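/- Let $\mathbf k$ be a field, $A$ an abelian group, and let $S=\mathbf k[x_0,\dots,x_n]$ be positively $A$-graded: there is a homomorphism $\theta\colon A\to\mathbb Z$ with $\theta(\deg x_i)>0$ for all $i$ (so $S_0=\mathbf k$). Let $E=\Lambda_{\mathbf k}(e_0,\dots,e_n)$, with the $A\oplus\mathbb Z$-grading $\deg e_i=(-\deg x_i;-1)$. A differential $E$-module is an $A\oplus\mathbb Z$-graded right $E$-module $D$ with a square-zero $E$-linear endomorphism $\partial_D$ of degree $(0;-1)$; we put $e_i d=(-1)^{j}d e_i$ for $d\in D_{(a;j)}$, and $H(D)=\ker\partial_D/\operatorname{im}\partial_D$ is a differential $E$-module with zero differential. Let $\mathbf L(D)$ be the complex of $A$-graded $S$-modules with $$\mathbf L(D)_j=\bigoplus_{a\in A}S(-a)\otimes_{\mathbf k}D_{(a;j)},\qquad s\otimes d\mapsto\Big(\sum_i x_is\otimes e_id\Big)-s\otimes\partial_D(d),$$ and let $\overline{\mathbf L(D)}$ be the complex with the same terms and with differential $s\otimes d\mapsto -s\otimes\partial_D(d)$ only. With $\omega_E=\operatorname{Hom}_{\mathbf k}(E,\mathbf k)$,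 a complex $C$ of $A$-graded $S$-modules gives the differential $E$-module $$\mathbf R(C)=\bigoplus_{j\in\mathbb Z}\bigoplus_{a\in A}(C_j)_a\otimes_{\mathbf k}\omega_E(-a;-j),\qquad c\otimes f\mapsto(-1)^j\Big(\sum_i x_ic\otimes e_if\Big)+\partial_C(c)\otimes f\quad(c\in C_j).$$ The terms of a complex $C$ are bounded below in $A$-degrees if there is a homomorphism $\theta\colon A\to\mathbb Z$ with $\theta(\deg x_i)>0$ for all $i$ such that, for each $j$, $(C_j)_a=0$ whenever $\theta(a)\ll 0$; and $C$ is homologically bounded below if $H_j(C)=0$ for $j\ll0$. A minimal free resolution of a complex $G$ is a quasi-isomorphism $F\to G$ of complexes of $A$-graded $S$-modules, where $F$ is a homologically bounded below complex of free graded modules, with terms bounded below in $A$-degrees, that is minimal: $\partial_F(F)\subseteq(x_0,\dots,x_n)F$. A degree-preserving map of free $A$-graded $S$-modules is strongly linear if there are homogeneous bases of its source and target in which its matrix has entries that are $\mathbf k$-linear combinations of $x_0,\dots,x_n$. Let $G$ be a homologically bounded below complex of $A$-graded $S$-modules whose terms are bounded below in $A$-degrees. Let $(\pi,\iota,h)$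 be a contraction of $\overline{\mathbf L\mathbf R(G)}$ onto $\overline{\mathbf L(H(\mathbf R(G)))}$ in the category of complexes of $A$-graded $S$-modules: $\pi,\iota$ are chain maps with $\pi\iota=\mathrm{id}$, $h$ is a null homotopy of $\mathrm{id}-\iota\pi$, and $\pi h=0$, $h\iota=0$, $h^2=0$. Assume that $\pi$ induces on homology the canonical identification $H(\overline{\mathbf L\mathbf R(G)})=S\otimes_{\mathbf k}H(\mathbf R(G))$, that is, $\pi(1\otimes z)=1\otimes[z]$ for all cycles $z$ of $\mathbf R(G)$. Let $\partial'$ be the endomorphism $s\otimes d\mapsto\sum_i x_is\otimes e_id$ of $\mathbf L\mathbf R(G)$, and put $$\delta_i=(-1)^{i-1}\pi(\partial'h)^{i-1}\partial'\iota\qquad(i\ge1).$$ Then for each $x\in\mathbf L(H(\mathbf R(G)))$ only finitely many $\delta_i(x)$ are nonzero. Let $\delta$ be the differential of $\mathbf L(H(\mathbf R(G)))$, and let $F$ have the same underlying module as $\mathbf L(H(\mathbf R(G)))$ and the differential $\delta+\sum_{i\ge2}\delta_i$. Then $F$ is a complex, and it is the minimal free resolution of $G$. If $G_j=0$ for all $j<m$,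 then $F_j=0$ for all $j<m$; if $\theta\colon A\to\mathbb Z$ is a homomorphism with $\theta(\deg x_i)>0$ for all $i$, $N\in\mathbb Z$, and $(G_j)_a=0$ for all $j$ and all $a$ with $\theta(a)<N$, then the same holds for $F$. Moreover, each $\delta_i$, $i\ge1$, is an $i$-fold composition of strongly linear maps. If $\pi,\iota,h$ are obtained from $\mathbf k$-linear maps by extension of scalars to $S$, then the $i$ maps can moreover be chosen to have matrices of linear forms with respect to one homogeneous basis of each module occurring, where the basis of $F$, as source and as target, is the same for all $i$. -/

import Mathlib

open scoped TensorProduct DirectSum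

namespace MultigradedBGG

set_option linter.unusedSectionVars false

universe u uk uA

noncomputable section

section Gradings

variable {k : Type*} [Field k] {ι κ l : Type*} [DecidableEq ι]
variable {M N : Type*} [AddCommGroup M] [Module k M] [AddCommGroup N] [Module k N]

/-- The decomposition of a graded vector space into its components. -/
def decomp {gr : ι → Submodule k M} (h : DirectSum.IsInternal gr) : M ≃ₗ[k] ⨁ i, gr i :=
  (LinearEquiv.ofBijective (DirectSum.coeLinearMap gr) (by exact h)).symm

theorem decomp_of_mem {gr : ι → Submodule k M} (h : DirectSum.IsInternal gr) {i : ι} {m : M}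
    (hm : m ∈ gr i) : decomp h m = DirectSum.lof k ι (fun i => gr i) i ⟨m, hm⟩ := by
  rw [decomp, LinearEquiv.symm_apply_eq]
  exact (DirectSum.coeLinearMap_lof gr i ⟨m, hm⟩).symm

/-- The projection of a graded vector space onto its component of degree `i`. -/
def component {gr : ι → Submodule k M} (h : DirectSum.IsInternal gr) (i : ι) : M →ₗ[k] M :=
  (gr i).subtype ∘ₗ DirectSum.component k ι (fun i => gr i) i ∘ₗ (decomp h).toLinearMap

theorem component_of_mem {gr : ι → Submodule k M} (h : DirectSum.IsInternal gr) {i : ι} {m : M}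
    (hm : m ∈ gr i) : component h i m = m := by
  simp [component, decomp_of_mem h hm, DirectSum.component.lof_self]

theorem component_of_mem_ne {gr : ι → Submodule k M} (h : DirectSum.IsInternal gr) {i j : ι}
    (hij : i ≠ j) {m : M} (hm : m ∈ gr j) : component h i m = 0 := by
  simp [component, decomp_of_mem h hm, DirectSum.component.of, hij.symm]

theorem component_mem {gr : ι → Submodule k M} (h : DirectSum.IsInternal gr) (i : ι) (m : M) :
    component h i m ∈ gr i := by
  simp [component]

theorem exists_sum_component {gr : ι → Submodule k M} (h : DirectSum.IsInternal gr) (m : M) :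
    ∃ s : Finset ι, m = ∑ i ∈ s, component h i m := by
  classical
  refine ⟨DFinsupp.support (decomp h m), ?_⟩
  have h1 : DirectSum.coeLinearMap gr (decomp h m) = m :=
    (LinearEquiv.ofBijective (DirectSum.coeLinearMap gr) (by exact h)).apply_symm_apply m
  refine h1.symm.trans ?_
  rw [DirectSum.coeLinearMap_eq_dfinsuppSum]
  rfl

theorem grading_induction {gr : ι → Submodule k M} (h : DirectSum.IsInternal gr)
    {P : M → Prop} (h0 : P 0) (ha : ∀ x y, P x → P y → P (x + y))
    (hm : ∀ i, ∀ m ∈ gr i, P m) (m : M) : P m := by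
  have : m ∈ iSup gr := by rw [h.submodule_iSup_eq_top]; trivial
  exact Submodule.iSup_induction gr (motive := P) this hm h0 ha

theorem linearMap_ext_grading {gr : ι → Submodule k M} (h : DirectSum.IsInternal gr)
    {f g : M →ₗ[k] N} (hfg : ∀ i, ∀ m ∈ gr i, f m = g m) : f = g := by
  ext m
  refine grading_induction h (P := fun m => f m = g m) (by simp) ?_ hfg m
  intro x y hx hy
  simp [hx, hy]

theorem isInternal_of_proj {gr : ι → Submodule k M} (pr : ι → M →ₗ[k] M)
    (h1 : ∀ i, ∀ m ∈ gr i, pr i m = m) (h2 : ∀ i j, i ≠ j → ∀ m ∈ gr j, pr i m = 0)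
    (h3 : ∀ m, m ∈ iSup gr) : DirectSum.IsInternal gr := by
  rw [DirectSum.isInternal_submodule_iff_iSupIndep_and_iSup_eq_top]
  refine ⟨?_, eq_top_iff.2 fun m _ => h3 m⟩
  intro i
  rw [Submodule.disjoint_def]
  intro x hx hx'
  rw [← h1 i x hx]
  have : (⨆ j, ⨆ (_ : j ≠ i), gr j) ≤ LinearMap.ker (pr i) :=
    iSup_le fun j => iSup_le fun hj m hm => h2 i j hj.symm m hm
  exact this hx'

/-- The `k`-linear endomorphism acting on the component of degree `i` as multiplication by
`(-1) ^ s i`. -/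
def signOp {gr : ι → Submodule k M} (h : DirectSum.IsInternal gr) (s : ι → ℤ) : M →ₗ[k] M :=
  DirectSum.toModule k ι M (fun i => ((s i).negOnePow : ℤ) • (gr i).subtype) ∘ₗ
    (decomp h).toLinearMap

theorem signOp_of_mem {gr : ι → Submodule k M} (h : DirectSum.IsInternal gr) (s : ι → ℤ)
    {i : ι} {m : M} (hm : m ∈ gr i) : signOp h s m = ((s i).negOnePow : ℤ) • m := by
  simp [signOp, decomp_of_mem h hm]

/-- The grading of `M ⊗ N` in which `m ⊗ n` has degree `f i j` for `m` of degree `i` and `n` of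
degree `j`. -/
def tensorGr (f : ι → κ → l) (V : ι → Submodule k M) (W : κ → Submodule k N) (c : l) :
    Submodule k (M ⊗[k] N) :=
  ⨆ (i : ι) (j : κ) (_ : f i j = c), Submodule.map₂ (TensorProduct.mk k M N) (V i) (W j)

theorem tmul_mem_tensorGr (f : ι → κ → l) {V : ι → Submodule k M} {W : κ → Submodule k N}
    {i : ι} {j : κ} {m : M} {x : N} (hm : m ∈ V i) (hx : x ∈ W j) {c : l} (hc : f i j = c) :
    m ⊗ₜ[k] x ∈ tensorGr f V W c :=
  le_iSup_of_le (f := fun i => ⨆ (j : κ) (_ : f i j = c),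
      Submodule.map₂ (TensorProduct.mk k M N) (V i) (W j)) i
    (le_iSup_of_le (f := fun j => ⨆ (_ : f i j = c),
      Submodule.map₂ (TensorProduct.mk k M N) (V i) (W j)) j
      (le_iSup_of_le hc le_rfl)) (Submodule.apply_mem_map₂ (TensorProduct.mk k M N) hm hx)

theorem tensorGr_le {f : ι → κ → l} {V : ι → Submodule k M} {W : κ → Submodule k N} {c : l}
    {P : Submodule k (M ⊗[k] N)}
    (h : ∀ i j, f i j = c → ∀ m ∈ V i, ∀ x ∈ W j, m ⊗ₜ[k] x ∈ P) : tensorGr f V W c ≤ P :=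
  iSup_le fun i => iSup_le fun j => iSup_le fun hc => Submodule.map₂_le.2 fun m hm x hx =>
    h i j hc m hm x hx

theorem isInternal_tensorGr [DecidableEq κ] [DecidableEq l] (f : ι → κ → l) {V : ι → Submodule k M} {W : κ → Submodule k N}
    (hV : DirectSum.IsInternal V) (hW : DirectSum.IsInternal W) :
    DirectSum.IsInternal (tensorGr f V W) := by
  classical
  let T := tensorGr f V W
  let eV := decomp hV
  let eW := decomp hW
  let g : ∀ i j, V i →ₗ[k] W j →ₗ[k] ⨁ c, T c := fun i j =>
    LinearMap.mk₂ k (fun m x => DirectSum.lof k l (fun c => T c) (f i j)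
      ⟨(m : M) ⊗ₜ[k] (x : N), tmul_mem_tensorGr f m.2 x.2 rfl⟩)
      (fun _ _ _ => by rw [← map_add]; congr 1; ext; simp [TensorProduct.add_tmul])
      (fun _ _ _ => by rw [← map_smul]; congr 1)
      (fun _ _ _ => by rw [← map_add]; congr 1; ext; simp [TensorProduct.tmul_add])
      (fun _ _ _ => by rw [← map_smul]; congr 1; ext; simp)
  let dec : M ⊗[k] N →ₗ[k] ⨁ c, T c := TensorProduct.lift
    ((DirectSum.toModule k ι _ (fun i => LinearMap.flip
      ((DirectSum.toModule k κ _ (fun j => (g i j).flip)) ∘ₗ eW.toLinearMap))) ∘ₗ eV.toLinearMap)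
  have hdec : ∀ i j m x (hm : m ∈ V i) (hx : x ∈ W j), dec (m ⊗ₜ x) =
      DirectSum.lof k l (fun c => T c) (f i j) ⟨m ⊗ₜ x, tmul_mem_tensorGr f hm hx rfl⟩ := by
    intro i j m x hm hx
    simp [dec, eV, eW, decomp_of_mem hV hm, decomp_of_mem hW hx, g]
  refine (DirectSum.Decomposition.ofLinearMap T dec ?_ ?_).isInternal
  · apply TensorProduct.ext
    refine linearMap_ext_grading hV fun i m hm => ?_
    refine linearMap_ext_grading hW fun j x hx => ?_
    simp [hdec i j m x hm hx]
  · refine DirectSum.linearMap_ext k fun c => ?_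
    ext ⟨t, ht⟩ : 1
    simp only [LinearMap.comp_apply, DirectSum.coeLinearMap_lof, LinearMap.id_apply]
    have key : T c ≤ LinearMap.ker ((LinearMap.id : M ⊗[k] N →ₗ[k] M ⊗[k] N) -
        (T c).subtype ∘ₗ DirectSum.component k l (fun c => T c) c ∘ₗ dec) ⊓
        ⨅ (c') (_ : c' ≠ c), LinearMap.ker (DirectSum.component k l (fun c => T c) c' ∘ₗ dec) := by
      refine tensorGr_le ?_
      rintro i j rfl m hm x hx
      simp only [Submodule.mem_inf, Submodule.mem_iInf, LinearMap.mem_ker, LinearMap.sub_apply,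
        LinearMap.comp_apply, hdec i j m x hm hx]
      refine ⟨by simp [DirectSum.component.lof_self], fun c' hc' => ?_⟩
      rw [DirectSum.component.of, dif_neg hc'.symm]
    obtain ⟨k1, k2⟩ := key ht
    refine DirectSum.ext_component k fun c' => ?_
    by_cases hc : c' = c
    · subst hc
      rw [DirectSum.component.lof_self]
      apply Subtype.ext
      simp only [SetLike.mem_coe, LinearMap.mem_ker, LinearMap.sub_apply, sub_eq_zero] at k1
      exact k1.symm
    · simp only [SetLike.mem_coe, Submodule.mem_iInf, LinearMap.mem_ker] at k2
      rw [DirectSum.component.of, dif_neg (Ne.symm hc)]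
      exact k2 c' hc

theorem sum_sum_eq_zero_of_antisymm {m : ℕ} (T : Fin m → Fin m → M) (h0 : ∀ i, T i i = 0)
    (h1 : ∀ i j, T i j = - T j i) : ∑ i, ∑ j, T i j = 0 := by
  rw [← Finset.sum_product']
  refine Finset.sum_involution (fun p _ => p.swap) ?_ ?_ ?_ ?_
  · rintro ⟨i, j⟩ _
    simp [h1 i j]
  · rintro ⟨i, j⟩ _ h h'
    simp only [Prod.swap_prod_mk, Prod.mk.injEq] at h'
    obtain ⟨rfl, -⟩ := h'
    exact h (h0 _)
  · simp
  · simp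

theorem linearCombination_sq {m : ℕ} {B : Type*} [Ring B] [Algebra k B] (t : Fin m → B)
    (h0 : ∀ i, t i * t i = 0) (h1 : ∀ i j, t i * t j = - (t j * t i)) (v : Fin m → k) :
    Fintype.linearCombination k t v * Fintype.linearCombination k t v = 0 := by
  simp only [Fintype.linearCombination_apply]
  rw [Finset.sum_mul_sum]
  refine sum_sum_eq_zero_of_antisymm _ (fun i => ?_) fun i j => ?_
  · rw [smul_mul_smul_comm, h0, smul_zero]
  · rw [smul_mul_smul_comm, smul_mul_smul_comm, h1 i j, smul_neg, mul_comm]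

end Gradings

section Algebras

/-- The polynomial ring `S = k[x_0, …, x_n]`. -/
abbrev Poly (k : Type uk) [Field k] (n : ℕ) : Type uk := MvPolynomial (Fin (n + 1)) k

/-- The exterior algebra `E = Λ_k(e_0, …, e_n)`. -/
abbrev Ext (k : Type uk) [Field k] (n : ℕ) : Type uk := ExteriorAlgebra k (Fin (n + 1) → k)

/-- The exterior variable `e_i`. -/
def extVar (k : Type uk) [Field k] (n : ℕ) (i : Fin (n + 1)) : Ext k n :=
  ExteriorAlgebra.ι k (Pi.single i 1)

variable {k : Type uk} [Field k] {n : ℕ} {A : Type uA} [AddCommGroup A] [DecidableEq A]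

theorem extVar_sq (i : Fin (n + 1)) : extVar k n i * extVar k n i = 0 :=
  ExteriorAlgebra.ι_sq_zero _

theorem extVar_anticomm (i j : Fin (n + 1)) :
    extVar k n i * extVar k n j = - (extVar k n j * extVar k n i) :=
  eq_neg_of_add_eq_zero_left (ExteriorAlgebra.ι_add_mul_swap _ _)

/-- The `A ⊕ ℤ`-grading of `E` with `deg e_i = (-deg x_i; -1)`: the component of degree `d` is
spanned by the products of the `e_i` of total degree `d`. -/
def extGr (w : Fin (n + 1) → A) (d : A × ℤ) : Submodule k (Ext k n) :=
  Submodule.span k {y | ∃ v : List (Fin (n + 1)), (v.map fun i => (-w i, (-1 : ℤ))).sum = d ∧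
    (v.map (extVar k n)).prod = y}

theorem extVar_mem_extGr (w : Fin (n + 1) → A) (i : Fin (n + 1)) :
    extVar k n i ∈ extGr (k := k) w (-w i, -1) :=
  Submodule.subset_span ⟨[i], by simp, by simp⟩

instance extGr_gradedMonoid (w : Fin (n + 1) → A) : SetLike.GradedMonoid (extGr (k := k) w) where
  one_mem := Submodule.subset_span ⟨[], by simp, by simp⟩
  mul_mem := by
    intro d d' x y hx hy
    have : extGr (k := k) w d * extGr (k := k) w d' ≤ extGr (k := k) w (d + d') := by
      rw [extGr, extGr, Submodule.span_mul_span]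
      refine Submodule.span_le.2 ?_
      rintro _ ⟨_, ⟨v, hv, rfl⟩, _, ⟨v', hv', rfl⟩, rfl⟩
      exact Submodule.subset_span ⟨v ++ v', by simp [hv, hv'], by simp⟩
    exact this (Submodule.mul_mem_mul hx hy)

theorem isInternal_extGr (w : Fin (n + 1) → A) : DirectSum.IsInternal (extGr (k := k) w) := by
  let 𝒜 := extGr (k := k) w
  let t : Fin (n + 1) → ⨁ d, 𝒜 d := fun i =>
    DirectSum.of (fun d => 𝒜 d) (-w i, -1) ⟨extVar k n i, extVar_mem_extGr w i⟩
  have ht0 : ∀ i, t i * t i = 0 := by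
    intro i
    simp only [t]
    rw [DirectSum.of_mul_of]
    exact DFinsupp.single_eq_zero.mpr (Subtype.ext (extVar_sq i))
  have ht1 : ∀ i j, t i * t j = - (t j * t i) := by
    intro i j
    simp only [t]
    rw [DirectSum.of_mul_of, DirectSum.of_mul_of, ← map_neg]
    refine DirectSum.of_eq_of_gradedMonoid_eq (Sigma.subtype_ext (add_comm _ _) ?_)
    exact extVar_anticomm i j
  let φ : (Fin (n + 1) → k) →ₗ[k] ⨁ d, 𝒜 d := Fintype.linearCombination k t
  have hφ : ∀ v, φ v * φ v = 0 := linearCombination_sq t ht0 ht1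
  let Φ : Ext k n →ₐ[k] ⨁ d, 𝒜 d := ExteriorAlgebra.lift k ⟨φ, hφ⟩
  have hΦ : ∀ i, Φ (extVar k n i) = t i := by
    intro i
    simp [Φ, extVar, φ, Fintype.linearCombination_apply_single]
  have hlist : ∀ v : List (Fin (n + 1)), ∀ h : (v.map (extVar k n)).prod ∈
      𝒜 (v.map fun i => (-w i, (-1 : ℤ))).sum, Φ (v.map (extVar k n)).prod =
      DirectSum.of (fun d => 𝒜 d) _ ⟨_, h⟩ := by
    intro v
    induction v with
    | nil =>
      intro h
      simp only [List.map_nil, List.prod_nil, map_one]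
      rfl
    | cons i v ih =>
      intro h
      have h' : (v.map (extVar k n)).prod ∈ 𝒜 (v.map fun i => (-w i, (-1 : ℤ))).sum :=
        Submodule.subset_span ⟨v, rfl, rfl⟩
      simp only [List.map_cons, List.prod_cons, map_mul, ih h', hΦ, t]
      rw [DirectSum.of_mul_of]
      exact DirectSum.of_eq_of_gradedMonoid_eq (Sigma.subtype_ext rfl rfl)
  refine (GradedAlgebra.ofAlgHom 𝒜 Φ ?_ ?_).isInternal
  · ext i
    simp only [LinearMap.comp_apply, AlgHom.toLinearMap_apply, AlgHom.comp_apply, AlgHom.id_apply,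
      LinearMap.single_apply]
    have := hΦ i
    simp only [extVar] at this
    rw [this]
    simp [t, extVar]
  · rintro d ⟨x, hx⟩
    have key : ∀ x (hx : x ∈ 𝒜 d), Φ x = DirectSum.lof k _ (fun d => 𝒜 d) d ⟨x, hx⟩ := by
      intro x hx
      refine Submodule.span_induction (p := fun x hx => Φ x =
        DirectSum.lof k _ (fun d => 𝒜 d) d ⟨x, hx⟩) ?_ ?_ ?_ ?_ hx
      · rintro _ ⟨v, rfl, rfl⟩
        exact hlist v _
      · rw [map_zero]
        exact (map_zero _).symm
      · intro x y hx hy h1 h2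
        rw [map_add, h1, h2, ← map_add]
        rfl
      · intro a x hx h1
        rw [map_smul, h1, ← map_smul]
        rfl
    exact key x hx

/-- `ω_E = Hom_k(E, k)`. -/
abbrev Omega (k : Type uk) [Field k] (n : ℕ) : Type uk := Module.Dual k (Ext k n)

/-- The right `E`-module structure `(f e)(y) = f (e y)` on `ω_E`, as an action of `Eᵐᵒᵖ`. -/
def omegaAct (k : Type uk) [Field k] (n : ℕ) : (Ext k n)ᵐᵒᵖ →ₐ[k] Module.End k (Omega k n) where
  toFun e := Module.Dual.transpose (R := k) (LinearMap.mulLeft k e.unop)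
  map_one' := by ext; simp [Module.Dual.transpose_apply]
  map_mul' a b := by ext; simp [Module.Dual.transpose_apply]
  map_zero' := by ext; simp
  map_add' a b := by ext; simp [Module.Dual.transpose_apply, add_mul]
  commutes' r := by
    ext; simp [Module.Dual.transpose_apply, Algebra.algebraMap_eq_smul_one]

theorem omegaAct_apply (e : Ext k n) (f : Omega k n) (y : Ext k n) :
    omegaAct k n (MulOpposite.op e) f y = f (e * y) := rfl

/-- The component `(ω_E)_d = Hom_k(E_{-d}, k)`: the functionals on `E` vanishing on all the
components of `E` of degree different from `-d`. -/
def omegaGr (w : Fin (n + 1) → A) (d : A × ℤ) : Submodule k (Omega k n) where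
  carrier := {f | ∀ d', d' ≠ -d → ∀ y ∈ extGr (k := k) w d', f y = 0}
  add_mem' hf hg d' hd y hy := by simp [hf d' hd y hy, hg d' hd y hy]
  zero_mem' _ _ _ _ := rfl
  smul_mem' a f hf d' hd y hy := by simp [hf d' hd y hy]

instance ext_finite (k : Type uk) [Field k] (n : ℕ) : Module.Finite k (Ext k n) :=
  Module.Finite.of_basis (Module.Basis.ExteriorAlgebra (Pi.basisFun k (Fin (n + 1))))

theorem isInternal_omegaGr (w : Fin (n + 1) → A) :
    DirectSum.IsInternal (omegaGr (k := k) w) := by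
  have hE := isInternal_extGr (k := k) w
  refine isInternal_of_proj
    (fun d => Module.Dual.transpose (R := k) (component hE (-d))) ?_ ?_ ?_
  · intro d f hf
    refine linearMap_ext_grading hE fun d' y hy => ?_
    rw [Module.Dual.transpose_apply, LinearMap.comp_apply]
    by_cases h : d' = -d
    · subst h
      rw [component_of_mem hE hy]
    · rw [component_of_mem_ne hE (Ne.symm h) hy, map_zero, hf d' h y hy]
  · intro d d₁ hd f hf
    refine linearMap_ext_grading hE fun d' y hy => ?_
    rw [Module.Dual.transpose_apply, LinearMap.comp_apply]
    exact hf (-d) (fun h => hd (neg_injective h)) _ (component_mem hE _ _)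
  · intro f
    have hfin : {d | extGr (k := k) w d ≠ ⊥}.Finite :=
      WellFoundedGT.finite_ne_bot_of_iSupIndep hE.submodule_iSupIndep
    have : f = ∑ d ∈ hfin.toFinset, f ∘ₗ component hE d := by
      refine linearMap_ext_grading hE fun d' y hy => ?_
      rw [LinearMap.sum_apply]
      by_cases hd : extGr (k := k) w d' = ⊥
      · rw [hd, Submodule.mem_bot] at hy
        simp [hy]
      · rw [Finset.sum_eq_single d']
        · rw [LinearMap.comp_apply, component_of_mem hE hy]
        · intro d _ hne
          rw [LinearMap.comp_apply, component_of_mem_ne hE hne hy, map_zero]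
        · intro h
          exact absurd (hfin.mem_toFinset.2 hd) h
    rw [this]
    refine Submodule.sum_mem _ fun d _ => Submodule.mem_iSup_of_mem (-d) ?_
    intro d' hd y hy
    rw [LinearMap.comp_apply, component_of_mem_ne hE _ hy, map_zero]
    rintro rfl
    exact hd (neg_neg _).symm

theorem omegaAct_mem (w : Fin (n + 1) → A) {d d' : A × ℤ} {f : Omega k n}
    (hf : f ∈ omegaGr (k := k) w d) {e : Ext k n} (he : e ∈ extGr (k := k) w d') :
    omegaAct k n (MulOpposite.op e) f ∈ omegaGr (k := k) w (d + d') := by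
  intro d₁ hd y hy
  rw [omegaAct_apply]
  refine hf _ (fun h => hd ?_) _ (SetLike.GradedMul.mul_mem (A := extGr (k := k) w) he hy)
  rw [neg_add, ← h]
  abel

/-- Left multiplication by `e_i` on `ω_E`: `e_i f = (-1) ^ aux(f) f e_i`. -/
def omegaLeft (w : Fin (n + 1) → A) (i : Fin (n + 1)) : Omega k n →ₗ[k] Omega k n :=
  omegaAct k n (MulOpposite.op (extVar k n i)) ∘ₗ signOp (isInternal_omegaGr (k := k) w) Prod.snd

end Algebras

section Objects

variable (k : Type uk) [Field k] {n : ℕ} {A : Type uA} [AddCommGroup A] [DecidableEq A]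

/-- A sequence `(M_j)_{j ∈ ℤ}` of `A`-graded `S`-modules, where `deg x_i = w i`, presented by its
total module `⨁_j M_j`: the component `gr (a, j)` is the degree `a` part of `M_j`. -/
structure GrMod (w : Fin (n + 1) → A) where
  carrier : Type u
  [addCommGroup : AddCommGroup carrier]
  [moduleK : Module k carrier]
  [moduleS : Module (Poly k n) carrier]
  [tower : IsScalarTower k (Poly k n) carrier]
  gr : A × ℤ → Submodule k carrier
  isInternal : DirectSum.IsInternal gr
  smul_mem : ∀ (b a : A) (j : ℤ), ∀ p ∈ MvPolynomial.weightedHomogeneousSubmodule k w b,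
    ∀ m ∈ gr (a, j), p • m ∈ gr (b + a, j)

attribute [instance] GrMod.addCommGroup GrMod.moduleK GrMod.moduleS GrMod.tower

instance (w : Fin (n + 1) → A) : CoeSort (GrMod.{u} k w) (Type u) := ⟨GrMod.carrier⟩

/-- A differential `E`-module: an `A ⊕ ℤ`-graded right `E`-module (that is, a module over `Eᵐᵒᵖ`)
with a square zero `E`-linear endomorphism of degree `(0; -1)`. -/
structure DiffMod (w : Fin (n + 1) → A) where
  carrier : Type u
  [addCommGroup : AddCommGroup carrier]
  [moduleK : Module k carrier]
  [moduleE : Module (Ext k n)ᵐᵒᵖ carrier]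
  [tower : IsScalarTower k (Ext k n)ᵐᵒᵖ carrier]
  gr : A × ℤ → Submodule k carrier
  isInternal : DirectSum.IsInternal gr
  smul_mem : ∀ (d d' : A × ℤ), ∀ m ∈ gr d, ∀ e ∈ extGr (k := k) w d',
    MulOpposite.op e • m ∈ gr (d + d')
  d : carrier →ₗ[(Ext k n)ᵐᵒᵖ] carrier
  d_mem : ∀ (a : A) (j : ℤ), ∀ m ∈ gr (a, j), d m ∈ gr (a, j - 1)
  d_sq : ∀ m, d (d m) = 0

attribute [instance] DiffMod.addCommGroup DiffMod.moduleK DiffMod.moduleE DiffMod.tower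

instance (w : Fin (n + 1) → A) : CoeSort (DiffMod.{u} k w) (Type u) := ⟨DiffMod.carrier⟩

variable {k} {w : Fin (n + 1) → A}

/-- `f` preserves `A`-degrees and raises the homological degree by `r`. -/
def IsHomogeneousMap {M N : GrMod k w} (f : M →ₗ[Poly k n] N) (r : ℤ) : Prop :=
  ∀ (a : A) (j : ℤ), ∀ m ∈ M.gr (a, j), f m ∈ N.gr (a, j + r)

/-- `d` is a differential: it lowers the homological degree by one, preserves `A`-degrees and
squares to zero. -/
structure IsDifferential (M : GrMod k w) (d : M →ₗ[Poly k n] M) : Prop where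
  homogeneous : IsHomogeneousMap d (-1)
  sq : ∀ m, d (d m) = 0

variable (k w) in
/-- A complex of `A`-graded `S`-modules. -/
structure Cpx where
  toGrMod : GrMod.{u} k w
  d : toGrMod →ₗ[Poly k n] toGrMod
  isDifferential : IsDifferential toGrMod d

instance : CoeSort (Cpx.{u} k w) (Type u) := ⟨fun C => C.toGrMod.carrier⟩

/-- Multiplication by the variable `x_i`. -/
def GrMod.mulVar (M : GrMod k w) (i : Fin (n + 1)) : M →ₗ[k] M :=
  (LinearMap.lsmul (Poly k n) M (MvPolynomial.X i)).restrictScalars k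

/-- The homological sign `m ↦ (-1) ^ j m` for `m ∈ M_j`. -/
def GrMod.sign (M : GrMod k w) : M →ₗ[k] M := signOp M.isInternal Prod.snd

theorem GrMod.X_smul_mem (M : GrMod k w) (i : Fin (n + 1)) {a : A} {j : ℤ} {m : M}
    (hm : m ∈ M.gr (a, j)) : (MvPolynomial.X i : Poly k n) • m ∈ M.gr (w i + a, j) :=
  M.smul_mem (w i) a j _ (MvPolynomial.isWeightedHomogeneous_X k w i) m hm

/-- Right multiplication `m ↦ m e_i`. -/
def DiffMod.rightVar (D : DiffMod k w) (i : Fin (n + 1)) : D →ₗ[k] D :=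
  { toFun := fun m => MulOpposite.op (extVar k n i) • m
    map_add' := smul_add _
    map_smul' := fun r m => (smul_comm r (MulOpposite.op (extVar k n i)) m).symm }

/-- Left multiplication `e_i m = (-1) ^ aux(m) m e_i`. -/
def DiffMod.leftVar (D : DiffMod k w) (i : Fin (n + 1)) : D →ₗ[k] D :=
  D.rightVar i ∘ₗ signOp D.isInternal Prod.snd

end Objects

section FunctorL

variable {k : Type uk} [Field k] {n : ℕ} {A : Type uA} [AddCommGroup A] [DecidableEq A]
variable {w : Fin (n + 1) → A}

theorem DiffMod.leftVar_of_mem (D : DiffMod k w) (i : Fin (n + 1)) {d : A × ℤ} {m : D}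
    (hm : m ∈ D.gr d) :
    D.leftVar i m = (d.2.negOnePow : ℤ) • (MulOpposite.op (extVar k n i) • m) := by
  rw [leftVar, LinearMap.comp_apply, signOp_of_mem D.isInternal Prod.snd hm, map_zsmul]
  rfl

theorem DiffMod.rightVar_mem (D : DiffMod k w) (i : Fin (n + 1)) {a : A} {j : ℤ} {m : D}
    (hm : m ∈ D.gr (a, j)) : MulOpposite.op (extVar k n i) • m ∈ D.gr (a - w i, j - 1) := by
  have := D.smul_mem _ _ m hm _ (extVar_mem_extGr w i)
  rwa [Prod.mk_add_mk, ← sub_eq_add_neg, ← sub_eq_add_neg] at this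

theorem DiffMod.leftVar_mem (D : DiffMod k w) (i : Fin (n + 1)) {a : A} {j : ℤ} {m : D}
    (hm : m ∈ D.gr (a, j)) : D.leftVar i m ∈ D.gr (a - w i, j - 1) := by
  rw [D.leftVar_of_mem i hm]
  exact zsmul_mem (D.rightVar_mem i hm) _

theorem DiffMod.leftVar_leftVar (D : DiffMod k w) (i j : Fin (n + 1)) {d : A × ℤ} {m : D}
    (hm : m ∈ D.gr d) :
    D.leftVar i (D.leftVar j m) = - (MulOpposite.op (extVar k n j * extVar k n i) • m) := by
  rw [D.leftVar_of_mem j hm, map_zsmul, D.leftVar_of_mem i (D.rightVar_mem j (a := d.1) hm),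
    smul_smul, smul_smul, Int.negOnePow_sub, ← MulOpposite.op_mul]
  have : ((d.2.negOnePow : ℤ) * ((d.2.negOnePow * Int.negOnePow 1 : ℤˣ) : ℤ)) = -1 := by
    rw [← Units.val_mul, ← mul_assoc, Int.units_mul_self]
    simp
  rw [this, neg_one_zsmul]

theorem DiffMod.d_leftVar (D : DiffMod k w) (i : Fin (n + 1)) (m : D) :
    D.d (D.leftVar i m) = - D.leftVar i (D.d m) := by
  have : (D.d.restrictScalars k) ∘ₗ D.leftVar i = - (D.leftVar i ∘ₗ D.d.restrictScalars k) := by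
    refine linearMap_ext_grading D.isInternal ?_
    rintro ⟨a, j⟩ m hm
    simp only [LinearMap.comp_apply, LinearMap.neg_apply, LinearMap.restrictScalars_apply]
    rw [D.leftVar_of_mem i hm, D.leftVar_of_mem i (D.d_mem a j m hm), map_zsmul, map_smul,
      Int.negOnePow_sub]
    simp
  exact LinearMap.congr_fun this m

/-- The underlying module of `L(D)`: `L(D)_j = ⨁_a S(-a) ⊗ D_(a;j)`, so that the total module is
`S ⊗ D` and `s ⊗ d` has degree `(b + a; j)` for `s ∈ S_b` and `d ∈ D_(a;j)`. -/
abbrev LMod (D : DiffMod.{u} k w) : GrMod.{max uk u} k w where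
  carrier := Poly k n ⊗[k] D
  gr := tensorGr (fun (b : A) (d : A × ℤ) => (b + d.1, d.2))
    (MvPolynomial.weightedHomogeneousSubmodule k w) D.gr
  isInternal := isInternal_tensorGr _
    (MvPolynomial.weightedDecomposition k w).isInternal D.isInternal
  smul_mem := by
    intro b a j p hp m hm
    let μ : Poly k n ⊗[k] D →ₗ[k] Poly k n ⊗[k] D :=
      (LinearMap.lsmul (Poly k n) (Poly k n ⊗[k] D) p).restrictScalars k
    change m ∈ (tensorGr _ _ _ (b + a, j)).comap μ
    refine tensorGr_le ?_ hm
    rintro c d hcd s hs x hx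
    rw [Submodule.mem_comap]
    change p • (s ⊗ₜ[k] x) ∈ _
    rw [TensorProduct.smul_tmul']
    refine tmul_mem_tensorGr _ (i := b + c) (hp.mul hs) hx ?_
    rw [Prod.mk.injEq] at hcd ⊢
    exact ⟨by rw [add_assoc, hcd.1], hcd.2⟩

/-- The `S`-linear endomorphism `∂'` of `L(D)` given by left multiplication by `∑ x_i ⊗ e_i`. -/
def dPrime (D : DiffMod k w) : Poly k n ⊗[k] D →ₗ[Poly k n] Poly k n ⊗[k] D :=
  ∑ i, (MvPolynomial.X i : Poly k n) • (D.leftVar i).baseChange (Poly k n)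

/-- The `S`-linear endomorphism `-∂_D` of `L(D)`, that is `s ⊗ d ↦ - s ⊗ ∂_D(d)`. -/
def dInternal (D : DiffMod k w) : Poly k n ⊗[k] D →ₗ[Poly k n] Poly k n ⊗[k] D :=
  - (D.d.restrictScalars k).baseChange (Poly k n)

theorem dPrime_tmul (D : DiffMod k w) (s : Poly k n) (m : D) :
    dPrime D (s ⊗ₜ[k] m) = ∑ i, (MvPolynomial.X i * s) ⊗ₜ[k] D.leftVar i m := by
  simp [dPrime, LinearMap.sum_apply, TensorProduct.smul_tmul']

theorem dInternal_tmul (D : DiffMod k w) (s : Poly k n) (m : D) :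
    dInternal D (s ⊗ₜ[k] m) = -(s ⊗ₜ[k] D.d m) := by
  simp [dInternal]

theorem LMod.hom_ext {D : DiffMod k w} 
    {f g : Poly k n ⊗[k] D →ₗ[Poly k n] Poly k n ⊗[k] D}
    (h : ∀ d, ∀ m ∈ D.gr d, f (1 ⊗ₜ[k] m) = g (1 ⊗ₜ[k] m)) : f = g := by
  apply TensorProduct.AlgebraTensorModule.curry_injective
  ext : 1
  exact linearMap_ext_grading D.isInternal h

theorem LMod.isHomogeneousMap {D D' : DiffMod k w} {f : LMod D →ₗ[Poly k n] LMod D'} {r : ℤ}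
    (h : ∀ a j, ∀ m ∈ D.gr (a, j), f (1 ⊗ₜ[k] m) ∈ (LMod D').gr (a, j + r)) :
    IsHomogeneousMap f r := by
  intro a j m hm
  change m ∈ ((LMod D').gr (a, j + r)).comap (f.restrictScalars k)
  refine tensorGr_le ?_ hm
  rintro b ⟨a', j'⟩ hd s hs x hx
  rw [Prod.mk.injEq] at hd
  obtain ⟨rfl, rfl⟩ := hd
  have := (LMod D').smul_mem b a' (j' + r) s hs _ (h a' j' x hx)
  rw [← map_smul, TensorProduct.smul_tmul', smul_eq_mul, mul_one] at this
  exact this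

theorem dPrime_homogeneous (D : DiffMod k w) : 
    IsHomogeneousMap (M := LMod D) (N := LMod D) (dPrime D) (-1) := by
  refine LMod.isHomogeneousMap fun a j m hm => ?_
  rw [dPrime_tmul]
  refine Submodule.sum_mem _ fun i _ => ?_
  rw [mul_one]
  refine tmul_mem_tensorGr _ (MvPolynomial.isWeightedHomogeneous_X k w i) (D.leftVar_mem i hm) ?_
  simp [sub_eq_add_neg]

theorem dInternal_homogeneous (D : DiffMod k w) : 
    IsHomogeneousMap (M := LMod D) (N := LMod D) (dInternal D) (-1) := by
  refine LMod.isHomogeneousMap fun a j m hm => ?_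
  rw [dInternal_tmul]
  exact neg_mem (tmul_mem_tensorGr _ (MvPolynomial.isWeightedHomogeneous_one k w)
    (D.d_mem a j m hm) (by simp [sub_eq_add_neg]))

theorem dPrime_dPrime (D : DiffMod k w) : dPrime D ∘ₗ dPrime D = 0 := by
  refine LMod.hom_ext fun d m hm => ?_
  rw [LinearMap.comp_apply, dPrime_tmul, map_sum, LinearMap.zero_apply]
  simp_rw [dPrime_tmul]
  refine sum_sum_eq_zero_of_antisymm _ (fun i => ?_) fun i j => ?_
  · rw [D.leftVar_leftVar i i hm, extVar_sq]
    simp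
  · rw [D.leftVar_leftVar j i hm, D.leftVar_leftVar i j hm, extVar_anticomm i j, mul_left_comm]
    simp [TensorProduct.tmul_neg]

theorem dInternal_dInternal (D : DiffMod k w) : dInternal D ∘ₗ dInternal D = 0 := by
  refine LMod.hom_ext fun d m hm => ?_
  simp [dInternal_tmul, D.d_sq]

theorem dPrime_dInternal (D : DiffMod k w) :
    dPrime D ∘ₗ dInternal D + dInternal D ∘ₗ dPrime D = 0 := by
  refine LMod.hom_ext fun d m hm => ?_
  simp only [LinearMap.add_apply, LinearMap.comp_apply, dInternal_tmul, dPrime_tmul, map_sum,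
    LinearMap.zero_apply, D.d_leftVar, map_neg, TensorProduct.tmul_neg, neg_neg]
  exact neg_add_cancel _

/-- The complex `L(D)`, with differential `s ⊗ d ↦ (∑ x_i s ⊗ e_i d) - s ⊗ ∂_D(d)`. -/
abbrev L (D : DiffMod.{u} k w) : Cpx.{max uk u} k w where
  toGrMod := LMod D
  d := dPrime D + dInternal D
  isDifferential := by
    refine ⟨fun a j m hm => add_mem (dPrime_homogeneous D a j m hm)
      (dInternal_homogeneous D a j m hm), fun m => ?_⟩
    have h1 := LinearMap.congr_fun (dPrime_dPrime D) m
    have h2 := LinearMap.congr_fun (dInternal_dInternal D) m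
    have h3 := LinearMap.congr_fun (dPrime_dInternal D) m
    simp only [LinearMap.comp_apply, LinearMap.zero_apply, LinearMap.add_apply] at h1 h2 h3 ⊢
    rw [map_add, map_add, h1, h2, zero_add, add_zero]
    exact h3

/-- The complex with the same underlying module as `L(D)` and with differential induced by
`-∂_D` only. -/
abbrev Lbar (D : DiffMod.{u} k w) : Cpx.{max uk u} k w where
  toGrMod := LMod D
  d := dInternal D
  isDifferential := ⟨dInternal_homogeneous D, LinearMap.congr_fun (dInternal_dInternal D)⟩

end FunctorL

section Homology

variable {k : Type uk} [Field k] {n : ℕ} {A : Type uA} [AddCommGroup A] [DecidableEq A]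
variable {w : Fin (n + 1) → A}

/-- The underlying `E`-module `ker ∂_D / im ∂_D` of `H(D)`. -/
abbrev DiffMod.HCarrier (D : DiffMod k w) : Type _ :=
  LinearMap.ker D.d ⧸ (LinearMap.range D.d).submoduleOf (LinearMap.ker D.d)

/-- The homology class of a cycle. -/
def DiffMod.cls (D : DiffMod k w) : LinearMap.ker D.d →ₗ[(Ext k n)ᵐᵒᵖ] D.HCarrier :=
  Submodule.mkQ _

/-- The classes of the cycles of degree `d`. -/
def DiffMod.homologyGr (D : DiffMod k w) (d : A × ℤ) : Submodule k D.HCarrier :=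
  ((D.gr d).comap ((LinearMap.ker D.d).subtype.restrictScalars k)).map
    (D.cls.restrictScalars k)

theorem DiffMod.mem_homologyGr (D : DiffMod k w) (d : A × ℤ) (x : D.HCarrier) :
    x ∈ D.homologyGr d ↔ ∃ z : LinearMap.ker D.d, (z : D) ∈ D.gr d ∧ D.cls z = x := Iff.rfl

theorem DiffMod.d_component (D : DiffMod k w) (a : A) (j : ℤ) (m : D) :
    D.d (component D.isInternal (a, j) m) = component D.isInternal (a, j - 1) (D.d m) := by
  have : (D.d.restrictScalars k) ∘ₗ component D.isInternal (a, j) =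
      component D.isInternal (a, j - 1) ∘ₗ (D.d.restrictScalars k) := by
    refine linearMap_ext_grading D.isInternal ?_
    rintro ⟨a', j'⟩ m hm
    have hd := D.d_mem a' j' m hm
    simp only [LinearMap.comp_apply, LinearMap.restrictScalars_apply]
    by_cases h : (a, j) = (a', j')
    · obtain ⟨rfl, rfl⟩ := Prod.mk.inj h
      rw [component_of_mem _ hm, component_of_mem _ hd]
    · rw [component_of_mem_ne _ h hm, component_of_mem_ne _ _ hd, map_zero]
      simpa using h
  exact LinearMap.congr_fun this m

theorem DiffMod.isInternal_homologyGr (D : DiffMod k w) :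
    DirectSum.IsInternal D.homologyGr := by
  have hker : ∀ d, ∀ z : LinearMap.ker D.d, component D.isInternal d (z : D) ∈
      LinearMap.ker D.d := by
    rintro ⟨a, j⟩ z
    rw [LinearMap.mem_ker, D.d_component, LinearMap.mem_ker.1 z.2, map_zero]
  let c : ∀ d, LinearMap.ker D.d →ₗ[k] LinearMap.ker D.d := fun d =>
    { toFun := fun z => ⟨component D.isInternal d z, hker d z⟩
      map_add' := fun x y => by ext; simp
      map_smul' := fun r x => by ext; simp }
  let B := (LinearMap.range D.d).submoduleOf (LinearMap.ker D.d)
  have hB : ∀ d, B.restrictScalars k ≤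
      LinearMap.ker (D.cls.restrictScalars k ∘ₗ c d) := by
    rintro ⟨a, j⟩ z ⟨y, hy⟩
    rw [LinearMap.mem_ker]
    refine (Submodule.Quotient.mk_eq_zero _).2 ?_
    refine ⟨component D.isInternal (a, j + 1) y, ?_⟩
    rw [D.d_component, hy, add_sub_cancel_right]
    rfl
  let pr : ∀ _ : A × ℤ, D.HCarrier →ₗ[k] D.HCarrier := fun d =>
    (B.restrictScalars k).liftQ (D.cls.restrictScalars k ∘ₗ c d) (hB d) ∘ₗ
      (Submodule.Quotient.restrictScalarsEquiv k B).symm.toLinearMap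
  have hpr : ∀ d z, pr d (D.cls z) = D.cls (c d z) := fun d z => rfl
  refine isInternal_of_proj pr ?_ ?_ ?_
  · rintro d _ ⟨z, hz, rfl⟩
    refine (hpr d z).trans (congrArg D.cls (Subtype.ext ?_))
    exact component_of_mem _ hz
  · rintro d d' hd _ ⟨z, hz, rfl⟩
    refine (hpr d z).trans ?_
    rw [← map_zero D.cls]
    exact congrArg D.cls (Subtype.ext (component_of_mem_ne _ hd hz))
  · intro x
    obtain ⟨z, rfl⟩ := Submodule.mkQ_surjective _ x
    obtain ⟨s, hs⟩ := exists_sum_component D.isInternal (z : D)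
    have hz : z = ∑ d ∈ s, c d z := by
      apply Subtype.ext
      rw [AddSubmonoidClass.coe_finsetSum]
      exact hs
    change D.cls z ∈ _
    rw [hz, map_sum]
    refine Submodule.sum_mem _ fun d _ => Submodule.mem_iSup_of_mem d ?_
    exact ⟨c d z, component_mem _ _ _, rfl⟩

/-- The homology `H(D)`, a differential `E`-module with trivial differential. -/
abbrev H (D : DiffMod.{u} k w) : DiffMod.{u} k w where
  carrier := D.HCarrier
  gr := D.homologyGr
  isInternal := D.isInternal_homologyGr
  smul_mem := by
    rintro d d' _ ⟨z, hz, rfl⟩ e he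
    exact ⟨MulOpposite.op e • z, D.smul_mem d d' z hz e he, map_smul D.cls _ _⟩
  d := 0
  d_mem := fun _ _ _ _ => zero_mem _
  d_sq := fun _ => rfl

end Homology

section FunctorR

variable {k : Type uk} [Field k] {n : ℕ} {A : Type uA} [AddCommGroup A] [DecidableEq A]
variable {w : Fin (n + 1) → A}

theorem omegaLeft_of_mem (i : Fin (n + 1)) {d : A × ℤ} {f : Omega k n}
    (hf : f ∈ omegaGr (k := k) w d) : omegaLeft w i f =
      (d.2.negOnePow : ℤ) • omegaAct k n (MulOpposite.op (extVar k n i)) f := by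
  rw [omegaLeft, LinearMap.comp_apply, signOp_of_mem _ Prod.snd hf, map_zsmul]

theorem omegaAct_var_mem (i : Fin (n + 1)) {d : A × ℤ} {f : Omega k n}
    (hf : f ∈ omegaGr (k := k) w d) :
    omegaAct k n (MulOpposite.op (extVar k n i)) f ∈ omegaGr (k := k) w (d.1 - w i, d.2 - 1) := by
  have := omegaAct_mem w hf (extVar_mem_extGr w i)
  obtain ⟨a, j⟩ := d
  rwa [Prod.mk_add_mk, ← sub_eq_add_neg, ← sub_eq_add_neg] at this

theorem omegaLeft_mem (i : Fin (n + 1)) {d : A × ℤ} {f : Omega k n}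
    (hf : f ∈ omegaGr (k := k) w d) :
    omegaLeft w i f ∈ omegaGr (k := k) w (d.1 - w i, d.2 - 1) := by
  rw [omegaLeft_of_mem i hf]
  exact zsmul_mem (omegaAct_var_mem i hf) _

theorem omegaAct_omegaAct (e e' : Ext k n) (f : Omega k n) :
    omegaAct k n (MulOpposite.op e) (omegaAct k n (MulOpposite.op e') f) =
      omegaAct k n (MulOpposite.op (e' * e)) f := by
  rw [MulOpposite.op_mul, map_mul]
  rfl

theorem omegaLeft_omegaLeft (i j : Fin (n + 1)) {d : A × ℤ} {f : Omega k n}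
    (hf : f ∈ omegaGr (k := k) w d) : omegaLeft w i (omegaLeft w j f) =
      - omegaAct k n (MulOpposite.op (extVar k n j * extVar k n i)) f := by
  rw [omegaLeft_of_mem j hf, map_zsmul, omegaLeft_of_mem i (omegaAct_var_mem j hf),
    smul_smul, omegaAct_omegaAct, Int.negOnePow_sub]
  have : ((d.2.negOnePow : ℤ) * ((d.2.negOnePow * Int.negOnePow 1 : ℤˣ) : ℤ)) = -1 := by
    rw [← Units.val_mul, ← mul_assoc, Int.units_mul_self]
    simp
  rw [this, neg_one_zsmul]

/-- Left and right multiplication on `ω_E` commute. -/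
theorem omegaLeft_omegaAct (i : Fin (n + 1)) (e : Ext k n) :
    omegaLeft w i ∘ₗ omegaAct k n (MulOpposite.op e) =
      omegaAct k n (MulOpposite.op e) ∘ₗ omegaLeft w i := by
  induction e using ExteriorAlgebra.induction with
  | algebraMap r =>
    rw [← MulOpposite.algebraMap_apply, AlgHom.commutes]
    ext f : 1
    simp [Module.algebraMap_end_apply]
  | ι v =>
    have hv : ExteriorAlgebra.ι k v = ∑ l, v l • extVar k n l := by
      conv_lhs => rw [pi_eq_sum_univ' v]
      rw [map_sum]
      refine Finset.sum_congr rfl fun l _ => ?_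
      rw [extVar, ← map_smul]
    have hl : ∀ l, omegaLeft w i ∘ₗ omegaAct k n (MulOpposite.op (extVar k n l)) =
        omegaAct k n (MulOpposite.op (extVar k n l)) ∘ₗ omegaLeft w i := by
      intro l
      refine linearMap_ext_grading (isInternal_omegaGr (k := k) w) fun d f hf => ?_
      rw [LinearMap.comp_apply, LinearMap.comp_apply, omegaLeft_of_mem i hf,
        omegaLeft_of_mem i (omegaAct_var_mem l hf), map_zsmul, omegaAct_omegaAct,
        omegaAct_omegaAct, extVar_anticomm, Int.negOnePow_sub]
      simp
    rw [hv, Finset.op_sum, map_sum]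
    ext f : 1
    simp only [LinearMap.comp_apply, LinearMap.sum_apply, map_sum]
    refine Finset.sum_congr rfl fun l _ => ?_
    rw [MulOpposite.op_smul, map_smul, LinearMap.smul_apply, LinearMap.smul_apply, map_smul]
    congr 1
    exact LinearMap.congr_fun (hl l) f
  | mul a b ha hb =>
    ext f : 1
    simp only [LinearMap.comp_apply]
    rw [← omegaAct_omegaAct, ← omegaAct_omegaAct]
    have h1 := LinearMap.congr_fun hb (omegaAct k n (MulOpposite.op a) f)
    have h2 := LinearMap.congr_fun ha f
    simp only [LinearMap.comp_apply] at h1 h2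
    rw [h1, h2]
  | add a b ha hb =>
    rw [MulOpposite.op_add, map_add, LinearMap.comp_add, LinearMap.add_comp, ha, hb]

/-- The differential of `R(C)` on `C ⊗ ω_E`: for `c ∈ C_j`,
`c ⊗ f ↦ (-1) ^ j (∑ x_i c ⊗ e_i f) + ∂_C(c) ⊗ f`. -/
def dR (C : Cpx k w) : C.toGrMod.carrier ⊗[k] Omega k n →ₗ[k] C.toGrMod.carrier ⊗[k] Omega k n :=
  ∑ i, TensorProduct.map (C.toGrMod.mulVar i ∘ₗ C.toGrMod.sign) (omegaLeft w i) +
    TensorProduct.map (C.d.restrictScalars k) LinearMap.id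

theorem dR_tmul (C : Cpx k w) {a : A} {j : ℤ} {c : C.toGrMod.carrier}
    (hc : c ∈ C.toGrMod.gr (a, j)) (f : Omega k n) :
    dR C (c ⊗ₜ[k] f) = (j.negOnePow : ℤ) •
      (∑ i, ((MvPolynomial.X i : Poly k n) • c) ⊗ₜ[k] omegaLeft w i f) + C.d c ⊗ₜ[k] f := by
  simp only [dR, LinearMap.add_apply, LinearMap.sum_apply, TensorProduct.map_tmul,
    LinearMap.comp_apply, GrMod.sign, signOp_of_mem _ Prod.snd hc, Finset.smul_sum,
    LinearMap.restrictScalars_apply, LinearMap.id_apply, map_zsmul]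
  congr 1

theorem dR_mem (C : Cpx k w) (a : A) (j : ℤ) {m : C.toGrMod.carrier ⊗[k] Omega k n}
    (hm : m ∈ tensorGr (fun d d' : A × ℤ => d + d') C.toGrMod.gr (omegaGr (k := k) w) (a, j)) :
    dR C m ∈ tensorGr (fun d d' : A × ℤ => d + d') C.toGrMod.gr (omegaGr (k := k) w)
      (a, j - 1) := by
  change m ∈ (tensorGr _ _ _ _).comap (dR C)
  refine tensorGr_le ?_ hm
  rintro ⟨a', j'⟩ ⟨b, p⟩ hd c hc f hf
  rw [Prod.mk_add_mk, Prod.mk.injEq] at hd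
  obtain ⟨rfl, rfl⟩ := hd
  rw [Submodule.mem_comap, dR_tmul C hc]
  refine add_mem (zsmul_mem (Submodule.sum_mem _ fun i _ => ?_) _) ?_
  · refine tmul_mem_tensorGr _ (C.toGrMod.X_smul_mem i hc) (omegaLeft_mem i hf) ?_
    ext
    · simp only [Prod.mk_add_mk]
      abel
    · simp only [Prod.mk_add_mk]
      ring
  · refine tmul_mem_tensorGr _ (C.isDifferential.homogeneous a' j' c hc) hf ?_
    ext
    · rfl
    · simp only [Prod.mk_add_mk]
      ring

theorem tensor_ext (M : GrMod k w) {N : Type*} [AddCommGroup N] [Module k N]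
    {f g : M ⊗[k] Omega k n →ₗ[k] N}
    (h : ∀ d, ∀ c ∈ M.gr d, ∀ d', ∀ y ∈ omegaGr (k := k) w d', f (c ⊗ₜ y) = g (c ⊗ₜ y)) :
    f = g := by
  apply TensorProduct.ext
  refine linearMap_ext_grading M.isInternal fun d c hc => ?_
  exact linearMap_ext_grading (isInternal_omegaGr (k := k) w) fun d' y hy => h d c hc d' y hy

theorem dR_dR (C : Cpx k w) : dR C ∘ₗ dR C = 0 := by
  refine tensor_ext C.toGrMod ?_
  rintro ⟨a, j⟩ c hc d' f hf
  rw [LinearMap.comp_apply, dR_tmul C hc, map_add, map_zsmul, map_sum,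
    dR_tmul C (C.isDifferential.homogeneous a j c hc), C.isDifferential.sq c,
    TensorProduct.zero_tmul, add_zero, LinearMap.zero_apply]
  simp_rw [dR_tmul C (C.toGrMod.X_smul_mem _ hc)]
  rw [Finset.sum_add_distrib, ← Finset.smul_sum, sum_sum_eq_zero_of_antisymm, smul_zero, zero_add]
  · simp_rw [map_smul]
    rw [← sub_eq_add_neg, Int.negOnePow_sub]
    simp
  · intro i
    rw [omegaLeft_omegaLeft i i hf, extVar_sq]
    simp
  · intro i l
    rw [omegaLeft_omegaLeft l i hf, omegaLeft_omegaLeft i l hf, extVar_anticomm i l, smul_smul,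
      smul_smul, mul_comm]
    simp [TensorProduct.tmul_neg]

/-- The right action of `E` on `C ⊗ ω_E`, through the second factor. -/
def RAct (M : GrMod k w) : (Ext k n)ᵐᵒᵖ →ₐ[k] Module.End k (M ⊗[k] Omega k n) :=
  (Module.End.lTensorAlgHom k (Omega k n) M).comp (omegaAct k n)

theorem RAct_tmul (M : GrMod k w) (e : (Ext k n)ᵐᵒᵖ) (c : M) (f : Omega k n) :
    RAct M e (c ⊗ₜ[k] f) = c ⊗ₜ[k] omegaAct k n e f := rfl

/-- The functor `R`: the underlying `E`-module of `R(C)` is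
`⨁_j ⨁_a (C_j)_a ⊗ ω_E(-a; -j)`, so that the total module is `C ⊗ ω_E`, and `c ⊗ f` has degree
`(a; j) + deg f` for `c ∈ (C_j)_a`. -/
abbrev R (C : Cpx.{u} k w) : DiffMod.{max uk u} k w :=
  letI : Module (Ext k n)ᵐᵒᵖ (C.toGrMod.carrier ⊗[k] Omega k n) :=
    Module.compHom _ (RAct C.toGrMod).toRingHom
  { carrier := C.toGrMod.carrier ⊗[k] Omega k n
    tower := ⟨fun r e m => by
      change RAct C.toGrMod (r • e) m = r • RAct C.toGrMod e m
      rw [map_smul, LinearMap.smul_apply]⟩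
    gr := tensorGr (fun d d' : A × ℤ => d + d') C.toGrMod.gr (omegaGr (k := k) w)
    isInternal := isInternal_tensorGr _ C.toGrMod.isInternal (isInternal_omegaGr w)
    smul_mem := by
      intro d d' m hm e he
      change RAct C.toGrMod (MulOpposite.op e) m ∈ _
      change m ∈ (tensorGr _ _ _ _).comap (RAct C.toGrMod (MulOpposite.op e))
      refine tensorGr_le ?_ hm
      rintro d₁ d₂ rfl c hc f hf
      exact tmul_mem_tensorGr _ hc (omegaAct_mem w hf he) (add_assoc _ _ _).symm
    d :=
      { toFun := dR C
        map_add' := map_add _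
        map_smul' := by
          intro e m
          change dR C (RAct C.toGrMod e m) = RAct C.toGrMod e (dR C m)
          have : dR C ∘ₗ RAct C.toGrMod e = RAct C.toGrMod e ∘ₗ dR C := by
            refine tensor_ext C.toGrMod ?_
            rintro ⟨a, j⟩ c hc d' f hf
            rw [LinearMap.comp_apply, LinearMap.comp_apply, RAct_tmul, dR_tmul C hc,
              dR_tmul C hc, map_add, map_zsmul, map_sum]
            congr 2
            refine Finset.sum_congr rfl fun i _ => ?_
            rw [RAct_tmul]
            congr 1
            exact LinearMap.congr_fun (omegaLeft_omegaAct i e.unop) f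
          exact LinearMap.congr_fun this m }
    d_mem := fun a j m hm => dR_mem C a j hm
    d_sq := LinearMap.congr_fun (dR_dR C) }

end FunctorR

section Resolutions

universe u₁ u₂

variable {k : Type uk} [Field k] {n : ℕ} {A : Type uA} [AddCommGroup A] [DecidableEq A]
variable {w : Fin (n + 1) → A}

/-- `θ` makes the grading of `S` with `deg x_i = w i` positive: `θ(deg x_i) > 0` for all `i`. (The
condition `S_0 = k` is then automatic.) -/
def IsPositive (w : Fin (n + 1) → A) (θ : A →+ ℤ) : Prop := ∀ i, 0 < θ (w i)

/-- The term `M_j`. -/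
def GrMod.term (M : GrMod.{u} k w) (j : ℤ) : Submodule k M := ⨆ a, M.gr (a, j)

/-- The terms `M_j` are bounded below in `A`-degrees: for some `θ : A → ℤ` that makes the grading
of `S` positive, each `M_j` is bounded below in the `ℤ`-grading induced by `θ`. -/
def GrMod.TermsBoundedBelow (M : GrMod.{u} k w) : Prop :=
  ∃ θ : A →+ ℤ, IsPositive w θ ∧ ∀ j : ℤ, ∃ N : ℤ, ∀ a, θ a < N → M.gr (a, j) = ⊥

/-- `H_j(C) = 0` for all `j ≪ 0`. -/
def Cpx.HomologicallyBoundedBelow (C : Cpx.{u} k w) : Prop :=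
  ∃ m : ℤ, ∀ j < m, ∀ x ∈ C.toGrMod.term j, C.d x = 0 → ∃ y ∈ C.toGrMod.term (j + 1), C.d y = x

/-- A quasi-isomorphism: a morphism of complexes of `A`-graded `S`-modules that is injective and
surjective on homology. -/
structure IsQuasiIso {C : Cpx.{u₁} k w} {C' : Cpx.{u₂} k w}
    (φ : C.toGrMod →ₗ[Poly k n] C'.toGrMod) : Prop where
  homogeneous : IsHomogeneousMap φ 0
  comm : ∀ x, φ (C.d x) = C'.d (φ x)
  injective : ∀ x, C.d x = 0 → φ x ∈ LinearMap.range C'.d → x ∈ LinearMap.range C.d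
  surjective : ∀ y, C'.d y = 0 → ∃ x, C.d x = 0 ∧ y - φ x ∈ LinearMap.range C'.d

/-- The basis `b` consists of homogeneous elements. -/
def IsHomogeneousBasis {M : GrMod.{u} k w} {I : Type u₁} (b : Module.Basis I (Poly k n) M) :
    Prop :=
  ∀ i, ∃ d, b i ∈ M.gr d

/-- `M` is a free graded module: it has a homogeneous basis. -/
def GrMod.IsGradedFree (M : GrMod.{u} k w) : Prop :=
  ∃ (I : Type u) (b : Module.Basis I (Poly k n) M), IsHomogeneousBasis b

/-- `C` is minimal: `∂(C) ⊆ (x_0, …, x_n) C`. -/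
def Cpx.IsMinimal (C : Cpx.{u} k w) : Prop :=
  ∀ x, C.d x ∈ Ideal.span (Set.range (MvPolynomial.X : Fin (n + 1) → Poly k n)) •
    (⊤ : Submodule (Poly k n) C.toGrMod)

/-- `F` is a minimal free resolution of `G`: a minimal, homologically bounded below complex of
free `A`-graded `S`-modules with terms bounded below in `A`-degrees, that has a quasi-isomorphism
to `G`. -/
structure IsMinimalFreeResolution (F : Cpx.{u₁} k w) (G : Cpx.{u₂} k w) : Prop where
  free : F.toGrMod.IsGradedFree
  minimal : F.IsMinimal
  homologicallyBoundedBelow : F.HomologicallyBoundedBelow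
  termsBoundedBelow : F.toGrMod.TermsBoundedBelow
  quasiIso : ∃ φ : F.toGrMod →ₗ[Poly k n] G.toGrMod, IsQuasiIso φ

/-- With respect to the bases `b` and `b'`, the matrix of `f` has entries that are `k`-linear
combinations of the variables. -/
def HasLinearEntries {P Q : GrMod.{u} k w} {I J : Type u} (b : Module.Basis I (Poly k n) P)
    (b' : Module.Basis J (Poly k n) Q) (f : P →ₗ[Poly k n] Q) : Prop :=
  ∀ i j, b'.repr (f (b i)) j ∈
    Submodule.span k (Set.range (MvPolynomial.X : Fin (n + 1) → Poly k n))

/-- A strongly linear map of free graded modules. Maps that shift the homological degree are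
allowed, so that this applies to the components `P_j → Q_{j+r}`. -/
def IsStronglyLinear {P Q : GrMod.{u} k w} (f : P →ₗ[Poly k n] Q) : Prop :=
  (∃ r, IsHomogeneousMap f r) ∧ ∃ (I J : Type u) (b : Module.Basis I (Poly k n) P)
    (b' : Module.Basis J (Poly k n) Q), IsHomogeneousBasis b ∧ IsHomogeneousBasis b' ∧
      HasLinearEntries b b' f

/-- `f` is an `i`-fold composition of strongly linear maps (`i ≥ 1`). -/
inductive IsStronglyLinearComp : ℕ → ∀ {P Q : GrMod.{u} k w}, (P →ₗ[Poly k n] Q) → Prop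
  | single {P Q : GrMod.{u} k w} (f : P →ₗ[Poly k n] Q) :
      IsStronglyLinear f → IsStronglyLinearComp 1 f
  | comp {i : ℕ} {P Q T : GrMod.{u} k w} (f : P →ₗ[Poly k n] Q) (g : Q →ₗ[Poly k n] T) :
      IsStronglyLinearComp i f → IsStronglyLinear g → IsStronglyLinearComp (i + 1) (g ∘ₗ f)

/-- `f` is an `i`-fold composition of maps of free graded modules (`i ≥ 1`), where the source of
`f`, its target and the intermediate modules have homogeneous bases, `b` and `b'` in the case of
the source and the target, in which all the maps have matrices whose entries are `k`-linear
combinations of the variables. -/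
inductive IsLinearChain : ℕ → ∀ {P Q : GrMod.{u} k w} {I J : Type u},
    Module.Basis I (Poly k n) P → Module.Basis J (Poly k n) Q → (P →ₗ[Poly k n] Q) → Prop
  | single {P Q : GrMod.{u} k w} {I J : Type u} (b : Module.Basis I (Poly k n) P)
      (b' : Module.Basis J (Poly k n) Q) (f : P →ₗ[Poly k n] Q) :
      IsHomogeneousBasis b → IsHomogeneousBasis b' → (∃ r, IsHomogeneousMap f r) →
      HasLinearEntries b b' f → IsLinearChain 1 b b' f
  | comp {i : ℕ} {P Q T : GrMod.{u} k w} {I J K : Type u} (b : Module.Basis I (Poly k n) P)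
      (b' : Module.Basis J (Poly k n) Q) (b'' : Module.Basis K (Poly k n) T)
      (f : P →ₗ[Poly k n] Q) (g : Q →ₗ[Poly k n] T) :
      IsLinearChain i b b' f → IsHomogeneousBasis b'' → (∃ r, IsHomogeneousMap g r) →
      HasLinearEntries b' b'' g → IsLinearChain (i + 1) b b'' (g ∘ₗ f)

/-- A contraction of the complex `C` onto the complex `C'`. -/
structure Contraction (C : Cpx.{u₁} k w) (C' : Cpx.{u₂} k w) where
  π : C.toGrMod →ₗ[Poly k n] C'.toGrMod
  ι : C'.toGrMod →ₗ[Poly k n] C.toGrMod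
  h : C.toGrMod →ₗ[Poly k n] C.toGrMod
  π_homogeneous : IsHomogeneousMap π 0
  ι_homogeneous : IsHomogeneousMap ι 0
  h_homogeneous : IsHomogeneousMap h 1
  π_comm : ∀ x, π (C.d x) = C'.d (π x)
  ι_comm : ∀ x, ι (C'.d x) = C.d (ι x)
  π_ι : ∀ x, π (ι x) = x
  homotopy : ∀ x, x - ι (π x) = C.d (h x) + h (C.d x)
  π_h : ∀ x, π (h x) = 0
  h_ι : ∀ x, h (ι x) = 0
  h_h : ∀ x, h (h x) = 0

variable {D : DiffMod.{u} k w}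

/-- The contraction is compatible with the identification `H(Lbar(D)) = S ⊗ H(D) = L(H(D))`: the
map `π` sends `1 ⊗ z` to `1 ⊗ [z]` for each cycle `z` of `D`. (Then `ι` is compatible with it too,
since `π ∘ ι = id`.) -/
def Contraction.IsCanonical (c : Contraction (Lbar D) (Lbar (H D))) : Prop :=
  ∀ z : LinearMap.ker D.d, c.π ((1 : Poly k n) ⊗ₜ[k] (z : D)) = (1 : Poly k n) ⊗ₜ[k] D.cls z

/-- The contraction is obtained from `k`-linear maps by extension of scalars from `k` to `S`. -/
def Contraction.IsExtended (c : Contraction (Lbar D) (Lbar (H D))) : Prop :=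
  ∃ (π₀ : D →ₗ[k] H D) (ι₀ : H D →ₗ[k] D) (h₀ : D →ₗ[k] D),
    c.π = π₀.baseChange (Poly k n) ∧ c.ι = ι₀.baseChange (Poly k n) ∧
      c.h = h₀.baseChange (Poly k n)

/-- `δ_i = (-1) ^ (i - 1) π (∂' h) ^ (i - 1) ∂' ι`, for `i ≥ 1`. -/
def Contraction.delta (c : Contraction (Lbar D) (Lbar (H D))) (i : ℕ) :
    LMod (H D) →ₗ[Poly k n] LMod (H D) :=
  (-1 : ℤ) ^ (i - 1) •
    (c.π ∘ₗ ((dPrime D ∘ₗ c.h) ^ (i - 1) : Module.End (Poly k n) (LMod D)) ∘ₗ dPrime D ∘ₗ c.ι)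

end Resolutions

end

end MultigradedBGG

open MultigradedBGG

/-! Write D = R(G). The differential of L(D) is the sum of the internal part -∂_D and the
perturbation ∂' = ∑ x_i ⊗ e_i. For the internal part alone, the given contraction retracts onto S ⊗
H(D) with zero differential, and the homological perturbation lemma carries ∂' across it. With T =
(1 + ∂'h)⁻¹∂' = ∑ (-1)^i (∂'h)^i ∂', the map πTι = ∑_{i ≥ 1} δ_i squares to zero, and ι - hTι is a
homotopy equivalence from the resulting complex F to L(D). All of this comes from the single
identity TιπT + dT + Td = 0 (`Perturbation.maurerCartan`). The series is locally finite because ∂'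
strictly lowers the θ-degree of the factor in D, h cannot raise it, and D is bounded below in each
auxiliary degree (`dPrime_comp_locallyNilpotent`). The term δ_1 is the differential of L(H(D))
(`Contraction.delta_one`). F is minimal because its differential passes through ∂', and it inherits
the bounds of G because ω_E lives in nonnegative degrees.

It remains to compare L(R(G)) with G (`counit_isQuasiIso`). Regrouped as (S ⊗ G) ⊗ ω_E, the complex
L(R(G)) carries a Koszul differential on the operators y_i = x_i ⊗ 1 - 1 ⊗ x_i together with the
differential of G. A k-linear shear of S ⊗ G turns y_i into multiplication by x_i, so y_i has a left
inverse q_i that commutes with the other y_j. Each variable then gives an explicit homotopy from the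
identity to a projection, and the product of the n + 1 projections replaces a cycle by a copy of its
image in G. This step needs no boundedness of G.

For strong linearity the difficulty is that π, ι, h are only S-linear, so their entries may have any
degree. For i ≥ 2, write ∂'ι and π∂' through the strongly linear maps y ↦ (x_s y)_s and (y_s)_s ↦ ∑
x_s y_s. Then δ_i consists of i strongly linear maps separated by arbitrary homogeneous maps, and a
homogeneous map between two strongly linear ones can be absorbed into a change of basis of an
enlarged middle module (`isStronglyLinear_twist`). For i = 1 this would give two factors, so δ_1
relies on `Contraction.delta_one`. -/

namespace MultigradedBGG

set_option linter.unusedSectionVars false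

universe u uk uA

noncomputable section

/-! ### The homological perturbation lemma -/

section Perturbation

variable {R M N : Type*} [Ring R] [AddCommGroup M] [Module R M] [AddCommGroup N] [Module R N]

theorem pow_apply_eq_zero_of_le (f : Module.End R M) {x : M} {m l : ℕ} (h : (f ^ m) x = 0)
    (hl : m ≤ l) : (f ^ l) x = 0 := by
  obtain ⟨j, rfl⟩ := Nat.exists_eq_add_of_le' hl
  rw [pow_add, Module.End.mul_apply, h, map_zero]

theorem finsum_pow_eq_sum (f : Module.End R M) {x : M} {m l : ℕ} (h : (f ^ m) x = 0)
    (hl : m ≤ l) :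
    ∑ᶠ i : ℕ, (-1 : ℤ) ^ i • (f ^ i) x = ∑ i ∈ Finset.range l, (-1 : ℤ) ^ i • (f ^ i) x := by
  refine finsum_eq_sum_of_support_subset _ fun i hi => ?_
  rw [Finset.coe_range, Set.mem_Iio]
  by_contra hli
  exact hi (by simp only [pow_apply_eq_zero_of_le f h (hl.trans (not_lt.1 hli)), smul_zero])

/-- The geometric series `∑ (-f) ^ i` of a locally nilpotent endomorphism `f`, which is the inverse
of `1 + f`. -/
def geomInv (f : Module.End R M) (hf : ∀ x, ∃ m, (f ^ m) x = 0) : Module.End R M where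
  toFun x := ∑ᶠ i : ℕ, (-1 : ℤ) ^ i • (f ^ i) x
  map_add' x y := by
    obtain ⟨m, hm⟩ := hf x
    obtain ⟨l, hl⟩ := hf y
    have hx := pow_apply_eq_zero_of_le f hm (le_max_left m l)
    have hy := pow_apply_eq_zero_of_le f hl (le_max_right m l)
    have hxy : (f ^ max m l) (x + y) = 0 := by rw [map_add, hx, hy, add_zero]
    rw [finsum_pow_eq_sum f hx le_rfl, finsum_pow_eq_sum f hy le_rfl,
      finsum_pow_eq_sum f hxy le_rfl, ← Finset.sum_add_distrib]
    simp
  map_smul' r x := by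
    obtain ⟨m, hm⟩ := hf x
    have hrx : (f ^ m) (r • x) = 0 := by rw [map_smul, hm, smul_zero]
    rw [finsum_pow_eq_sum f hm le_rfl, finsum_pow_eq_sum f hrx le_rfl, RingHom.id_apply,
      Finset.smul_sum]
    refine Finset.sum_congr rfl fun i _ => ?_
    rw [map_smul, smul_comm]

variable {f : Module.End R M} (hf : ∀ x, ∃ m, (f ^ m) x = 0)

theorem geomInv_apply (x : M) : geomInv f hf x = ∑ᶠ i : ℕ, (-1 : ℤ) ^ i • (f ^ i) x := rfl

theorem geomInv_add_geomInv_apply (x : M) : geomInv f hf x + geomInv f hf (f x) = x := by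
  obtain ⟨m, hm⟩ := hf x
  have hfx : (f ^ m) (f x) = 0 := by
    rw [← Module.End.mul_apply, ← pow_succ]
    exact pow_apply_eq_zero_of_le f hm m.le_succ
  -- Truncating at m + 1 for x and at m for f x makes the sums telescope: only the term of index 0,
  -- which is x, survives.
  rw [geomInv_apply, geomInv_apply, finsum_pow_eq_sum f hm m.le_succ,
    finsum_pow_eq_sum f hfx le_rfl, Finset.sum_range_succ', add_right_comm,
    ← Finset.sum_add_distrib, Finset.sum_eq_zero, zero_add]
  · simp
  · intro i _
    rw [pow_succ f, Module.End.mul_apply, ← add_smul, pow_succ]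
    simp

theorem apply_geomInv (x : M) : f (geomInv f hf x) = geomInv f hf (f x) := by
  obtain ⟨m, hm⟩ := hf x
  have hfx : (f ^ m) (f x) = 0 := by
    rw [← Module.End.mul_apply, ← pow_succ]
    exact pow_apply_eq_zero_of_le f hm m.le_succ
  rw [geomInv_apply, geomInv_apply, finsum_pow_eq_sum f hm le_rfl, finsum_pow_eq_sum f hfx le_rfl,
    map_sum]
  refine Finset.sum_congr rfl fun i _ => ?_
  rw [map_zsmul, ← Module.End.mul_apply, ← Module.End.mul_apply, ← pow_succ, ← pow_succ']

theorem geomInv_add_apply_geomInv (x : M) : geomInv f hf x + f (geomInv f hf x) = x := by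
  rw [apply_geomInv, geomInv_add_geomInv_apply]

theorem geomInv_mem (p : AddSubgroup M) (hp : ∀ x ∈ p, f x ∈ p) {x : M} (hx : x ∈ p) :
    geomInv f hf x ∈ p := by
  obtain ⟨m, hm⟩ := hf x
  rw [geomInv_apply, finsum_pow_eq_sum f hm le_rfl]
  refine AddSubgroup.sum_mem _ fun i hi => AddSubgroup.zsmul_mem _ ?_ _
  clear hi
  induction i with
  | zero => exact hx
  | succ i ih =>
    rw [pow_succ', Module.End.mul_apply]
    exact hp _ ih

/-- The data of the perturbation lemma: a contraction `(π, ι, h)` of a module `M` with differential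
`d` onto a module `N` with zero differential, and a perturbation `t` of `d`, together with
`T = (1 + t h)⁻¹ t`, which is characterized by `T + t h T = t = T + T h t`. -/
structure Perturbation (d t h T : M →ₗ[R] M) (π : M →ₗ[R] N) (ι : N →ₗ[R] M) : Prop where
  sq : ∀ x, t (t x) + d (t x) + t (d x) = 0
  π_d : ∀ x, π (d x) = 0
  d_ι : ∀ x, d (ι x) = 0
  π_ι : ∀ x, π (ι x) = x
  homotopy : ∀ x, x - ι (π x) = d (h x) + h (d x)
  π_h : ∀ x, π (h x) = 0
  h_ι : ∀ x, h (ι x) = 0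
  h_h : ∀ x, h (h x) = 0
  eq_left : ∀ x, T x + t (h (T x)) = t x
  eq_right : ∀ x, T x + T (h (t x)) = t x

namespace Perturbation

variable {d t h T : M →ₗ[R] M} {π : M →ₗ[R] N} {ι : N →ₗ[R] M}

/-- `1 + t h` is injective. -/
theorem eq_zero_of_add_eq_zero (P : Perturbation d t h T π ι) {x : M} (hx : x + t (h x) = 0) : x = 0 := by
  have h1 := P.eq_right (h x)
  have h2 : T (h x) + T (h (t (h x))) = 0 := by rw [← map_add, ← map_add, hx, map_zero, map_zero]
  rw [h2] at h1
  rwa [← h1, add_zero] at hx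

/-- Since 1 + ht is surjective, take x = y + hty, so that Tx = ty. Since 1 + th is injective, it may
be applied to the left side, where it turns each outer T into t. The homotopy formula at ty then
reduces the claim to t² + dt + td = 0 at y. This is the source of all the perturbed identities:
applying π on the left and ι on the right gives (πTι)² = 0. -/
theorem maurerCartan (P : Perturbation d t h T π ι) (x : M) : T (ι (π (T x))) + d (T x) + T (d x) = 0 := by
  -- `1 + h t` is surjective
  obtain ⟨y, rfl⟩ : ∃ y, y + h (t y) = x := by
    refine ⟨x - h (T x), ?_⟩
    have := congrArg h (P.eq_left x)
    rw [map_add] at this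
    rw [map_sub, map_sub, ← this]
    abel
  have e1 : T (y + h (t y)) = t y := by rw [map_add, P.eq_right]
  apply P.eq_zero_of_add_eq_zero
  have e2 : ∀ z, T z + t (h (T z)) = t z := P.eq_left
  have a1 := P.homotopy (t y)
  have a2 := P.homotopy y
  have a3 := P.sq y
  have b1 := e2 (ι (π (t y)))
  have b2 := e2 (d (y + h (t y)))
  rw [e1]
  simp only [map_add] at b1 b2 ⊢
  have a4 := congrArg t a1
  simp only [map_add, map_sub] at a4
  linear_combination (norm := abel) b1 + b2 + a3 - a4

/-- The perturbed differential on `N` squares to zero. -/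
theorem sq_zero (P : Perturbation d t h T π ι) (x : N) : π (T (ι (π (T (ι x))))) = 0 := by
  have h1 := congrArg π (P.maurerCartan (ι x))
  simpa [P.π_d, P.d_ι] using h1

/-- The perturbed contraction consists of ι - hTι, π - πTh and h - hTh. Compatibility with the
differentials and the homotopy formula are the unperturbed identities corrected by `maurerCartan`,
composed with h or π on the left and with ι or h on the right. -/
theorem ι_comm (P : Perturbation d t h T π ι) (x : N) : (d + t) (ι x - h (T (ι x))) =
    ι (π (T (ι x))) - h (T (ι (π (T (ι x))))) := by
  have h1 := congrArg h (P.maurerCartan (ι x))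
  have h2 := P.homotopy (T (ι x))
  have h3 := P.eq_left (ι x)
  simp only [LinearMap.add_apply, map_sub, map_add, P.d_ι, map_zero] at h1 h2 h3 ⊢
  linear_combination (norm := abel) h2 - h3 + h1

theorem π_comm (P : Perturbation d t h T π ι) (x : M) : π ((d + t) x) - π (T (h ((d + t) x))) =
    π (T (ι (π x - π (T (h x))))) := by
  have h1 := congrArg π (P.maurerCartan (h x))
  have h2 := congrArg (fun y => π (T y)) (P.homotopy x)
  have h3 := congrArg π (P.eq_right x)
  simp only [LinearMap.add_apply, map_sub, map_add, P.π_d, map_zero] at h1 h2 h3 ⊢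
  linear_combination (norm := abel) h2 - h3 + h1

theorem π_ι_perturbed (P : Perturbation d t h T π ι) (x : N) :
    π (ι x - h (T (ι x))) - π (T (h (ι x - h (T (ι x))))) = x := by
  simp [P.π_h, P.h_ι, P.h_h, P.π_ι]

theorem homotopy_perturbed (P : Perturbation d t h T π ι) (x : M) :
    x - (ι (π x - π (T (h x))) - h (T (ι (π x - π (T (h x)))))) =
      (d + t) (h x - h (T (h x))) + (h ((d + t) x) - h (T (h ((d + t) x)))) := by
  have h1 := P.homotopy x
  have h2 := P.homotopy (T (h x))
  have h3 := congrArg (fun y => h (T y)) (P.homotopy x)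
  have h4 := congrArg h (P.maurerCartan (h x))
  have h5 := P.eq_left (h x)
  have h6 := congrArg h (P.eq_right x)
  simp only [LinearMap.add_apply, map_sub, map_add, map_zero] at h1 h2 h3 h4 h5 h6 ⊢
  linear_combination (norm := abel) h1 - h2 - h3 - h4 + h5 + h6

end Perturbation

end Perturbation

/-! ### Lower bounds on degrees -/

section Bounds

variable {k : Type uk} [Field k] {n : ℕ} {A : Type uA} [AddCommGroup A] [DecidableEq A]
variable {w : Fin (n + 1) → A}

/-- A nonzero component of `S` has nonnegative degree. -/
theorem nonneg_of_ne_zero {θ : A →+ ℤ} (hθ : IsPositive w θ) {b : A} {s : Poly k n}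
    (hs : s ∈ MvPolynomial.weightedHomogeneousSubmodule k w b) (h0 : s ≠ 0) : 0 ≤ θ b := by
  obtain ⟨m, hm⟩ := MvPolynomial.ne_zero_iff.1 h0
  rw [← hs hm, Finsupp.weight_apply, Finsupp.sum, map_sum]
  refine Finset.sum_nonneg fun i _ => ?_
  rw [map_nsmul]
  exact nsmul_nonneg (hθ i).le _

theorem extGr_eq_bot_or (w : Fin (n + 1) → A) (d : A × ℤ) : extGr (k := k) w d = ⊥ ∨
    ∃ v : List (Fin (n + 1)), (v.map fun i => (-w i, (-1 : ℤ))).sum = d := by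
  by_cases h : ∃ v : List (Fin (n + 1)), (v.map fun i => (-w i, (-1 : ℤ))).sum = d
  · exact Or.inr h
  · left
    rw [extGr, Submodule.span_eq_bot]
    rintro _ ⟨v, hv, -⟩
    exact absurd ⟨v, hv⟩ h

theorem omegaGr_eq_bot {d : A × ℤ} (h : extGr (k := k) w (-d) = ⊥) :
    omegaGr (k := k) w d = ⊥ := by
  rw [Submodule.eq_bot_iff]
  intro f hf
  refine linearMap_ext_grading (isInternal_extGr (k := k) w) fun d' y hy => ?_
  rw [LinearMap.zero_apply]
  by_cases hd : d' = -d
  · subst hd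
    rw [h, Submodule.mem_bot] at hy
    rw [hy, map_zero]
  · exact hf d' hd y hy

/-- The e_i have degree (-w i; -1) and dualizing reverses degrees. Hence tensoring with ω_E never
lowers a degree, which is why lower bounds on G pass to R(G). -/
theorem omegaGr_nonneg {d : A × ℤ} (h : omegaGr (k := k) w d ≠ ⊥) :
    0 ≤ d.2 ∧ ∀ θ : A →+ ℤ, IsPositive w θ → 0 ≤ θ d.1 := by
  obtain h0 | ⟨v, hv⟩ := extGr_eq_bot_or (k := k) w (-d)
  · exact absurd (omegaGr_eq_bot h0) h
  have key : ∀ v : List (Fin (n + 1)), (v.map fun i => (-w i, (-1 : ℤ))).sum.2 ≤ 0 ∧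
      ∀ θ : A →+ ℤ, IsPositive w θ → θ (v.map fun i => (-w i, (-1 : ℤ))).sum.1 ≤ 0 := by
    intro v
    induction v with
    | nil => simp
    | cons i v ih =>
      simp only [List.map_cons, List.sum_cons, Prod.snd_add, Prod.fst_add, map_add, map_neg]
      exact ⟨by linarith [ih.1], fun θ hθ => by linarith [ih.2 θ hθ, hθ i]⟩
  have := key v
  rw [hv] at this
  simpa using this

theorem finite_omegaGr_ne_bot (w : Fin (n + 1) → A) :
    {d | omegaGr (k := k) w d ≠ ⊥}.Finite := by
  have hfin : {d | extGr (k := k) w d ≠ ⊥}.Finite :=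
    WellFoundedGT.finite_ne_bot_of_iSupIndep (isInternal_extGr w).submodule_iSupIndep
  refine (hfin.preimage (f := fun d : A × ℤ => -d) neg_injective.injOn).subset fun d hd => ?_
  exact fun h => hd (omegaGr_eq_bot h)

theorem R_gr_eq_bot (G : Cpx.{u} k w) {d : A × ℤ}
    (h : ∀ q, omegaGr (k := k) w q ≠ ⊥ → G.toGrMod.gr (d - q) = ⊥) : (R G).gr d = ⊥ := by
  refine eq_bot_iff.2 (tensorGr_le ?_)
  rintro p q rfl m hm f hf
  by_cases hq : omegaGr (k := k) w q = ⊥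
  · rw [hq, Submodule.mem_bot] at hf
    simp [hf]
  · have := h q hq
    rw [add_sub_cancel_right] at this
    rw [this, Submodule.mem_bot] at hm
    simp [hm]

theorem H_gr_eq_bot (D : DiffMod.{u} k w) {d : A × ℤ} (h : D.gr d = ⊥) : (H D).gr d = ⊥ := by
  rw [Submodule.eq_bot_iff]
  rintro _ ⟨z, hz, rfl⟩
  have hz' : (z : D) ∈ D.gr d := hz
  rw [h, Submodule.mem_bot] at hz'
  have : z = 0 := Subtype.ext hz'
  rw [this, map_zero]

theorem LMod_gr_eq_bot (D : DiffMod.{u} k w) {θ : A →+ ℤ} (hθ : IsPositive w θ) {a : A} {j : ℤ}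
    (h : ∀ a', θ a' ≤ θ a → D.gr (a', j) = ⊥) : (LMod D).gr (a, j) = ⊥ := by
  refine eq_bot_iff.2 (tensorGr_le ?_)
  rintro b ⟨a', j'⟩ hd s hs x hx
  obtain ⟨rfl, rfl⟩ := Prod.mk.inj hd
  by_cases h0 : s = 0
  · simp [h0]
  · have := nonneg_of_ne_zero hθ hs h0
    rw [h a' (by rw [map_add]; linarith), Submodule.mem_bot] at hx
    simp [hx]

theorem LMod_term_eq_bot (D : DiffMod.{u} k w) {j : ℤ} (h : ∀ a, D.gr (a, j) = ⊥) :
    (LMod D).term j = ⊥ := by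
  refine eq_bot_iff.2 (iSup_le fun a => tensorGr_le ?_)
  rintro b ⟨a', j'⟩ hd s hs x hx
  obtain ⟨rfl, rfl⟩ := Prod.mk.inj hd
  rw [h a', Submodule.mem_bot] at hx
  simp [hx]

/-- The components of `D` are bounded below with respect to `θ` in each auxiliary degree. -/
def DiffMod.BoundedBelow (D : DiffMod.{u} k w) (θ : A →+ ℤ) : Prop :=
  ∀ j : ℤ, ∃ N : ℤ, ∀ a, θ a < N → D.gr (a, j) = ⊥

/-- The bound on G may vary with the homological degree. But ω_E has only finitely many nonzero
components, so a fixed auxiliary degree of R(G) involves finitely many terms of G, and a common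
lower bound exists. -/
theorem R_boundedBelow (G : Cpx.{u} k w) {θ : A →+ ℤ} (hθ : IsPositive w θ)
    (hG : ∀ j : ℤ, ∃ N : ℤ, ∀ a, θ a < N → G.toGrMod.gr (a, j) = ⊥) :
    (R G).BoundedBelow θ := by
  intro j
  choose N hN using hG
  obtain ⟨B, hB⟩ := ((finite_omegaGr_ne_bot (k := k) w).image fun q => N (j - q.2)).bddBelow
  refine ⟨B, fun a ha => R_gr_eq_bot G fun q hq => ?_⟩
  refine hN (j - q.2) _ ?_
  have h1 := (omegaGr_nonneg hq).2 θ hθ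
  have h2 := hB (Set.mem_image_of_mem _ hq)
  change B ≤ N (j - q.2) at h2
  change θ (a - q.1) < _
  rw [map_sub]
  linarith

theorem termsBoundedBelow_LMod_H (D : DiffMod.{u} k w) {θ : A →+ ℤ} (hθ : IsPositive w θ)
    (hD : D.BoundedBelow θ) : (LMod (H D)).TermsBoundedBelow := by
  refine ⟨θ, hθ, fun j => ?_⟩
  obtain ⟨N, hN⟩ := hD j
  exact ⟨N, fun a ha => LMod_gr_eq_bot _ hθ fun a' ha' =>
    H_gr_eq_bot D (hN a' (ha'.trans_lt ha))⟩

end Bounds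

/-! ### Local nilpotence of ∂'h -/

section Nilpotent

variable {k : Type uk} [Field k] {n : ℕ} {A : Type uA} [AddCommGroup A] [DecidableEq A]
variable {w : Fin (n + 1) → A}

/-- The submodule of `L(D)` generated by the components `D_(a;j)` with `θ(a) ≤ p`. -/
def degreeFiltration (D : DiffMod.{u} k w) (θ : A →+ ℤ) (j p : ℤ) :
    Submodule (Poly k n) (LMod D) :=
  Submodule.span (Poly k n) {y | ∃ a, θ a ≤ p ∧ ∃ m ∈ D.gr (a, j), (1 : Poly k n) ⊗ₜ[k] m = y}

theorem tmul_mem_degreeFiltration (D : DiffMod.{u} k w) {θ : A →+ ℤ} {j p : ℤ} {a : A}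
    (ha : θ a ≤ p) {m : D} (hm : m ∈ D.gr (a, j)) (s : Poly k n) :
    s ⊗ₜ[k] m ∈ degreeFiltration D θ j p := by
  have : s ⊗ₜ[k] m = s • ((1 : Poly k n) ⊗ₜ[k] m) := by
    rw [TensorProduct.smul_tmul', smul_eq_mul, mul_one]
  rw [this]
  exact Submodule.smul_mem _ _ (Submodule.subset_span ⟨a, ha, m, hm, rfl⟩)

theorem dPrime_mem_degreeFiltration (D : DiffMod.{u} k w) {θ : A →+ ℤ} (hθ : IsPositive w θ)
    {j p : ℤ} {x : LMod D} (hx : x ∈ degreeFiltration D θ j p) :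
    dPrime D x ∈ degreeFiltration D θ (j - 1) (p - 1) := by
  change x ∈ (degreeFiltration D θ (j - 1) (p - 1)).comap (dPrime D)
  refine Submodule.span_le.2 ?_ hx
  rintro _ ⟨a, ha, m, hm, rfl⟩
  change dPrime D _ ∈ degreeFiltration D θ (j - 1) (p - 1)
  rw [dPrime_tmul]
  refine Submodule.sum_mem _ fun i _ => ?_
  refine tmul_mem_degreeFiltration D ?_ (D.leftVar_mem i hm) _
  rw [map_sub]
  linarith [hθ i]

/-- The image of 1 ⊗ m has the A-degree of m, so it is a sum of s ⊗ x with deg s + deg x = deg m. As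
θ(deg s) ≥ 0 for s ≠ 0, the factor x cannot have larger θ-degree than m. -/
theorem homogeneous_mem_degreeFiltration (D : DiffMod.{u} k w) {θ : A →+ ℤ}
    (hθ : IsPositive w θ) {f : LMod D →ₗ[Poly k n] LMod D} {r : ℤ} (hf : IsHomogeneousMap f r)
    {j p : ℤ} {x : LMod D} (hx : x ∈ degreeFiltration D θ j p) :
    f x ∈ degreeFiltration D θ (j + r) p := by
  change x ∈ (degreeFiltration D θ (j + r) p).comap f
  refine Submodule.span_le.2 ?_ hx
  rintro _ ⟨a, ha, m, hm, rfl⟩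
  have h1 : f ((1 : Poly k n) ⊗ₜ[k] m) ∈ (LMod D).gr (a, j + r) :=
    hf a j _ (tmul_mem_tensorGr _ (MvPolynomial.isWeightedHomogeneous_one k w) hm (by simp))
  refine (tensorGr_le (P := (degreeFiltration D θ (j + r) p).restrictScalars k) ?_) h1
  rintro b ⟨a', j'⟩ hd s hs x hx
  obtain ⟨rfl, rfl⟩ := Prod.mk.inj hd
  by_cases h0 : s = 0
  · simp [h0]
  · have := nonneg_of_ne_zero hθ hs h0
    rw [map_add] at ha
    exact tmul_mem_degreeFiltration D (by linarith) hx s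

/-- The map h raises j by one without raising the filtration index p, and ∂' lowers both by one. So
∂'h stays in the same auxiliary degree j and lowers p, and for that j the filtration is eventually
zero. The exponent depends on the element. -/
theorem dPrime_comp_locallyNilpotent (D : DiffMod.{u} k w) {θ : A →+ ℤ} (hθ : IsPositive w θ)
    (hD : D.BoundedBelow θ) {h : LMod D →ₗ[Poly k n] LMod D} (hh : IsHomogeneousMap h 1)
    (x : LMod D) : ∃ m, ((dPrime D ∘ₗ h : Module.End (Poly k n) (LMod D)) ^ m) x = 0 := by
  let f : Module.End (Poly k n) (LMod D) := dPrime D ∘ₗ h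
  have hstep : ∀ (m : ℕ) (j p : ℤ), ∀ x ∈ degreeFiltration D θ j p,
      (f ^ m) x ∈ degreeFiltration D θ j (p - m) := by
    intro m j p x hx
    induction m with
    | zero => simpa using hx
    | succ m ih =>
      have := dPrime_mem_degreeFiltration D hθ (homogeneous_mem_degreeFiltration D hθ hh ih)
      rw [pow_succ', Module.End.mul_apply]
      rw [add_sub_cancel_right] at this
      have hp : p - ((m + 1 : ℕ) : ℤ) = p - m - 1 := by push_cast; ring
      rw [hp]
      exact this
  have hzero : ∀ j : ℤ, ∃ N : ℤ, ∀ p < N, degreeFiltration D θ j p = ⊥ := by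
    intro j
    obtain ⟨N, hN⟩ := hD j
    refine ⟨N, fun p hp => Submodule.span_eq_bot.2 ?_⟩
    rintro _ ⟨a, ha, m, hm, rfl⟩
    rw [hN a (ha.trans_lt hp), Submodule.mem_bot] at hm
    rw [hm, TensorProduct.tmul_zero]
  have hadd : ∀ x y : LMod D, (∃ m, (f ^ m) x = 0) → (∃ m, (f ^ m) y = 0) →
      ∃ m, (f ^ m) (x + y) = 0 := by
    rintro x y ⟨m, hm⟩ ⟨l, hl⟩
    exact ⟨max m l, by rw [map_add, pow_apply_eq_zero_of_le f hm (le_max_left m l),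
      pow_apply_eq_zero_of_le f hl (le_max_right m l), add_zero]⟩
  induction x using TensorProduct.induction_on with
  | zero => exact ⟨0, map_zero _⟩
  | add x y hx hy => exact hadd x y hx hy
  | tmul s d =>
    refine grading_induction D.isInternal
      (P := fun d => ∃ m, (f ^ m) (s ⊗ₜ[k] d : LMod D) = 0) ?_ ?_ ?_ d
    · exact ⟨0, by simp⟩
    · intro d d' hd hd'
      rw [TensorProduct.tmul_add]
      exact hadd _ _ hd hd'
    · rintro ⟨a, j⟩ d hd
      obtain ⟨N, hN⟩ := hzero j
      -- This is the least exponent that is certain to bring the filtration index from θ a to below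
      -- N.
      refine ⟨(θ a - N + 1).toNat, ?_⟩
      have h1 := hstep (θ a - N + 1).toNat j (θ a) _ (tmul_mem_degreeFiltration D le_rfl hd s)
      rw [hN _ (by linarith [Int.self_le_toNat (θ a - N + 1)])] at h1
      exact (Submodule.mem_bot _).1 h1

end Nilpotent

/-! ### The linear part of the perturbed differential -/

section DeltaOne

variable {k : Type uk} [Field k] {n : ℕ} {A : Type uA} [AddCommGroup A] [DecidableEq A]
variable {w : Fin (n + 1) → A}

theorem d_leftVar_eq_zero (D : DiffMod.{u} k w) (i : Fin (n + 1)) (z : LinearMap.ker D.d) :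
    D.leftVar i (z : D) ∈ LinearMap.ker D.d := by
  rw [LinearMap.mem_ker, D.d_leftVar, LinearMap.mem_ker.1 z.2, map_zero, neg_zero]

theorem leftVar_cls (D : DiffMod.{u} k w) (i : Fin (n + 1)) {d : A × ℤ} (z : LinearMap.ker D.d)
    (hz : (z : D) ∈ D.gr d) :
    (H D).leftVar i (D.cls z) = D.cls ⟨D.leftVar i (z : D), d_leftVar_eq_zero D i z⟩ := by
  have h1 : D.cls z ∈ (H D).gr d := ⟨z, hz, rfl⟩
  rw [(H D).leftVar_of_mem i h1, ← map_smul, ← map_zsmul]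
  congr 1
  apply Subtype.ext
  exact (D.leftVar_of_mem i hz).symm

theorem dInternal_H (D : DiffMod.{u} k w) : dInternal (H D) = 0 := by
  refine LMod.hom_ext fun d m hm => ?_
  rw [dInternal_tmul, LinearMap.zero_apply]
  change -((1 : Poly k n) ⊗ₜ[k] (0 : H D)) = 0
  rw [TensorProduct.tmul_zero, neg_zero]

variable {D : DiffMod.{u} k w}

theorem Contraction.π_dInternal (c : Contraction (Lbar D) (Lbar (H D))) (x : LMod D) :
    c.π (dInternal D x) = 0 := by
  have := c.π_comm x
  change _ = dInternal (H D) _ at this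
  rwa [dInternal_H] at this

theorem Contraction.dInternal_ι (c : Contraction (Lbar D) (Lbar (H D))) (x : LMod (H D)) :
    dInternal D (c.ι x) = 0 := by
  have := c.ι_comm x
  change c.ι (dInternal (H D) _) = _ at this
  rw [dInternal_H] at this
  rw [← this, LinearMap.zero_apply, map_zero]

/-- By the homotopy formula, ι(1 ⊗ [z]) differs from 1 ⊗ z by a boundary. The map π∂' kills
boundaries, because ∂' anticommutes with the internal differential and π kills the image of the
latter. So ι may be replaced by the choice of the representative z, and π then sends x_i ⊗ e_i z to
x_i ⊗ [e_i z]. -/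
theorem Contraction.delta_one (c : Contraction (Lbar D) (Lbar (H D))) (hc : c.IsCanonical) :
    c.delta 1 = dPrime (H D) := by
  refine LMod.hom_ext ?_
  rintro d _ ⟨z, hz, rfl⟩
  have hz' : (z : D) ∈ D.gr d := hz
  have h1 : dInternal D ((1 : Poly k n) ⊗ₜ[k] (z : D)) = 0 := by
    rw [dInternal_tmul, LinearMap.mem_ker.1 z.2, TensorProduct.tmul_zero, neg_zero]
  have h2 := c.homotopy ((1 : Poly k n) ⊗ₜ[k] (z : D))
  change _ = dInternal D _ + c.h (dInternal D _) at h2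
  rw [h1, map_zero, add_zero, hc z] at h2
  have h3 : c.ι ((1 : Poly k n) ⊗ₜ[k] D.cls z) = (1 : Poly k n) ⊗ₜ[k] (z : D) -
      dInternal D (c.h ((1 : Poly k n) ⊗ₜ[k] (z : D))) := by rw [← h2]; abel
  have h5 : ∀ y, c.π (dPrime D (dInternal D y)) = 0 := by
    intro y
    have := LinearMap.congr_fun (dPrime_dInternal D) y
    simp only [LinearMap.add_apply, LinearMap.comp_apply, LinearMap.zero_apply] at this
    rw [eq_neg_of_add_eq_zero_left this, map_neg, c.π_dInternal, neg_zero]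
  change ((-1 : ℤ) ^ 0) • c.π (dPrime D (c.ι ((1 : Poly k n) ⊗ₜ[k] D.cls z))) = 
    dPrime (H D) ((1 : Poly k n) ⊗ₜ[k] D.cls z)
  rw [h3, map_sub, map_sub, h5, sub_zero, pow_zero, one_smul, dPrime_tmul, dPrime_tmul, map_sum]
  refine Finset.sum_congr rfl fun i _ => ?_
  rw [leftVar_cls D i z hz', mul_one]
  have h6 : ∀ y : D, (MvPolynomial.X i : Poly k n) ⊗ₜ[k] y =
      (MvPolynomial.X i : Poly k n) • ((1 : Poly k n) ⊗ₜ[k] y) := fun y => by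
    rw [TensorProduct.smul_tmul', smul_eq_mul, mul_one]
  rw [h6, map_smul, hc ⟨_, d_leftVar_eq_zero D i z⟩, TensorProduct.smul_tmul', smul_eq_mul, mul_one]

end DeltaOne

/-! ### Division by x_i ⊗ 1 - 1 ⊗ x_i on S ⊗ G -/

section Shear

variable {k : Type uk} [Field k] {n : ℕ}
variable {G : Type u} [AddCommGroup G] [Module k G] [Module (Poly k n) G]
  [IsScalarTower k (Poly k n) G]

/-- Induction on the polynomial factor with c left free, so that in the inductive step the
hypothesis may be used for x_i c in place of c. -/
theorem tensor_poly_hom_ext {N : Type*} [AddCommGroup N] [Module k N]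
    {f g : Poly k n ⊗[k] G →ₗ[k] N} (h1 : ∀ c : G, f (1 ⊗ₜ[k] c) = g (1 ⊗ₜ[k] c))
    (hX : ∀ i (s : Poly k n), (∀ c : G, f (s ⊗ₜ[k] c) = g (s ⊗ₜ[k] c)) →
      ∀ c : G, f ((MvPolynomial.X i * s) ⊗ₜ[k] c) = g ((MvPolynomial.X i * s) ⊗ₜ[k] c)) :
    f = g := by
  apply TensorProduct.ext'
  intro s
  induction s using MvPolynomial.induction_on with
  | C a =>
    intro c
    have : (MvPolynomial.C a : Poly k n) = a • 1 := by rw [MvPolynomial.smul_eq_C_mul, mul_one]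
    rw [this, ← TensorProduct.smul_tmul', map_smul, map_smul, h1]
  | add p q hp hq =>
    intro c
    rw [TensorProduct.add_tmul, map_add, map_add, hp, hq]
  | mul_X p i hp =>
    rw [mul_comm]
    exact hX i p hp

/-- Multiplication by a variable on the module, as a `k`-linear map. -/
def actVar (k : Type uk) [Field k] {n : ℕ} (G : Type u) [AddCommGroup G] [Module k G]
    [Module (Poly k n) G] [IsScalarTower k (Poly k n) G] (i : Fin (n + 1)) : G →ₗ[k] G :=
  (LinearMap.lsmul (Poly k n) G (MvPolynomial.X i)).restrictScalars k

theorem actVar_apply (i : Fin (n + 1)) (c : G) :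
    actVar k G i c = (MvPolynomial.X i : Poly k n) • c := rfl

/-- The algebra homomorphism `S → S ⊗ S` with `x_i ↦ x_i ⊗ 1 + a (1 ⊗ x_i)`. -/
def shearHom (n : ℕ) (a : k) : Poly k n →ₐ[k] Poly k n ⊗[k] Poly k n :=
  MvPolynomial.aeval fun i => MvPolynomial.X i ⊗ₜ[k] 1 + a • (1 ⊗ₜ[k] MvPolynomial.X i)

variable (k n G) in
/-- The module structure `S ⊗ G → G`. -/
def actHom : Poly k n ⊗[k] G →ₗ[k] G :=
  TensorProduct.lift (Algebra.lsmul k k G).toLinearMap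

theorem actHom_tmul (s : Poly k n) (c : G) : actHom k n G (s ⊗ₜ[k] c) = s • c := rfl

/-- The action of `S ⊗ S` on `S ⊗ G`, restricted to elements `1 ⊗ c`. -/
def biAct : (Poly k n ⊗[k] Poly k n) ⊗[k] G →ₗ[k] Poly k n ⊗[k] G :=
  LinearMap.lTensor (Poly k n) (actHom k n G) ∘ₗ
    (TensorProduct.assoc k (Poly k n) (Poly k n) G).toLinearMap

theorem biAct_tmul (s t : Poly k n) (c : G) : biAct ((s ⊗ₜ[k] t) ⊗ₜ[k] c) = s ⊗ₜ[k] (t • c) := rfl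

theorem biAct_left_mul (p : Poly k n) (t : Poly k n ⊗[k] Poly k n) (c : G) :
    biAct ((p ⊗ₜ[k] 1 * t) ⊗ₜ[k] c) = p • biAct (t ⊗ₜ[k] c) := by
  induction t using TensorProduct.induction_on with
  | zero => simp
  | add x y hx hy => rw [mul_add, TensorProduct.add_tmul, map_add, hx, hy, TensorProduct.add_tmul,
      map_add, smul_add]
  | tmul x y =>
    rw [Algebra.TensorProduct.tmul_mul_tmul, biAct_tmul, biAct_tmul, one_mul,
      TensorProduct.smul_tmul', smul_eq_mul]

theorem biAct_right_mul (i : Fin (n + 1)) (t : Poly k n ⊗[k] Poly k n) (c : G) :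
    biAct ((1 ⊗ₜ[k] MvPolynomial.X i * t) ⊗ₜ[k] c) =
      LinearMap.lTensor (Poly k n) (actVar k G i) (biAct (t ⊗ₜ[k] c)) := by
  induction t using TensorProduct.induction_on with
  | zero => simp
  | add x y hx hy => rw [mul_add, TensorProduct.add_tmul, map_add, hx, hy, TensorProduct.add_tmul,
      map_add, map_add]
  | tmul x y =>
    rw [Algebra.TensorProduct.tmul_mul_tmul, biAct_tmul, biAct_tmul, one_mul,
      LinearMap.lTensor_tmul, actVar_apply, smul_smul]

theorem biAct_lTensor (v : G →ₗ[k] G) (hv : ∀ (p : Poly k n) c, v (p • c) = p • v c)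
    (t : Poly k n ⊗[k] Poly k n) (c : G) :
    biAct (t ⊗ₜ[k] v c) = LinearMap.lTensor (Poly k n) v (biAct (t ⊗ₜ[k] c)) := by
  induction t using TensorProduct.induction_on with
  | zero => simp
  | add x y hx hy => rw [TensorProduct.add_tmul, TensorProduct.add_tmul, map_add, map_add, hx, hy,
      map_add]
  | tmul x y => rw [biAct_tmul, biAct_tmul, LinearMap.lTensor_tmul, hv]

variable (G) in
/-- The automorphism of `S ⊗ G` with `x_i s ⊗ c ↦ (x_i ⊗ 1 + a (1 ⊗ x_i)) (s ⊗ c)`. -/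
def shear (a : k) : Poly k n ⊗[k] G →ₗ[k] Poly k n ⊗[k] G :=
  biAct ∘ₗ LinearMap.rTensor G (shearHom n a).toLinearMap

theorem shear_tmul (a : k) (s : Poly k n) (c : G) :
    shear G a (s ⊗ₜ[k] c) = biAct (shearHom n a s ⊗ₜ[k] c) := rfl

theorem shear_one (a : k) (c : G) : shear G a ((1 : Poly k n) ⊗ₜ[k] c) = 1 ⊗ₜ[k] c := by
  rw [shear_tmul, map_one, Algebra.TensorProduct.one_def, biAct_tmul, one_smul]

theorem shear_X_smul (a : k) (i : Fin (n + 1)) (x : Poly k n ⊗[k] G) :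
    shear G a ((MvPolynomial.X i : Poly k n) • x) = (MvPolynomial.X i : Poly k n) • shear G a x +
      a • LinearMap.lTensor (Poly k n) (actVar k G i) (shear G a x) := by
  induction x using TensorProduct.induction_on with
  | zero => simp
  | add x y hx hy =>
    rw [smul_add, map_add, hx, hy, map_add, map_add, smul_add, smul_add]
    abel
  | tmul s c =>
    rw [TensorProduct.smul_tmul', smul_eq_mul, shear_tmul, shear_tmul, map_mul]
    have : shearHom n a (MvPolynomial.X i) =
        MvPolynomial.X i ⊗ₜ[k] 1 + a • (1 ⊗ₜ[k] MvPolynomial.X i) := MvPolynomial.aeval_X _ _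
    rw [this, add_mul, TensorProduct.add_tmul, map_add, biAct_left_mul, smul_mul_assoc,
      ← TensorProduct.smul_tmul', map_smul, biAct_right_mul]

theorem shear_lTensor (a : k) (v : G →ₗ[k] G) (hv : ∀ (p : Poly k n) c, v (p • c) = p • v c)
    (x : Poly k n ⊗[k] G) :
    shear G a (LinearMap.lTensor (Poly k n) v x) =
      LinearMap.lTensor (Poly k n) v (shear G a x) := by
  induction x using TensorProduct.induction_on with
  | zero => simp
  | add x y hx hy => rw [map_add, map_add, hx, hy, map_add, map_add]
  | tmul s c => rw [LinearMap.lTensor_tmul, shear_tmul, shear_tmul, biAct_lTensor v hv]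

theorem actVar_smul (i : Fin (n + 1)) (p : Poly k n) (c : G) :
    actVar k G i (p • c) = p • actVar k G i c :=
  smul_comm _ _ _

theorem shear_shear (a b : k) (hab : a + b = 0) (x : Poly k n ⊗[k] G) :
    shear G a (shear G b x) = x := by
  have : shear G a ∘ₗ shear G b = (LinearMap.id : Poly k n ⊗[k] G →ₗ[k] _) := by
    refine tensor_poly_hom_ext (fun c => ?_) fun i s hs c => ?_
    · rw [LinearMap.comp_apply, shear_one, shear_one, LinearMap.id_apply]
    · have h1 := hs c
      rw [LinearMap.comp_apply, LinearMap.id_apply] at h1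
      rw [LinearMap.comp_apply, LinearMap.id_apply, ← smul_eq_mul, ← TensorProduct.smul_tmul',
        shear_X_smul, map_add, shear_X_smul, map_smul (shear G a) b,
        shear_lTensor _ _ (actVar_smul i), h1,
        add_assoc, ← add_smul, hab, zero_smul, add_zero]
  exact LinearMap.congr_fun this x

/-- Division by `x_i`, discarding the remainder. -/
def divVar (k : Type uk) [Field k] (n : ℕ) (i : Fin (n + 1)) : Poly k n →ₗ[k] Poly k n where
  toFun p := p.divMonomial (Finsupp.single i 1)
  map_add' p q := MvPolynomial.add_divMonomial p q _
  map_smul' r p := by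
    ext m
    simp [MvPolynomial.coeff_divMonomial]

theorem divVar_X_mul (i : Fin (n + 1)) (p : Poly k n) :
    divVar k n i (MvPolynomial.X i * p) = p :=
  MvPolynomial.X_mul_divMonomial i p

theorem divVar_X_mul_of_ne {i j : Fin (n + 1)} (hij : i ≠ j) (p : Poly k n) :
    divVar k n i (MvPolynomial.X j * p) = MvPolynomial.X j * divVar k n i p := by
  ext m
  simp only [divVar, LinearMap.coe_mk, AddHom.coe_mk, MvPolynomial.coeff_divMonomial,
    MvPolynomial.coeff_X_mul']
  have h1 : j ∈ (Finsupp.single i 1 + m).support ↔ j ∈ m.support := by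
    simp [hij]
  by_cases hj : j ∈ m.support
  -- Subtraction of exponents is truncated; it reassociates because x_j divides the monomial m.
  · rw [if_pos (h1.2 hj), if_pos hj, add_tsub_assoc_of_le]
    rw [Finsupp.single_le_iff]
    exact Nat.one_le_iff_ne_zero.2 (Finsupp.mem_support_iff.1 hj)
  · rw [if_neg (fun h => hj (h1.1 h)), if_neg hj]

theorem divVar_one (i : Fin (n + 1)) : divVar k n i 1 = 0 := by
  ext m
  simp only [divVar, LinearMap.coe_mk, AddHom.coe_mk, MvPolynomial.coeff_divMonomial,
    MvPolynomial.coeff_one, MvPolynomial.coeff_zero]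
  rw [if_neg]
  intro h
  have := DFunLike.congr_fun h i
  simp at this
  omega

variable (k n G) in
/-- The endomorphism `x_i ⊗ 1 - 1 ⊗ x_i` of `S ⊗ G`. -/
def diagVar (i : Fin (n + 1)) : Module.End k (Poly k n ⊗[k] G) :=
  (LinearMap.lsmul (Poly k n) (Poly k n ⊗[k] G) (MvPolynomial.X i)).restrictScalars k -
    LinearMap.lTensor (Poly k n) (actVar k G i)

theorem diagVar_apply (i : Fin (n + 1)) (x : Poly k n ⊗[k] G) : diagVar k n G i x =
    (MvPolynomial.X i : Poly k n) • x - LinearMap.lTensor (Poly k n) (actVar k G i) x := rfl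

theorem diagVar_tmul (i : Fin (n + 1)) (s : Poly k n) (c : G) : diagVar k n G i (s ⊗ₜ[k] c) =
    (MvPolynomial.X i * s) ⊗ₜ[k] c - s ⊗ₜ[k] ((MvPolynomial.X i : Poly k n) • c) := rfl

variable (k n G) in
/-- Division by `x_i ⊗ 1 - 1 ⊗ x_i` on `S ⊗ G`. -/
def divDiag (i : Fin (n + 1)) : Module.End k (Poly k n ⊗[k] G) :=
  shear G (-1) ∘ₗ LinearMap.rTensor G (divVar k n i) ∘ₗ shear G 1

theorem rTensor_divVar_X_smul (i : Fin (n + 1)) (x : Poly k n ⊗[k] G) :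
    LinearMap.rTensor G (divVar k n i) ((MvPolynomial.X i : Poly k n) • x) = x := by
  induction x using TensorProduct.induction_on with
  | zero => simp
  | add x y hx hy => rw [smul_add, map_add, hx, hy]
  | tmul s c =>
    rw [TensorProduct.smul_tmul', smul_eq_mul, LinearMap.rTensor_tmul, divVar_X_mul]

theorem rTensor_divVar_X_smul_of_ne {i j : Fin (n + 1)} (hij : i ≠ j) (x : Poly k n ⊗[k] G) :
    LinearMap.rTensor G (divVar k n i) ((MvPolynomial.X j : Poly k n) • x) =
      (MvPolynomial.X j : Poly k n) • LinearMap.rTensor G (divVar k n i) x := by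
  induction x using TensorProduct.induction_on with
  | zero => simp
  | add x y hx hy => rw [smul_add, map_add, hx, hy, map_add, smul_add]
  | tmul s c =>
    rw [TensorProduct.smul_tmul', smul_eq_mul, LinearMap.rTensor_tmul, divVar_X_mul_of_ne hij,
      LinearMap.rTensor_tmul, TensorProduct.smul_tmul', smul_eq_mul]

/-- The point of the shear: it conjugates x_i ⊗ 1 - 1 ⊗ x_i into multiplication by x_i on the left
factor, where division by monomials is available. No freeness of G is needed, and the resulting
quotient operator `divDiag` is only k-linear. -/
theorem shear_diagVar (i : Fin (n + 1)) (x : Poly k n ⊗[k] G) :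
    shear G 1 (diagVar k n G i x) = (MvPolynomial.X i : Poly k n) • shear G 1 x := by
  rw [diagVar_apply, map_sub, shear_X_smul, shear_lTensor _ _ (actVar_smul i), one_smul,
    add_sub_cancel_right]

theorem diagVar_shear (i : Fin (n + 1)) (x : Poly k n ⊗[k] G) :
    diagVar k n G i (shear G (-1) x) = shear G (-1) ((MvPolynomial.X i : Poly k n) • x) := by
  rw [diagVar_apply, shear_X_smul, sub_eq_add_neg]
  congr 1
  exact (neg_one_smul k _).symm

theorem divDiag_mul_diagVar (i : Fin (n + 1)) : divDiag k n G i * diagVar k n G i = 1 := by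
  refine LinearMap.ext fun x => ?_
  change shear G (-1) (LinearMap.rTensor G (divVar k n i) (shear G 1 (diagVar k n G i x))) = x
  rw [shear_diagVar, rTensor_divVar_X_smul, shear_shear _ _ (neg_add_cancel 1)]

theorem divDiag_mul_diagVar_of_ne {i j : Fin (n + 1)} (hij : i ≠ j) :
    divDiag k n G i * diagVar k n G j = diagVar k n G j * divDiag k n G i := by
  refine LinearMap.ext fun x => ?_
  change shear G (-1) (LinearMap.rTensor G (divVar k n i) (shear G 1 (diagVar k n G j x))) =
    diagVar k n G j (shear G (-1) (LinearMap.rTensor G (divVar k n i) (shear G 1 x)))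
  rw [shear_diagVar, rTensor_divVar_X_smul_of_ne hij, diagVar_shear]

theorem divDiag_mul_lTensor (i : Fin (n + 1)) (v : G →ₗ[k] G)
    (hv : ∀ (p : Poly k n) c, v (p • c) = p • v c) :
    divDiag k n G i * LinearMap.lTensor (Poly k n) v =
      LinearMap.lTensor (Poly k n) v * divDiag k n G i := by
  refine LinearMap.ext fun x => ?_
  change shear G (-1) (LinearMap.rTensor G (divVar k n i) (shear G 1
    (LinearMap.lTensor (Poly k n) v x))) = LinearMap.lTensor (Poly k n) v (shear G (-1)
      (LinearMap.rTensor G (divVar k n i) (shear G 1 x)))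
  rw [shear_lTensor 1 v hv, ← shear_lTensor (-1) v hv]
  refine congrArg (shear G (-1)) ?_
  exact LinearMap.congr_fun ((LinearMap.rTensor_comp_lTensor _ _ _).trans
    (LinearMap.lTensor_comp_rTensor _ _ _).symm) (shear G 1 x)

theorem divDiag_one_tmul (i : Fin (n + 1)) (c : G) :
    divDiag k n G i ((1 : Poly k n) ⊗ₜ[k] c) = 0 := by
  change shear G (-1) (LinearMap.rTensor G (divVar k n i) (shear G 1 _)) = 0
  rw [shear_one, LinearMap.rTensor_tmul, divVar_one, TensorProduct.zero_tmul, map_zero]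

theorem diagVar_mul_lTensor (i : Fin (n + 1)) (v : G →ₗ[k] G)
    (hv : ∀ (p : Poly k n) c, v (p • c) = p • v c) :
    diagVar k n G i * LinearMap.lTensor (Poly k n) v =
      LinearMap.lTensor (Poly k n) v * diagVar k n G i := by
  apply TensorProduct.ext'
  intro s c
  simp only [Module.End.mul_apply, LinearMap.lTensor_tmul, diagVar_tmul, map_sub, hv]

theorem diagVar_comm (i j : Fin (n + 1)) :
    diagVar k n G i * diagVar k n G j = diagVar k n G j * diagVar k n G i := by
  apply TensorProduct.ext'
  intro s c
  simp only [Module.End.mul_apply, diagVar_tmul, map_sub, mul_left_comm (MvPolynomial.X i),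
    smul_comm (MvPolynomial.X i : Poly k n) (MvPolynomial.X j : Poly k n) c]
  abel

/-- The element y_i commutes with the factors of index different from i, so it can be moved left
until it meets 1 - y_i q_i, and (1 - y_i q_i) y_i = 0 by q_i y_i = 1. -/
theorem prod_proj_mul_eq_zero {B κ : Type*} [Ring B] (y q : κ → B)
    (hy : ∀ i j, y i * y j = y j * y i) (hq : ∀ i, q i * y i = 1)
    (hqy : ∀ i j, i ≠ j → q i * y j = y j * q i) {l : List κ} {i : κ} (hi : i ∈ l) :
    (l.map fun i => 1 - y i * q i).prod * y i = 0 := by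
  classical
  induction l with
  | nil => simp at hi
  | cons j l ih =>
    rw [List.map_cons, List.prod_cons, mul_assoc]
    -- The list may repeat indices; the last occurrence of i is the one that kills y_i.
    by_cases hil : i ∈ l
    · rw [ih hil, mul_zero]
    · obtain rfl : i = j := by simpa [hil] using hi
      have hcomm : ∀ l : List κ, i ∉ l →
          (l.map fun i => 1 - y i * q i).prod * y i = y i * (l.map fun i => 1 - y i * q i).prod := by
        intro l hl
        induction l with
        | nil => simp
        | cons j l ih =>
          rw [List.mem_cons, not_or] at hl
          rw [List.map_cons, List.prod_cons, mul_assoc, ih hl.2, ← mul_assoc, ← mul_assoc]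
          congr 1
          rw [sub_mul, mul_sub, mul_assoc, hqy j i (Ne.symm hl.1), one_mul, mul_one, ← mul_assoc,
            ← mul_assoc, hy]
      rw [hcomm l hil, ← mul_assoc, sub_mul, mul_assoc, hq, one_mul, mul_one, sub_self, zero_mul]

/-- The product of the projections `1 - y_i q_i`, where `y_i = x_i ⊗ 1 - 1 ⊗ x_i` and `q_i` is
division by `y_i`. -/
theorem prod_proj_tmul {l : List (Fin (n + 1))} (hl : ∀ i, i ∈ l) (s : Poly k n) (c : G) :
    (l.map fun i => (1 - diagVar k n G i * divDiag k n G i)).prod (s ⊗ₜ[k] c) =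
      (1 : Poly k n) ⊗ₜ[k] (s • c) := by
  have h1 : ∀ l : List (Fin (n + 1)), ∀ c : G,
      (l.map fun i => (1 - diagVar k n G i * divDiag k n G i)).prod ((1 : Poly k n) ⊗ₜ[k] c) =
        (1 : Poly k n) ⊗ₜ[k] c := by
    intro l c
    induction l with
    | nil => rfl
    | cons i l ih =>
      rw [List.map_cons, List.prod_cons, Module.End.mul_apply, ih, LinearMap.sub_apply,
        Module.End.mul_apply, divDiag_one_tmul, map_zero, sub_zero, Module.End.one_apply]
  -- The product fixes 1 ⊗ c and kills the image of each y_i, so x_i s ⊗ c and s ⊗ x_i c have the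
  -- same image. Moving the variables across one at a time reduces to the case s = 1.
  have key : (l.map fun i => (1 - diagVar k n G i * divDiag k n G i)).prod =
      TensorProduct.mk k (Poly k n) G 1 ∘ₗ actHom k n G := by
    refine tensor_poly_hom_ext (fun c => ?_) fun i s hs c => ?_
    · rw [h1, LinearMap.comp_apply, actHom_tmul, one_smul, TensorProduct.mk_apply]
    · have h4 := LinearMap.congr_fun (prod_proj_mul_eq_zero (diagVar k n G) (divDiag k n G) diagVar_comm
        divDiag_mul_diagVar (fun _ _ => divDiag_mul_diagVar_of_ne) (hl i)) (s ⊗ₜ[k] c)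
      rw [Module.End.mul_apply, diagVar_tmul, map_sub, LinearMap.zero_apply, sub_eq_zero] at h4
      rw [h4, hs]
      simp only [LinearMap.comp_apply, actHom_tmul, smul_smul, mul_comm s]
  rw [key]
  rfl

end Shear

/-! ### Multiplication and contraction operators on ω_E -/

section ExteriorDual

variable {k : Type uk} [Field k] {n : ℕ} {A : Type uA} [AddCommGroup A] [DecidableEq A]
variable {w : Fin (n + 1) → A}

theorem extVar_mul_of_mem {d : A × ℤ} (i : Fin (n + 1)) {y : Ext k n}
    (hy : y ∈ extGr (k := k) w d) : extVar k n i * y = (d.2.negOnePow : ℤ) • (y * extVar k n i) := by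
  refine Submodule.span_induction (p := fun y _ => extVar k n i * y =
    (d.2.negOnePow : ℤ) • (y * extVar k n i)) ?_ ?_ ?_ ?_ hy
  · clear hy
    rintro _ ⟨v, rfl, rfl⟩
    induction v with
    | nil => simp
    | cons j v ih =>
      rw [List.map_cons, List.prod_cons, ← mul_assoc, extVar_anticomm, neg_mul, mul_assoc, ih,
        List.map_cons, List.sum_cons, Prod.snd_add, Int.negOnePow_add, mul_smul_comm, mul_assoc]
      simp
  · simp
  · intro x y _ _ hx hy
    rw [mul_add, hx, hy, add_mul, smul_add]
  · intro a x _ hx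
    rw [mul_smul_comm, hx, smul_mul_assoc, smul_comm]

/-- Left multiplication by `e_i` on `ω_E` is the negative of the transpose of right multiplication
by `e_i` on `E`. -/
theorem omegaLeft_apply (i : Fin (n + 1)) (f : Omega k n) (y : Ext k n) :
    omegaLeft w i f y = - f (y * extVar k n i) := by
  have : omegaLeft w i = - Module.Dual.transpose (R := k) (LinearMap.mulRight k (extVar k n i)) := by
    refine linearMap_ext_grading (isInternal_omegaGr (k := k) w) fun d f hf => ?_
    refine linearMap_ext_grading (isInternal_extGr (k := k) w) fun d' y hy => ?_
    rw [omegaLeft_of_mem i hf]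
    change (d.2.negOnePow : ℤ) • f (extVar k n i * y) = - f (y * extVar k n i)
    have hmem := SetLike.GradedMul.mul_mem (A := extGr (k := k) w) hy (extVar_mem_extGr w i)
    -- If y e_i lies in the degree -d that f can detect, then d.2 = 1 - d'.2, so the sign from the
    -- left action and the sign from commuting e_i past y multiply to -1. Otherwise both sides
    -- vanish.
    by_cases hd : d' + (-w i, -1) = -d
    · rw [extVar_mul_of_mem i hy, map_zsmul, smul_smul]
      have h2 : d.2 = -d'.2 + 1 := by
        have := congrArg Prod.snd hd
        simp only [Prod.snd_add, Prod.snd_neg] at this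
        linarith
      rw [h2, Int.negOnePow_add, Int.negOnePow_neg]
      have : (((d'.2.negOnePow * Int.negOnePow 1 : ℤˣ) : ℤ) * (d'.2.negOnePow : ℤ)) = -1 := by
        rw [← Units.val_mul, mul_right_comm, Int.units_mul_self]
        simp
      rw [this, neg_one_zsmul]
    · rw [extVar_mul_of_mem i hy, map_zsmul, hf _ hd _ hmem]
      simp
  exact LinearMap.congr_fun (LinearMap.congr_fun this f) y

variable (k n) in
/-- The contraction of `E` with the `i`-th coordinate functional, from the right. -/
def contractVar (i : Fin (n + 1)) : Ext k n →ₗ[k] Ext k n :=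
  CliffordAlgebra.contractRight.flip (LinearMap.proj i : (Fin (n + 1) → k) →ₗ[k] k)

theorem contractVar_mul_extVar (i j : Fin (n + 1)) (y : Ext k n) :
    contractVar k n i (y * extVar k n j) =
      (if i = j then y else 0) - contractVar k n i y * extVar k n j := by
  have := CliffordAlgebra.contractRight_mul_ι (Q := (0 : QuadraticForm k (Fin (n + 1) → k)))
    (LinearMap.proj i : (Fin (n + 1) → k) →ₗ[k] k) (Pi.single j 1) y
  refine this.trans ?_
  congr 1
  by_cases h : i = j
  · subst h; simp
  · simp [h]

variable (k n) in
/-- The negative of the transpose of the contraction of `E` with the `i`-th coordinate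
functional. -/
def omegaWedge (i : Fin (n + 1)) : Omega k n →ₗ[k] Omega k n :=
  - Module.Dual.transpose (R := k) (contractVar k n i)

theorem omegaWedge_apply (i : Fin (n + 1)) (f : Omega k n) (y : Ext k n) :
    omegaWedge k n i f y = - f (contractVar k n i y) := rfl

/-- These are the transposed Clifford relations: contraction is an antiderivation for right
multiplication by e_j, and the minus signs in the two operators cancel. They are the input on ω_E
for the Koszul homotopies. -/
theorem omegaLeft_omegaWedge (i j : Fin (n + 1)) (f : Omega k n) :
    omegaLeft w j (omegaWedge k n i f) + omegaWedge k n i (omegaLeft w j f) =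
      if i = j then f else 0 := by
  refine LinearMap.ext fun y => ?_
  rw [LinearMap.add_apply, omegaLeft_apply, omegaWedge_apply, omegaWedge_apply, omegaLeft_apply,
    contractVar_mul_extVar, map_sub]
  split_ifs <;> simp

variable (k n) in
/-- The functional `E → k` that takes the degree zero part. -/
def augmentation : Omega k n := (ExteriorAlgebra.algebraMapInv (R := k)
  (M := Fin (n + 1) → k)).toLinearMap

theorem augmentation_one : augmentation k n 1 = 1 := map_one ExteriorAlgebra.algebraMapInv

theorem augmentation_mul_extVar (y : Ext k n) (i : Fin (n + 1)) :
    augmentation k n (y * extVar k n i) = 0 := by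
  change ExteriorAlgebra.algebraMapInv (y * extVar k n i) = 0
  rw [map_mul, extVar]
  simp [ExteriorAlgebra.algebraMapInv]

theorem omegaLeft_augmentation (i : Fin (n + 1)) : omegaLeft w i (augmentation k n) = 0 := by
  refine LinearMap.ext fun y => ?_
  rw [omegaLeft_apply, augmentation_mul_extVar, neg_zero, LinearMap.zero_apply]

/-- As a vector space, E is spanned by 1 and the right multiples y e_i. -/
theorem omega_ext {f g : Omega k n} (h1 : f 1 = g 1)
    (h : ∀ y i, f (y * extVar k n i) = g (y * extVar k n i)) : f = g := by
  refine LinearMap.ext fun y => ?_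
  induction y using CliffordAlgebra.right_induction with
  | algebraMap r => rw [Algebra.algebraMap_eq_smul_one, map_smul, map_smul, h1]
  | add x y hx hy => rw [map_add, map_add, hx, hy]
  | mul_ι x m _ =>
    have hv : CliffordAlgebra.ι (0 : QuadraticForm k (Fin (n + 1) → k)) x =
        ∑ l, x l • extVar k n l := by
      conv_lhs => rw [pi_eq_sum_univ' x]
      rw [map_sum]
      refine Finset.sum_congr rfl fun l _ => ?_
      rw [map_smul]
      rfl
    rw [hv, Finset.mul_sum, map_sum, map_sum]
    refine Finset.sum_congr rfl fun l _ => ?_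
    rw [mul_smul_comm, map_smul, map_smul, h]

/-- Each factor is the transpose of y ↦ contraction of y e_i. That operator fixes 1, kills E e_i,
and maps E e_j into itself for j ≠ i. When all indices occur, the product therefore leaves a
functional that agrees with f at 1 and vanishes on every E e_i. -/
theorem prod_omega_apply (w : Fin (n + 1) → A) {l : List (Fin (n + 1))} (hl : ∀ i, i ∈ l)
    (f : Omega k n) :
    (l.map fun i => (omegaLeft w i * omegaWedge k n i : Module.End k (Omega k n))).prod f =
      f 1 • augmentation k n := by
  have happ : ∀ i (f : Omega k n) y, (omegaLeft w i * omegaWedge k n i : Module.End k (Omega k n))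
      f y = f (contractVar k n i (y * extVar k n i)) := by
    intro i f y
    rw [Module.End.mul_apply, omegaLeft_apply, omegaWedge_apply, neg_neg]
  have hone : ∀ i, contractVar k n i 1 = 0 := fun i => CliffordAlgebra.contractRight_one _ _
  have h1 : ∀ l : List (Fin (n + 1)), (l.map fun i =>
      (omegaLeft w i * omegaWedge k n i : Module.End k (Omega k n))).prod f 1 = f 1 := by
    intro l
    induction l with
    | nil => rfl
    | cons i l ih =>
      rw [List.map_cons, List.prod_cons, Module.End.mul_apply, happ, contractVar_mul_extVar,
        if_pos rfl, hone, zero_mul, sub_zero, ih]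
  have h2 : ∀ l : List (Fin (n + 1)), ∀ i ∈ l, ∀ y, (l.map fun i =>
      (omegaLeft w i * omegaWedge k n i : Module.End k (Omega k n))).prod f
        (y * extVar k n i) = 0 := by
    intro l i hi y
    induction l generalizing y with
    | nil => simp at hi
    | cons j l ih =>
      rw [List.map_cons, List.prod_cons, Module.End.mul_apply, happ]
      by_cases hij : j = i
      · subst hij
        rw [mul_assoc, extVar_sq, mul_zero, map_zero, map_zero]
      · rw [mul_assoc, extVar_anticomm, mul_neg, map_neg, ← mul_assoc, contractVar_mul_extVar,
          if_neg hij, zero_sub, neg_neg]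
        refine ih ?_ _
        simpa [Ne.symm hij] using hi
  refine omega_ext ?_ fun y i => ?_
  · rw [h1, LinearMap.smul_apply, augmentation_one, smul_eq_mul, mul_one]
  · rw [h2 l i (hl i), LinearMap.smul_apply, augmentation_mul_extVar, smul_zero]

end ExteriorDual

/-! ### Koszul homotopies, one variable at a time -/

section KoszulHomotopy

variable {k : Type*} [Field k] {m : ℕ} {W V : Type*} [AddCommGroup W] [Module k W]
  [AddCommGroup V] [Module k V]

/-- The differential `∑ y_j σ ⊗ l_j - δ ⊗ 1` on `W ⊗ V`. -/
def koszulDiff (y : Fin m → Module.End k W) (σ δ : Module.End k W) (l : Fin m → Module.End k V) :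
    Module.End k (W ⊗[k] V) :=
  ∑ j, TensorProduct.map (y j * σ) (l j) - TensorProduct.map δ 1

theorem koszulDiff_tmul (y : Fin m → Module.End k W) (σ δ : Module.End k W)
    (l : Fin m → Module.End k V) (x : W) (f : V) :
    koszulDiff y σ δ l (x ⊗ₜ[k] f) = ∑ j, y j (σ x) ⊗ₜ[k] l j f - δ x ⊗ₜ[k] f := by
  simp [koszulDiff, LinearMap.sum_apply]

/-- A homotopy between the identity and the projection `(1 - y_i q_i) ⊗ l_i c_i` for the
differential `∑ y_j σ ⊗ l_j - δ ⊗ 1`. -/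
theorem koszul_homotopy (y q : Fin m → Module.End k W) (σ δ : Module.End k W)
    (l c : Fin m → Module.End k V) (hqy : ∀ i, q i * y i = 1)
    (hqy' : ∀ i j, i ≠ j → q i * y j = y j * q i) (hσ : σ * σ = 1)
    (hσy : ∀ i, y i * σ = σ * y i) (hσq : ∀ i, q i * σ = σ * q i) (hδq : ∀ i, q i * δ = δ * q i)
    (hδσ : δ * σ = -(σ * δ)) (hlc : ∀ i j, l j * c i + c i * l j = if i = j then 1 else 0)
    (i : Fin m) :
    koszulDiff y σ δ l * TensorProduct.map (q i * σ) (c i) +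
      TensorProduct.map (q i * σ) (c i) * koszulDiff y σ δ l =
      1 - TensorProduct.map (1 - y i * q i) (l i * c i) := by
  have hsub : ∀ (a b : Module.End k W) (g : Module.End k V),
      TensorProduct.map (a - b) g = TensorProduct.map a g - TensorProduct.map b g :=
    fun a b g => TensorProduct.ext' fun x z => by simp [TensorProduct.sub_tmul]
  have hneg : ∀ (a : Module.End k W) (g : Module.End k V),
      TensorProduct.map (-a) g = -TensorProduct.map a g :=
    fun a g => TensorProduct.ext' fun x z => by simp [TensorProduct.neg_tmul]
  have hσσ : ∀ a b : Module.End k W, a * σ * (b * σ) = a * (σ * b) * σ := fun a b => by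
    simp only [mul_assoc]
  have e1 : ∀ j, y j * σ * (q i * σ) = y j * q i := fun j => by
    rw [hσσ, ← hσq, mul_assoc, mul_assoc (q i), hσ, mul_one]
  have e2 : ∀ j, q i * σ * (y j * σ) = q i * y j := fun j => by
    rw [hσσ, ← hσy, mul_assoc, mul_assoc (y j), hσ, mul_one]
  have e3 : δ * (q i * σ) = -(q i * σ * δ) := by
    rw [← mul_assoc, ← hδq, mul_assoc, hδσ, mul_neg, mul_assoc]
  -- For j ≠ i the two terms share the factor y_j q_i = q_i y_j and cancel by anticommutation of l_j
  -- and c_i. For j = i, use q_i y_i = 1 and c_i l_i = 1 - l_i c_i.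
  have e4 : ∀ j, TensorProduct.map (y j * q i) (l j * c i) +
      TensorProduct.map (q i * y j) (c i * l j) =
      if j = i then 1 - TensorProduct.map (1 - y i * q i) (l i * c i) else 0 := by
    intro j
    have h := hlc i j
    split_ifs with hj
    · subst hj
      rw [if_pos rfl] at h
      rw [hqy, hsub, sub_sub_eq_add_sub, add_comm, eq_sub_iff_add_eq,
        add_right_comm, add_right_cancel_iff, ← TensorProduct.map_add_right, add_comm, h]
      exact TensorProduct.map_id
    · rw [if_neg (Ne.symm hj)] at h
      rw [hqy' i j (Ne.symm hj), ← TensorProduct.map_add_right, h, TensorProduct.map_zero_right]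
  rw [koszulDiff, sub_mul, mul_sub, Finset.sum_mul, Finset.mul_sum]
  simp only [← TensorProduct.map_mul, e1, e2, e3, one_mul, mul_one]
  rw [hneg, sub_neg_eq_add, add_add_sub_cancel, ← Finset.sum_add_distrib]
  simp only [e4]
  simp

/-- Each P_i is homotopic to the identity, so it sends a cycle to a cycle and changes it by a
boundary; the boundaries add up along the list. -/
theorem homologous_prod {M κ : Type*} [AddCommGroup M] [Module k M] (d : Module.End k M)
    (s P : κ → Module.End k M) (h : ∀ i, d * s i + s i * d = 1 - P i) (hd : d * d = 0)
    (l : List κ) {x : M} (hx : d x = 0) :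
    d ((l.map P).prod x) = 0 ∧ ∃ z, d z = x - (l.map P).prod x := by
  have hd' : ∀ z, d (d z) = 0 := LinearMap.congr_fun hd
  induction l with
  | nil => exact ⟨by simpa using hx, 0, by simp⟩
  | cons i l ih =>
    obtain ⟨h1, z, hz⟩ := ih
    rw [List.map_cons, List.prod_cons, Module.End.mul_apply]
    have h2 := LinearMap.congr_fun (h i) ((l.map P).prod x)
    simp only [LinearMap.add_apply, Module.End.mul_apply, LinearMap.sub_apply,
      Module.End.one_apply, h1, map_zero, add_zero] at h2
    have h3 : P i ((l.map P).prod x) = (l.map P).prod x - d (s i ((l.map P).prod x)) := by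
      rw [h2]; abel
    refine ⟨by rw [h3, map_sub, h1, hd', sub_zero], z + s i ((l.map P).prod x), ?_⟩
    rw [h3, map_add, hz]
    abel

theorem prod_map_tensor {κ : Type*} (e : κ → Module.End k W) (g : κ → Module.End k V)
    (l : List κ) : (l.map fun i => (TensorProduct.map (e i) (g i) : Module.End k (W ⊗[k] V))).prod =
      TensorProduct.map (l.map e).prod (l.map g).prod := by
  induction l with
  | nil => exact TensorProduct.map_id.symm
  | cons i l ih => rw [List.map_cons, List.prod_cons, ih, ← TensorProduct.map_mul]; rfl

/-- A cycle of the differential `∑ y_j σ ⊗ l_j - δ ⊗ 1` is homologous to its projection under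
`(∏ (1 - y_i q_i)) ⊗ (∏ l_i c_i)`. -/
theorem koszulDiff_homologous (y q : Fin m → Module.End k W) (σ δ : Module.End k W)
    (l c : Fin m → Module.End k V) (hqy : ∀ i, q i * y i = 1)
    (hqy' : ∀ i j, i ≠ j → q i * y j = y j * q i) (hσ : σ * σ = 1)
    (hσy : ∀ i, y i * σ = σ * y i) (hσq : ∀ i, q i * σ = σ * q i) (hδq : ∀ i, q i * δ = δ * q i)
    (hδσ : δ * σ = -(σ * δ)) (hlc : ∀ i j, l j * c i + c i * l j = if i = j then 1 else 0)
    (hsq : ∀ x, koszulDiff y σ δ l (koszulDiff y σ δ l x) = 0) (L : List (Fin m)) {x : W ⊗[k] V}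
    (hx : koszulDiff y σ δ l x = 0) :
    ∃ z, x = koszulDiff y σ δ l z + TensorProduct.map (L.map fun i => 1 - y i * q i).prod
      (L.map fun i => l i * c i).prod x := by
  obtain ⟨-, z, hz⟩ := homologous_prod (koszulDiff y σ δ l)
    (fun i => TensorProduct.map (q i * σ) (c i))
    (fun i => TensorProduct.map (1 - y i * q i) (l i * c i))
    (koszul_homotopy y q σ δ l c hqy hqy' hσ hσy hσq hδq hδσ hlc) (LinearMap.ext hsq) L hx
  rw [prod_map_tensor] at hz
  exact ⟨z, by rw [hz, sub_add_cancel]⟩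

theorem koszulDiff_tmul_of_eq_zero (y : Fin m → Module.End k W) (σ δ : Module.End k W)
    (l : Fin m → Module.End k V) (x : W) {f : V} (hf : ∀ j, l j f = 0) :
    koszulDiff y σ δ l (x ⊗ₜ[k] f) = (-δ x) ⊗ₜ[k] f := by
  simp [koszulDiff_tmul, hf, TensorProduct.neg_tmul]

/-- Splitting y_i = a_i ⊗ 1 - 1 ⊗ b_i separates the Koszul differential into a part that will be ∂'
and a part that will be minus the differential of R(G). -/
theorem assoc_koszulDiff {T U : Type*} [AddCommGroup T] [Module k T] [AddCommGroup U] [Module k U]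
    (y : Fin m → Module.End k (T ⊗[k] U)) (a : Fin m → Module.End k T) (b : Fin m → Module.End k U)
    (σ δ : Module.End k U) (l : Fin m → Module.End k V)
    (hy : ∀ i s c, y i (s ⊗ₜ[k] c) = a i s ⊗ₜ[k] c - s ⊗ₜ[k] b i c) (s : T) (c : U) (f : V) :
    TensorProduct.assoc k T U V (koszulDiff y (LinearMap.lTensor T σ) (LinearMap.lTensor T δ) l
      ((s ⊗ₜ[k] c) ⊗ₜ[k] f)) = ∑ i, a i s ⊗ₜ[k] (σ c ⊗ₜ[k] l i f) +
        -(s ⊗ₜ[k] (∑ i, b i (σ c) ⊗ₜ[k] l i f + δ c ⊗ₜ[k] f)) := by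
  simp only [koszulDiff_tmul, LinearMap.lTensor_tmul, hy, TensorProduct.sub_tmul, map_sub, map_sum,
    TensorProduct.assoc_tmul, Finset.sum_sub_distrib, TensorProduct.tmul_add,
    TensorProduct.tmul_sum]
  abel

end KoszulHomotopy

/-! ### The quasi-isomorphism from L(R(G)) to G -/

section Counit

variable {k : Type uk} [Field k] {n : ℕ} {A : Type uA} [AddCommGroup A] [DecidableEq A]
variable {w : Fin (n + 1) → A}

theorem GrMod.sign_of_mem (M : GrMod.{u} k w) {a : A} {j : ℤ} {m : M} (hm : m ∈ M.gr (a, j)) :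
    M.sign m = (j.negOnePow : ℤ) • m :=
  signOp_of_mem _ _ hm

theorem GrMod.sign_mem (M : GrMod.{u} k w) {d : A × ℤ} {m : M} (hm : m ∈ M.gr d) :
    M.sign m ∈ M.gr d := by
  rw [GrMod.sign, signOp_of_mem _ _ hm]
  exact zsmul_mem hm _

theorem GrMod.sign_sign (M : GrMod.{u} k w) (m : M) : M.sign (M.sign m) = m := by
  have : M.sign ∘ₗ M.sign = LinearMap.id := by
    refine linearMap_ext_grading M.isInternal ?_
    rintro ⟨a, j⟩ m hm
    rw [LinearMap.comp_apply, M.sign_of_mem hm, map_zsmul, M.sign_of_mem hm, smul_smul,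
      ← Units.val_mul, Int.units_mul_self, Units.val_one, one_smul, LinearMap.id_apply]
  exact LinearMap.congr_fun this m

theorem GrMod.sign_smul (M : GrMod.{u} k w) (p : Poly k n) (m : M) :
    M.sign (p • m) = p • M.sign m := by
  induction p using MvPolynomial.induction_on generalizing m with
  | C a =>
    rw [← MvPolynomial.algebraMap_eq, algebraMap_smul, algebraMap_smul, map_smul]
  | add p q hp hq => rw [add_smul, map_add, hp, hq, add_smul]
  | mul_X p i hp =>
    rw [mul_smul, mul_smul, hp]
    congr 1
    have : M.sign ∘ₗ M.mulVar i = M.mulVar i ∘ₗ M.sign := by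
      refine linearMap_ext_grading M.isInternal ?_
      rintro ⟨a, j⟩ m hm
      have h1 := M.X_smul_mem i hm
      rw [LinearMap.comp_apply, LinearMap.comp_apply, M.sign_of_mem hm, map_zsmul]
      exact M.sign_of_mem h1
    exact LinearMap.congr_fun this m

theorem Cpx.d_sign (C : Cpx.{u} k w) (m : C.toGrMod) :
    C.d (C.toGrMod.sign m) = - C.toGrMod.sign (C.d m) := by
  have : (C.d.restrictScalars k) ∘ₗ C.toGrMod.sign =
      -(C.toGrMod.sign ∘ₗ C.d.restrictScalars k) := by
    refine linearMap_ext_grading C.toGrMod.isInternal ?_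
    rintro ⟨a, j⟩ m hm
    have h1 := C.isDifferential.homogeneous a j m hm
    simp only [LinearMap.comp_apply, LinearMap.neg_apply, LinearMap.restrictScalars_apply]
    rw [C.toGrMod.sign_of_mem hm, C.toGrMod.sign_of_mem h1, map_zsmul, Int.negOnePow_add]
    simp
  exact LinearMap.congr_fun this m

variable (G : Cpx.{u} k w)

/-- The auxiliary degree of c ⊗ f is the sum of those of c and f, so the sign in the left action
splits between the two factors. -/
theorem R_leftVar_tmul (i : Fin (n + 1)) (c : G.toGrMod) (f : Omega k n) :
    (R G).leftVar i (c ⊗ₜ[k] f) = G.toGrMod.sign c ⊗ₜ[k] omegaLeft w i f := by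
  have : (R G).leftVar i = TensorProduct.map G.toGrMod.sign (omegaLeft w i) := by
    refine tensor_ext G.toGrMod ?_
    rintro ⟨a, j⟩ c hc d' f hf
    have h1 : c ⊗ₜ[k] f ∈ (R G).gr ((a, j) + d') := tmul_mem_tensorGr _ hc hf rfl
    rw [(R G).leftVar_of_mem i h1, TensorProduct.map_tmul, G.toGrMod.sign_of_mem hc,
      omegaLeft_of_mem i hf, Prod.snd_add, Int.negOnePow_add]
    change _ • RAct G.toGrMod _ _ = _
    rw [RAct_tmul, TensorProduct.tmul_smul, ← TensorProduct.smul_tmul', smul_smul, mul_comm,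
      Units.val_mul]
  exact LinearMap.congr_fun this _

/-- The identification `(S ⊗ G) ⊗ ω_E = L(R(G))`. -/
def LRequiv : (Poly k n ⊗[k] G.toGrMod.carrier) ⊗[k] Omega k n ≃ₗ[k] (L (R G)).toGrMod :=
  TensorProduct.assoc k (Poly k n) G.toGrMod.carrier (Omega k n)

theorem LRequiv_tmul (s : Poly k n) (c : G.toGrMod) (f : Omega k n) :
    LRequiv G ((s ⊗ₜ[k] c) ⊗ₜ[k] f) = s ⊗ₜ[k] (c ⊗ₜ[k] f) := rfl

/-- The differential of `L(R(G))` on `(S ⊗ G) ⊗ ω_E`. -/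
def dLR : Module.End k ((Poly k n ⊗[k] G.toGrMod.carrier) ⊗[k] Omega k n) :=
  koszulDiff (diagVar k n G.toGrMod.carrier) (LinearMap.lTensor (Poly k n) G.toGrMod.sign)
    (LinearMap.lTensor (Poly k n) (G.d.restrictScalars k)) (fun i => omegaLeft w i)

theorem LRequiv_dLR_tmul (s : Poly k n) (c : G.toGrMod) (f : Omega k n) :
    LRequiv G (dLR G ((s ⊗ₜ[k] c) ⊗ₜ[k] f)) =
      ∑ i, (MvPolynomial.X i * s) ⊗ₜ[k] (G.toGrMod.sign c ⊗ₜ[k] omegaLeft w i f) +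
      -(s ⊗ₜ[k] (∑ i, ((MvPolynomial.X i : Poly k n) • G.toGrMod.sign c) ⊗ₜ[k] omegaLeft w i f +
        G.d c ⊗ₜ[k] f)) :=
  assoc_koszulDiff (diagVar k n G.toGrMod.carrier)
    (fun i => LinearMap.mulLeft k (MvPolynomial.X i : Poly k n)) (actVar k G.toGrMod.carrier)
    G.toGrMod.sign (G.d.restrictScalars k) (fun i => omegaLeft w i) diagVar_tmul s c f

theorem LRequiv_dLR (x) : LRequiv G (dLR G x) = (L (R G)).d (LRequiv G x) := by
  have : (LRequiv G).toLinearMap ∘ₗ dLR G =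
      ((L (R G)).d.restrictScalars k) ∘ₗ (LRequiv G).toLinearMap := by
    apply TensorProduct.ext_threefold
    intro s c f
    refine grading_induction G.toGrMod.isInternal (P := fun c =>
      ((LRequiv G).toLinearMap ∘ₗ dLR G) ((s ⊗ₜ[k] c) ⊗ₜ[k] f) =
      (((L (R G)).d.restrictScalars k) ∘ₗ (LRequiv G).toLinearMap) ((s ⊗ₜ[k] c) ⊗ₜ[k] f))
      ?_ ?_ ?_ c
    · simp
    · intro x y hx hy
      rw [TensorProduct.tmul_add, TensorProduct.add_tmul, map_add, map_add, hx, hy]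
    · rintro ⟨a, j⟩ c hc
      have hd : (R G).d (c ⊗ₜ[k] f) = _ := dR_tmul G hc f
      change LRequiv G (dLR G ((s ⊗ₜ[k] c) ⊗ₜ[k] f)) = dPrime (R G) (s ⊗ₜ[k] (c ⊗ₜ[k] f)) +
        dInternal (R G) (s ⊗ₜ[k] (c ⊗ₜ[k] f))
      rw [LRequiv_dLR_tmul, dPrime_tmul, dInternal_tmul, hd]
      congr 1
      · exact Finset.sum_congr rfl fun i _ => by rw [R_leftVar_tmul]
      · have hsum : ∑ i, ((MvPolynomial.X i : Poly k n) • G.toGrMod.sign c) ⊗ₜ[k] omegaLeft w i f =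
            (j.negOnePow : ℤ) •
              ∑ i, ((MvPolynomial.X i : Poly k n) • c) ⊗ₜ[k] omegaLeft w i f := by
          rw [Finset.smul_sum]
          refine Finset.sum_congr rfl fun i _ => ?_
          rw [G.toGrMod.sign_of_mem hc, smul_comm (MvPolynomial.X i : Poly k n) (j.negOnePow : ℤ) c,
            TensorProduct.smul_tmul']
        rw [hsum]
  exact LinearMap.congr_fun this x

/-- The counit `L(R(G)) → G`, which sends `s ⊗ c ⊗ f` to `(-1) ^ j f(1) s c` for `c ∈ G_j`. -/
def counit : (L (R G)).toGrMod →ₗ[Poly k n] G.toGrMod :=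
  LinearMap.liftBaseChange (Poly k n) ((TensorProduct.rid k G.toGrMod.carrier).toLinearMap ∘ₗ
    TensorProduct.map G.toGrMod.sign (LinearMap.applyₗ (1 : Ext k n)))

theorem counit_tmul (s : Poly k n) (c : G.toGrMod) (f : Omega k n) :
    counit G (s ⊗ₜ[k] (c ⊗ₜ[k] f)) = s • (f 1 • G.toGrMod.sign c) := rfl

theorem counit_homogeneous :
    IsHomogeneousMap (M := (L (R G)).toGrMod) (N := G.toGrMod) (counit G) 0 := by
  intro a j m hm
  rw [add_zero]
  refine tensorGr_le (P := (G.toGrMod.gr (a, j)).comap ((counit G).restrictScalars k)) ?_ hm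
  rintro b ⟨a', j'⟩ hd s hs x hx
  obtain ⟨rfl, rfl⟩ := Prod.mk.inj hd
  refine tensorGr_le (P := (G.toGrMod.gr (b + a', j')).comap
    (((counit G).restrictScalars k) ∘ₗ TensorProduct.mk k (Poly k n) (R G) s)) ?_ hx
  rintro p q hpq c hc f hf
  change counit G (s ⊗ₜ[k] (c ⊗ₜ[k] f)) ∈ G.toGrMod.gr (b + a', j')
  rw [counit_tmul]
  -- Evaluation at 1 sees only the functionals of degree zero, so only these can contribute and no
  -- degree is lost.
  by_cases hq : q = 0
  · rw [hq, add_zero] at hpq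
    subst hpq
    exact G.toGrMod.smul_mem _ _ _ s hs _ (Submodule.smul_mem _ _ (G.toGrMod.sign_mem hc))
  · have : f 1 = 0 := by
      refine hf 0 (fun h => hq ?_) 1 (SetLike.GradedOne.one_mem (A := extGr (k := k) w))
      rw [← neg_neg q, ← h, neg_zero]
    rw [this, zero_smul, smul_zero]
    exact zero_mem _

/-- The inclusion `c ↦ (-1) ^ j 1 ⊗ c ⊗ 1^*` of `G` into `L(R(G))`. -/
def counitSection : G.toGrMod →ₗ[k] (Poly k n ⊗[k] G.toGrMod.carrier) ⊗[k] Omega k n :=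
  (TensorProduct.mk k _ (Omega k n)).flip (augmentation k n) ∘ₗ
    TensorProduct.mk k (Poly k n) G.toGrMod.carrier 1 ∘ₗ G.toGrMod.sign

theorem counitSection_apply (c : G.toGrMod) :
    counitSection G c = ((1 : Poly k n) ⊗ₜ[k] G.toGrMod.sign c) ⊗ₜ[k] augmentation k n := rfl

theorem counit_counitSection (c : G.toGrMod) : counit G (LRequiv G (counitSection G c)) = c := by
  rw [counitSection_apply, LRequiv_tmul, counit_tmul, augmentation_one, one_smul, one_smul,
    G.toGrMod.sign_sign]

/-- The functional 1^* is killed by all e_i, so only the part coming from G survives; its minus sign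
is absorbed by the anticommutation of the differential of G with the sign operator. -/
theorem dLR_counitSection (c : G.toGrMod) :
    dLR G (counitSection G c) = counitSection G (G.d c) := by
  have h := koszulDiff_tmul_of_eq_zero (diagVar k n G.toGrMod.carrier)
    (LinearMap.lTensor (Poly k n) G.toGrMod.sign)
    (LinearMap.lTensor (Poly k n) (G.d.restrictScalars k)) (fun i => omegaLeft w i)
    ((1 : Poly k n) ⊗ₜ[k] G.toGrMod.sign c) (f := augmentation k n) omegaLeft_augmentation
  refine h.trans ?_
  rw [counitSection_apply, LinearMap.lTensor_tmul, LinearMap.restrictScalars_apply, G.d_sign,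
    TensorProduct.tmul_neg, neg_neg]

/-- The first product sends s ⊗ c to 1 ⊗ sc and the second sends f to f(1) 1^*. The signs in the
counit and in its section cancel. -/
theorem map_prod_proj {l : List (Fin (n + 1))} (hl : ∀ i, i ∈ l) (x) :
    TensorProduct.map (l.map fun i => 1 - diagVar k n G.toGrMod.carrier i * divDiag k n _ i).prod
      (l.map fun i => (omegaLeft w i * omegaWedge k n i : Module.End k (Omega k n))).prod x =
      counitSection G (counit G (LRequiv G x)) := by
  induction x using TensorProduct.induction_on with
  | zero => simp
  | add x y hx hy => rw [map_add, map_add, map_add, map_add, hx, hy]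
  | tmul x f =>
    induction x using TensorProduct.induction_on with
    | zero => simp
    | add x y hx hy => rw [TensorProduct.add_tmul, map_add, map_add, map_add, map_add, hx, hy]
    | tmul s c =>
      rw [TensorProduct.map_tmul, prod_proj_tmul hl, prod_omega_apply w hl, LRequiv_tmul,
        counit_tmul, counitSection_apply, G.toGrMod.sign_smul, map_smul, G.toGrMod.sign_sign,
        smul_comm s, ← TensorProduct.smul_tmul (f 1), ← TensorProduct.tmul_smul (f 1)]

theorem dLR_dLR (x) : dLR G (dLR G x) = 0 := by
  apply (LRequiv G).injective
  rw [LRequiv_dLR, LRequiv_dLR, (L (R G)).isDifferential.sq, map_zero]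

/-- The n + 1 Koszul homotopies show that every cycle is homologous to the copy of its image under
the counit, which gives injectivity of the counit on homology. -/
theorem exists_dLR_eq {x} (hx : dLR G x = 0) :
    ∃ z, x = dLR G z + counitSection G (counit G (LRequiv G x)) := by
  obtain ⟨z, hz⟩ := koszulDiff_homologous (diagVar k n G.toGrMod.carrier)
    (divDiag k n G.toGrMod.carrier) (LinearMap.lTensor (Poly k n) G.toGrMod.sign)
    (LinearMap.lTensor (Poly k n) (G.d.restrictScalars k)) (fun i => omegaLeft w i)
    (omegaWedge k n) divDiag_mul_diagVar
    (fun i j => divDiag_mul_diagVar_of_ne)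
    (TensorProduct.ext' fun s c => by
      rw [Module.End.mul_apply, LinearMap.lTensor_tmul, LinearMap.lTensor_tmul,
        G.toGrMod.sign_sign, Module.End.one_apply])
    (fun i => diagVar_mul_lTensor i _ G.toGrMod.sign_smul)
    (fun i => divDiag_mul_lTensor i _ G.toGrMod.sign_smul)
    (fun i => divDiag_mul_lTensor i _ (fun p c => map_smul G.d p c))
    (TensorProduct.ext' fun s c => by
      rw [Module.End.mul_apply, LinearMap.neg_apply, Module.End.mul_apply]
      simp only [LinearMap.lTensor_tmul, LinearMap.restrictScalars_apply, G.d_sign,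
        TensorProduct.tmul_neg])
    (fun i j => LinearMap.ext fun f => by
      rw [LinearMap.add_apply, Module.End.mul_apply, Module.End.mul_apply, omegaLeft_omegaWedge]
      split_ifs <;> rfl)
    (dLR_dLR G) (List.finRange (n + 1)) hx
  rw [map_prod_proj G List.mem_finRange] at hz
  exact ⟨z, hz⟩

/-- The counit does not distinguish x_i s ⊗ c from s ⊗ x_i c, so the two Koszul sums cancel; what
remains is the differential of G, with signs matched by `Cpx.d_sign`. -/
theorem counit_comm (x : (L (R G)).toGrMod) : counit G ((L (R G)).d x) = G.d (counit G x) := by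
  obtain ⟨x, rfl⟩ := (LRequiv G).surjective x
  have h1 := congrArg (counit G) (LRequiv_dLR G x)
  rw [← h1]
  refine LinearMap.congr_fun (f := (counit G).restrictScalars k ∘ₗ (LRequiv G).toLinearMap ∘ₗ dLR G)
    (g := G.d.restrictScalars k ∘ₗ (counit G).restrictScalars k ∘ₗ (LRequiv G).toLinearMap)
    (TensorProduct.ext_threefold fun s c f => ?_) x
  change counit G (LRequiv G (dLR G ((s ⊗ₜ[k] c) ⊗ₜ[k] f))) =
    G.d (counit G (LRequiv G ((s ⊗ₜ[k] c) ⊗ₜ[k] f)))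
  rw [LRequiv_dLR_tmul, TensorProduct.tmul_add, TensorProduct.tmul_sum, neg_add, ← add_assoc,
    map_add, map_add, map_neg, map_neg, map_sum, map_sum, LRequiv_tmul]
  have h2 : ∀ i, counit G ((MvPolynomial.X i * s) ⊗ₜ[k] (G.toGrMod.sign c ⊗ₜ[k] omegaLeft w i f)) =
      counit G (s ⊗ₜ[k] (((MvPolynomial.X i : Poly k n) • G.toGrMod.sign c) ⊗ₜ[k]
        omegaLeft w i f)) := by
    intro i
    rw [counit_tmul, counit_tmul, G.toGrMod.sign_smul, mul_comm, mul_smul]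
    congr 1
    exact smul_comm _ _ _
  rw [Finset.sum_congr rfl fun i _ => h2 i, add_neg_cancel, zero_add, counit_tmul, counit_tmul,
    map_smul, LinearMap.map_smul_of_tower, G.d_sign, smul_neg, smul_neg]

/-- The counit `L(R(G)) → G` is a quasi-isomorphism. -/
theorem counit_isQuasiIso : IsQuasiIso (C := L (R G)) (C' := G) (counit G) where
  homogeneous := counit_homogeneous G
  comm := counit_comm G
  injective := by
    rintro x hx ⟨g, hg⟩
    obtain ⟨x, rfl⟩ := (LRequiv G).surjective x
    rw [← LRequiv_dLR, LinearEquiv.map_eq_zero_iff] at hx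
    obtain ⟨z, hz⟩ := exists_dLR_eq G hx
    -- If the counit sends x to the boundary of g, then x is the boundary of z plus the section of
    -- that boundary, and the section is a chain map.
    refine ⟨LRequiv G (z + counitSection G g), ?_⟩
    rw [← LRequiv_dLR, map_add, dLR_counitSection, hg, ← hz]
  surjective := by
    intro g hg
    refine ⟨LRequiv G (counitSection G g), ?_, 0, ?_⟩
    · rw [← LRequiv_dLR, dLR_counitSection, hg, map_zero, map_zero]
    · rw [counit_counitSection, sub_self, map_zero]

end Counit

/-! ### Homogeneous bases extended from k -/

section HomogeneousBases

variable {k : Type uk} [Field k] {n : ℕ} {A : Type uA} [AddCommGroup A] [DecidableEq A]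
variable {w : Fin (n + 1) → A}

theorem exists_basis_of_isInternal {ι : Type*} [DecidableEq ι] {M : Type u} [AddCommGroup M]
    [Module k M] {gr : ι → Submodule k M} (h : DirectSum.IsInternal gr) :
    ∃ (I : Type u) (b : Module.Basis I k M), ∀ i, ∃ d, b i ∈ gr d := by
  have h1 : ∀ d, ∃ I : Type u, Nonempty (Module.Basis I k (gr d)) :=
    fun d => ⟨_, ⟨Module.Basis.ofVectorSpace k (gr d)⟩⟩
  choose α hα using h1
  let b := h.collectedBasis fun d => (hα d).some
  have hb : ∀ x, ∃ d, b x ∈ gr d := fun x => ⟨x.1, h.collectedBasis_mem _ x⟩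
  -- The collected basis is indexed by pairs that involve the grading group; reindexing by its range
  -- brings the index type into the universe of M.
  refine ⟨Set.range b, b.reindexRange, fun i => ?_⟩
  obtain ⟨x, hx⟩ := i.2
  rw [Module.Basis.reindexRange_apply, ← hx]
  exact hb x

theorem DiffMod.exists_homogeneous_basis (D : DiffMod.{u} k w) :
    ∃ (I : Type u) (b : Module.Basis I k D), ∀ i, ∃ d, b i ∈ D.gr d :=
  exists_basis_of_isInternal D.isInternal

theorem one_tmul_mem (D : DiffMod.{u} k w) {d : A × ℤ} {m : D} (hm : m ∈ D.gr d) :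
    (1 : Poly k n) ⊗ₜ[k] m ∈ (LMod D).gr d :=
  tmul_mem_tensorGr _ (MvPolynomial.isWeightedHomogeneous_one k w) hm (by simp)

theorem isHomogeneousBasis_baseChange {D : DiffMod.{u} k w} {I : Type*} {b : Module.Basis I k D}
    (hb : ∀ i, ∃ d, b i ∈ D.gr d) :
    IsHomogeneousBasis (M := LMod D) (b.baseChange (Poly k n)) := by
  intro i
  obtain ⟨d, hd⟩ := hb i
  refine ⟨d, ?_⟩
  rw [Module.Basis.baseChange_apply]
  exact one_tmul_mem D hd

theorem LMod_isGradedFree (D : DiffMod.{max uk u} k w) : (LMod D).IsGradedFree := by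
  obtain ⟨I, b, hb⟩ := D.exists_homogeneous_basis
  exact ⟨I, b.baseChange (Poly k n), isHomogeneousBasis_baseChange hb⟩

/-- A composition of `dPrime` with maps extended from `k` has linear entries with respect to bases
extended from `k`. -/
theorem hasLinearEntries_baseChange {D D₁ D₂ : DiffMod.{max uk u} k w} {I J : Type (max uk u)}
    (b : Module.Basis I k D₁) (b' : Module.Basis J k D₂) (f : D →ₗ[k] D₂) (g : D₁ →ₗ[k] D) :
    HasLinearEntries (P := LMod D₁) (Q := LMod D₂) (b.baseChange (Poly k n))
      (b'.baseChange (Poly k n))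
      (f.baseChange (Poly k n) ∘ₗ dPrime D ∘ₗ g.baseChange (Poly k n)) := by
  intro i j
  have : (f.baseChange (Poly k n) ∘ₗ dPrime D ∘ₗ g.baseChange (Poly k n))
      (b.baseChange (Poly k n) i) =
      ∑ s, (MvPolynomial.X s : Poly k n) ⊗ₜ[k] f (D.leftVar s (g (b i))) := by
    simp only [LinearMap.comp_apply, Module.Basis.baseChange_apply, LinearMap.baseChange_tmul,
      dPrime_tmul, map_sum, mul_one]
  rw [this, map_sum, Finsupp.finsetSum_apply]
  refine Submodule.sum_mem _ fun s _ => ?_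
  rw [Module.Basis.baseChange_repr_tmul]
  exact Submodule.smul_mem _ _ (Submodule.subset_span ⟨s, rfl⟩)

theorem dPrime_isStronglyLinear (D : DiffMod.{max uk u} k w) :
    IsStronglyLinear (P := LMod D) (Q := LMod D) (dPrime D) := by
  obtain ⟨I, b, hb⟩ := D.exists_homogeneous_basis
  refine ⟨⟨-1, dPrime_homogeneous D⟩, I, I, b.baseChange (Poly k n), b.baseChange (Poly k n),
    isHomogeneousBasis_baseChange hb, isHomogeneousBasis_baseChange hb, ?_⟩
  have := hasLinearEntries_baseChange b b (LinearMap.id : D →ₗ[k] D) LinearMap.id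
  rwa [LinearMap.baseChange_id, LinearMap.id_comp, LinearMap.comp_id] at this

theorem IsHomogeneousMap.comp {M N P : GrMod.{u} k w} {f : M →ₗ[Poly k n] N}
    {g : N →ₗ[Poly k n] P} {r s : ℤ} (hg : IsHomogeneousMap g s) (hf : IsHomogeneousMap f r) :
    IsHomogeneousMap (g ∘ₗ f) (r + s) := by
  intro a j m hm
  rw [← add_assoc]
  exact hg _ _ _ (hf a j m hm)

theorem IsHomogeneousMap.zsmul {M N : GrMod.{u} k w} {f : M →ₗ[Poly k n] N} {r : ℤ}
    (hf : IsHomogeneousMap f r) (z : ℤ) : IsHomogeneousMap (z • f) r :=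
  fun a j m hm => zsmul_mem (hf a j m hm) z

end HomogeneousBases

/-! ### Absorbing homogeneous maps into strongly linear ones -/

section Sums

variable {k : Type uk} [Field k] {n : ℕ} {A : Type uA} [AddCommGroup A] [DecidableEq A]
variable {w : Fin (n + 1) → A}

/-- The graded module `P ⊕ Q[r]`. -/
abbrev prodGr (P Q : GrMod.{u} k w) (r : ℤ) : GrMod.{u} k w where
  carrier := P × Q
  gr d := (P.gr d).prod (Q.gr (d.1, d.2 + r))
  isInternal := by
    refine isInternal_of_proj (fun d => (component P.isInternal d).prodMap
      (component Q.isInternal (d.1, d.2 + r))) ?_ ?_ ?_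
    · rintro d ⟨x, y⟩ ⟨hx, hy⟩
      exact Prod.ext (component_of_mem _ hx) (component_of_mem _ hy)
    · rintro ⟨a, j⟩ ⟨a', j'⟩ hd ⟨x, y⟩ ⟨hx, hy⟩
      refine Prod.ext (component_of_mem_ne _ hd hx) (component_of_mem_ne _ ?_ hy)
      simpa using hd
    · rintro ⟨x, y⟩
      have h1 : ∀ x : P, ((x, 0) : P × Q) ∈ ⨆ d : A × ℤ, (P.gr d).prod (Q.gr (d.1, d.2 + r)) := by
        intro x
        refine grading_induction P.isInternal (P := fun x => ((x, 0) : P × Q) ∈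
          ⨆ d : A × ℤ, (P.gr d).prod (Q.gr (d.1, d.2 + r))) (zero_mem _) ?_ ?_ x
        · intro x y hx hy
          simpa using add_mem hx hy
        · intro d m hm
          exact Submodule.mem_iSup_of_mem d ⟨hm, zero_mem _⟩
      have h2 : ∀ y : Q, ((0, y) : P × Q) ∈ ⨆ d : A × ℤ, (P.gr d).prod (Q.gr (d.1, d.2 + r)) := by
        intro y
        refine grading_induction Q.isInternal (P := fun y => ((0, y) : P × Q) ∈
          ⨆ d : A × ℤ, (P.gr d).prod (Q.gr (d.1, d.2 + r))) (zero_mem _) ?_ ?_ y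
        · intro x y hx hy
          simpa using add_mem hx hy
        · rintro ⟨a, j⟩ m hm
          refine Submodule.mem_iSup_of_mem (a, j - r) ⟨zero_mem _, ?_⟩
          simpa using hm
      simpa using add_mem (h1 x) (h2 y)
  smul_mem := by
    rintro b a j p hp ⟨x, y⟩ ⟨hx, hy⟩
    exact ⟨P.smul_mem b a j p hp x hx, Q.smul_mem b a (j + r) p hp y hy⟩

/-- The graded module `⨁_i P(sh i)`. -/
abbrev powGr (P : GrMod.{u} k w) (sh : Fin (n + 1) → A) : GrMod.{u} k w where
  carrier := Fin (n + 1) → P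
  gr d := Submodule.pi Set.univ fun i => P.gr (d.1 + sh i, d.2)
  isInternal := by
    refine isInternal_of_proj (fun d => LinearMap.pi fun i =>
      component P.isInternal (d.1 + sh i, d.2) ∘ₗ LinearMap.proj i) ?_ ?_ ?_
    · intro d x hx
      exact funext fun i => component_of_mem _ (hx i trivial)
    · rintro ⟨a, j⟩ ⟨a', j'⟩ hd x hx
      refine funext fun i => component_of_mem_ne _ ?_ (hx i trivial)
      simpa using hd
    · intro x
      rw [← Finset.univ_sum_single x]
      refine Submodule.sum_mem _ fun i _ => ?_
      refine grading_induction P.isInternal (P := fun y => (Pi.single i y : Fin (n + 1) → P) ∈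
        ⨆ d : A × ℤ, Submodule.pi Set.univ fun i => P.gr (d.1 + sh i, d.2)) ?_ ?_ ?_ (x i)
      · rw [Pi.single_zero]
        exact zero_mem _
      · intro y z hy hz
        rw [Pi.single_add]
        exact add_mem hy hz
      · rintro ⟨a, j⟩ m hm
        refine Submodule.mem_iSup_of_mem (a - sh i, j) fun l _ => ?_
        by_cases hl : l = i
        · subst hl
          simpa using hm
        · rw [Pi.single_eq_of_ne hl]
          exact zero_mem _
  smul_mem := by
    intro b a j p hp x hx i _
    have := P.smul_mem b (a + sh i) j p hp _ (hx i trivial)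
    rwa [← add_assoc] at this

theorem X_mul_mem_span (s : Fin (n + 1)) (c : Prop) [Decidable c] :
    (MvPolynomial.X s * (if c then 1 else 0) : Poly k n) ∈
      Submodule.span k (Set.range (MvPolynomial.X : Fin (n + 1) → Poly k n)) := by
  split_ifs
  · rw [mul_one]
    exact Submodule.subset_span ⟨s, rfl⟩
  · rw [mul_zero]
    exact zero_mem _

theorem isHomogeneousBasis_pi {P : GrMod.{u} k w} {I : Type u} {b : Module.Basis I (Poly k n) P}
    (hb : IsHomogeneousBasis b) (sh : Fin (n + 1) → A) :
    IsHomogeneousBasis (M := powGr P sh) (Pi.basis fun _ : Fin (n + 1) => b) := by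
  rintro ⟨s, i⟩
  obtain ⟨⟨a, j⟩, hd⟩ := hb i
  refine ⟨(a - sh s, j), fun l _ => ?_⟩
  rw [Pi.basis_apply]
  by_cases hl : l = s
  · subst hl
    simpa using hd
  · rw [Pi.single_eq_of_ne hl]
    exact zero_mem _

theorem powGr_isGradedFree {P : GrMod.{u} k w} (hP : P.IsGradedFree) (sh : Fin (n + 1) → A) :
    (powGr P sh).IsGradedFree := by
  obtain ⟨I, b, hb⟩ := hP
  exact ⟨Σ _ : Fin (n + 1), I, Pi.basis fun _ => b, isHomogeneousBasis_pi hb sh⟩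

/-- The map `y ↦ (x_s y)_s`. -/
def mulVars (P : GrMod.{u} k w) : P →ₗ[Poly k n] powGr P w :=
  LinearMap.pi fun s => (MvPolynomial.X s : Poly k n) • LinearMap.id

/-- Every homogeneous basis of P works, since the matrix entries are variables or zero. This
isolates the linear factor of ∂'ι without any control over the entries of ι; `sumVars` does the same
for π∂'. -/
theorem mulVars_isStronglyLinear {P : GrMod.{u} k w} (hP : P.IsGradedFree) :
    IsStronglyLinear (mulVars P) := by
  classical
  obtain ⟨I, b, hb⟩ := hP
  refine ⟨⟨0, fun a j m hm s _ => ?_⟩, I, Σ _ : Fin (n + 1), I, b, Pi.basis fun _ => b, hb,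
    isHomogeneousBasis_pi hb w, ?_⟩
  · have := P.X_smul_mem s hm
    rw [add_comm] at this
    rw [add_zero]
    exact this
  · rintro i ⟨s, l⟩
    have : (Pi.basis fun _ : Fin (n + 1) => b).repr (mulVars P (b i)) ⟨s, l⟩ =
        MvPolynomial.X s * (if i = l then 1 else 0) := by
      rw [Pi.basis_repr]
      change b.repr ((MvPolynomial.X s : Poly k n) • b i) l = _
      rw [map_smul, Module.Basis.repr_self, Finsupp.smul_apply, Finsupp.single_apply, smul_eq_mul]
    exact this ▸ X_mul_mem_span s (i = l)

/-- The map `(y_s)_s ↦ ∑ x_s y_s`. -/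
def sumVars (P : GrMod.{u} k w) : powGr P (-w) →ₗ[Poly k n] P :=
  ∑ s, (MvPolynomial.X s : Poly k n) • LinearMap.proj s

theorem sumVars_apply (P : GrMod.{u} k w) (y : Fin (n + 1) → P) :
    sumVars P y = ∑ s, (MvPolynomial.X s : Poly k n) • y s := by
  simp [sumVars, LinearMap.sum_apply]

theorem sumVars_isStronglyLinear {P : GrMod.{u} k w} (hP : P.IsGradedFree) :
    IsStronglyLinear (sumVars P) := by
  classical
  obtain ⟨I, b, hb⟩ := hP
  refine ⟨⟨0, fun a j m hm => ?_⟩, Σ _ : Fin (n + 1), I, I, Pi.basis fun _ => b, b,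
    isHomogeneousBasis_pi hb _, hb, ?_⟩
  · rw [sumVars_apply, add_zero]
    refine Submodule.sum_mem _ fun s _ => ?_
    have := P.X_smul_mem s (hm s trivial)
    simpa using this
  · rintro ⟨s, i⟩ l
    have : b.repr (sumVars P ((Pi.basis fun _ : Fin (n + 1) => b) ⟨s, i⟩)) l =
        MvPolynomial.X s * (if i = l then 1 else 0) := by
      rw [sumVars_apply, Pi.basis_apply, Finset.sum_eq_single s]
      · rw [Pi.single_eq_same, map_smul, Module.Basis.repr_self, Finsupp.smul_apply,
          Finsupp.single_apply, smul_eq_mul]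
      · intro s' _ hs'
        rw [Pi.single_eq_of_ne hs', smul_zero]
      · simp
    exact this ▸ X_mul_mem_span s (i = l)

theorem isStronglyLinear_inl {P Q : GrMod.{u} k w} {f : P →ₗ[Poly k n] Q}
    (hf : IsStronglyLinear f) {Q' : GrMod.{u} k w} (hQ' : Q'.IsGradedFree) (r : ℤ) :
    IsStronglyLinear (P := P) (Q := prodGr Q Q' r) (LinearMap.inl (Poly k n) Q Q' ∘ₗ f) := by
  obtain ⟨⟨t, ht⟩, I, J, b, b', hb, hb', hbb⟩ := hf
  obtain ⟨K, c, hc⟩ := hQ'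
  refine ⟨⟨t, fun a j m hm => ⟨ht a j m hm, zero_mem _⟩⟩, I, J ⊕ K, b, b'.prod c, hb, ?_, ?_⟩
  · rintro (l | l)
    · obtain ⟨d, hd⟩ := hb' l
      refine ⟨d, ?_⟩
      rw [Module.Basis.prod_apply]
      exact ⟨hd, zero_mem _⟩
    · obtain ⟨⟨a, j⟩, hd⟩ := hc l
      refine ⟨(a, j - r), ?_⟩
      rw [Module.Basis.prod_apply]
      refine ⟨zero_mem _, ?_⟩
      simpa using hd
  · rintro i (l | l)
    · rw [Module.Basis.prod_repr_inl]
      exact hbb i l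
    · rw [Module.Basis.prod_repr_inr]
      simp

/-- Apply the automorphism (x, y) ↦ (x, y - Cx) of Q ⊕ Q' to the product basis. On the images of the
vectors (x, 0) the map (x, y) ↦ g(Cx + y) vanishes, and on those of (0, y) it equals g, so the
entries of C disappear from the matrix. The shift by r makes the new basis homogeneous. -/
theorem isStronglyLinear_twist {Q Q' T : GrMod.{u} k w} (hQ : Q.IsGradedFree)
    {C : Q →ₗ[Poly k n] Q'} {r : ℤ} (hC : IsHomogeneousMap C r) {g : Q' →ₗ[Poly k n] T}
    (hg : IsStronglyLinear g) :
    IsStronglyLinear (P := prodGr Q Q' r) (Q := T) (g ∘ₗ LinearMap.coprod C LinearMap.id) := by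
  obtain ⟨⟨t, ht⟩, J, K, b', c, hb', hc, hbc⟩ := hg
  obtain ⟨I, b, hb⟩ := hQ
  let U : (Q × Q') ≃ₗ[Poly k n] Q × Q' :=
    LinearEquiv.skewProd (LinearEquiv.refl _ _) (LinearEquiv.refl _ _) (-C)
  refine ⟨⟨r + t, fun a j m hm => ?_⟩, I ⊕ J, K, (b.prod b').map U, c, ?_, hc, ?_⟩
  · rw [← add_assoc]
    refine ht a (j + r) _ ?_
    rw [LinearMap.coprod_apply]
    exact add_mem (hC a j _ hm.1) hm.2
  · rintro (l | l)
    · obtain ⟨⟨a, j⟩, hd⟩ := hb l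
      refine ⟨(a, j), ?_⟩
      rw [Module.Basis.map_apply, Module.Basis.prod_apply]
      refine ⟨by simpa [U] using hd, ?_⟩
      simpa [U] using hC a j _ hd
    · obtain ⟨⟨a, j⟩, hd⟩ := hb' l
      refine ⟨(a, j - r), ?_⟩
      rw [Module.Basis.map_apply, Module.Basis.prod_apply]
      refine ⟨by simp [U], ?_⟩
      simpa [U] using hd
  · rintro (l | l) m
    · have : (g ∘ₗ LinearMap.coprod C LinearMap.id) ((b.prod b').map U (Sum.inl l)) = 0 := by
        rw [Module.Basis.map_apply, Module.Basis.prod_apply]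
        simp [U]
      rw [this, map_zero]
      exact zero_mem _
    · have : (g ∘ₗ LinearMap.coprod C LinearMap.id) ((b.prod b').map U (Sum.inr l)) =
          g (b' l) := by
        rw [Module.Basis.map_apply, Module.Basis.prod_apply]
        simp [U]
      rw [this]
      exact hbc l m

theorem IsStronglyLinear.target_free {P Q : GrMod.{u} k w} {f : P →ₗ[Poly k n] Q}
    (hf : IsStronglyLinear f) : P.IsGradedFree ∧ Q.IsGradedFree := by
  obtain ⟨-, I, J, b, b', hb, hb', -⟩ := hf
  exact ⟨⟨I, b, hb⟩, J, b', hb'⟩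

/-- Between two strongly linear maps, an arbitrary homogeneous map can be absorbed into the choice
of the bases, after enlarging the module in the middle. -/
theorem IsStronglyLinearComp.comp_comp {i : ℕ} {P Q Q' T : GrMod.{u} k w}
    {f : P →ₗ[Poly k n] Q} (hf : IsStronglyLinearComp i f) (hQ : Q.IsGradedFree)
    {C : Q →ₗ[Poly k n] Q'} {r : ℤ} (hC : IsHomogeneousMap C r) {g : Q' →ₗ[Poly k n] T}
    (hg : IsStronglyLinear g) : IsStronglyLinearComp (i + 1) (g ∘ₗ C ∘ₗ f) := by
  -- Only the last factor of f changes. Its target basis and the source basis of the next map may be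
  -- different bases of Q ⊕ Q', which is what makes the absorption possible.
  have h1 : IsStronglyLinearComp i (P := P) (Q := prodGr Q Q' r)
      (LinearMap.inl (Poly k n) Q Q' ∘ₗ f) := by
    cases hf with
    | single f hf => exact .single _ (isStronglyLinear_inl hf hg.target_free.1 r)
    | comp f₁ f₂ h₁ h₂ => exact .comp f₁ _ h₁ (isStronglyLinear_inl h₂ hg.target_free.1 r)
  have h2 := IsStronglyLinearComp.comp _ _ h1 (isStronglyLinear_twist hQ hC hg)
  have h3 : (g ∘ₗ LinearMap.coprod C LinearMap.id) ∘ₗ LinearMap.inl (Poly k n) Q Q' ∘ₗ f =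
      g ∘ₗ C ∘ₗ f := by
    ext x
    simp
  exact h3 ▸ h2

end Sums

/-! ### The δ_i as compositions of linear maps -/

section Deltas

variable {k : Type uk} [Field k] {n : ℕ} {A : Type uA} [AddCommGroup A] [DecidableEq A]
variable {w : Fin (n + 1) → A} {D : DiffMod.{max uk u} k w}

theorem baseChange_leftVar_mem (D : DiffMod.{u} k w) (s : Fin (n + 1)) {a : A} {j : ℤ} {x : LMod D}
    (hx : x ∈ (LMod D).gr (a, j)) :
    (D.leftVar s).baseChange (Poly k n) x ∈ (LMod D).gr (a - w s, j - 1) := by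
  refine tensorGr_le (P := ((LMod D).gr (a - w s, j - 1)).comap
    (((D.leftVar s).baseChange (Poly k n)).restrictScalars k)) ?_ hx
  rintro b ⟨a', j'⟩ hd p hp y hy
  obtain ⟨rfl, rfl⟩ := Prod.mk.inj hd
  change (D.leftVar s).baseChange (Poly k n) (p ⊗ₜ[k] y) ∈ (LMod D).gr (b + a' - w s, j' - 1)
  rw [LinearMap.baseChange_tmul]
  exact tmul_mem_tensorGr _ hp (D.leftVar_mem s hy) (by simp [add_sub_assoc])

theorem dPrime_apply (D : DiffMod.{u} k w) (x : LMod D) : dPrime D x =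
    ∑ s, (MvPolynomial.X s : Poly k n) • (D.leftVar s).baseChange (Poly k n) x := by
  simp [dPrime, LinearMap.sum_apply]

/-- The maps `h (dPrime h) ^ m dPrime ι` factor through an `(m + 1)`-fold composition of strongly
linear maps. -/
theorem Contraction.exists_factorization (c : Contraction (Lbar D) (Lbar (H D))) (m : ℕ) :
    ∃ (Q : GrMod.{max uk u} k w) (g : LMod (H D) →ₗ[Poly k n] Q) (C : Q →ₗ[Poly k n] LMod D)
      (r : ℤ), Q.IsGradedFree ∧ IsStronglyLinearComp (m + 1) g ∧ IsHomogeneousMap C r ∧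
      C ∘ₗ g = c.h ∘ₗ ((dPrime D ∘ₗ c.h) ^ m : Module.End (Poly k n) (LMod D)) ∘ₗ
        dPrime D ∘ₗ c.ι := by
  induction m with
  | zero =>
    -- By S-linearity ∂'ι(y) = ∑ e_s ι(x_s y), which factors through y ↦ (x_s y)_s.
    refine ⟨powGr (LMod (H D)) w, mulVars _, c.h ∘ₗ ∑ s, (D.leftVar s).baseChange (Poly k n) ∘ₗ
      c.ι ∘ₗ LinearMap.proj s, 0, powGr_isGradedFree (LMod_isGradedFree _) w,
      .single _ (mulVars_isStronglyLinear (LMod_isGradedFree _)), ?_, ?_⟩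
    · intro a j y hy
      have h1 : (∑ s, (D.leftVar s).baseChange (Poly k n) ∘ₗ c.ι ∘ₗ
          (LinearMap.proj s : (Fin (n + 1) → LMod (H D)) →ₗ[Poly k n] LMod (H D))) y ∈
          (LMod D).gr (a, j - 1) := by
        rw [LinearMap.sum_apply]
        refine Submodule.sum_mem _ fun s _ => ?_
        have := baseChange_leftVar_mem D s (c.ι_homogeneous _ _ _ (hy s trivial))
        simpa using this
      have h2 := c.h_homogeneous _ _ _ h1
      rw [sub_add_cancel] at h2
      rw [add_zero]
      exact h2
    · refine LinearMap.ext fun y => ?_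
      simp only [LinearMap.comp_apply, LinearMap.sum_apply, pow_zero, Module.End.one_apply,
        LinearMap.proj_apply]
      rw [dPrime_apply]
      congr 1
      refine Finset.sum_congr rfl fun s _ => ?_
      change (D.leftVar s).baseChange (Poly k n) (c.ι ((MvPolynomial.X s : Poly k n) • y)) = _
      rw [map_smul, map_smul]
  | succ m ih =>
    obtain ⟨Q, g, C, r, hQ, hg, hC, hCg⟩ := ih
    -- The new ∂' is a further strongly linear factor, the old homogeneous map C is absorbed between
    -- g and ∂', and the outer h becomes the new homogeneous map.
    refine ⟨LMod D, dPrime D ∘ₗ C ∘ₗ g, c.h, 1, LMod_isGradedFree D,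
      hg.comp_comp hQ hC (dPrime_isStronglyLinear D), c.h_homogeneous, ?_⟩
    rw [hCg, pow_succ']
    rfl

/-- For i = m + 2, the m + 1 factors of `exists_factorization` are followed by a last one from π∂' =
`sumVars` composed with a homogeneous map B; B, the preceding homogeneous map and the sign are
absorbed together. For i = 1 the differential of L(H(D)) is linear in any basis extended from k. -/
theorem Contraction.delta_isStronglyLinearComp (c : Contraction (Lbar D) (Lbar (H D)))
    (hc : c.IsCanonical) (i : ℕ) (hi : 1 ≤ i) :
    IsStronglyLinearComp (P := LMod (H D)) (Q := LMod (H D)) i (c.delta i) := by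
  obtain _ | _ | m := i
  · omega
  · rw [zero_add, c.delta_one hc]
    exact .single _ (dPrime_isStronglyLinear (H D))
  · obtain ⟨Q, g, C, r, hQ, hg, hC, hCg⟩ := c.exists_factorization m
    let B : LMod D →ₗ[Poly k n] powGr (LMod (H D)) (-w) :=
      LinearMap.pi fun s => c.π ∘ₗ (D.leftVar s).baseChange (Poly k n)
    have hB : IsHomogeneousMap B (-1) := by
      intro a j x hx s _
      have := c.π_homogeneous _ _ _ (baseChange_leftVar_mem D s hx)
      rw [add_zero, sub_eq_add_neg, sub_eq_add_neg] at this
      exact this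
    have h1 := hg.comp_comp hQ ((hB.comp hC).zsmul ((-1) ^ (m + 1)))
      (sumVars_isStronglyLinear (LMod_isGradedFree (H D)))
    have h2 : sumVars (LMod (H D)) ∘ₗ ((-1 : ℤ) ^ (m + 1) • (B ∘ₗ C)) ∘ₗ g = c.delta (m + 2) := by
      have hS : sumVars (LMod (H D)) ∘ₗ B = c.π ∘ₗ dPrime D := by
        refine LinearMap.ext fun x => ?_
        rw [LinearMap.comp_apply, sumVars_apply, LinearMap.comp_apply, dPrime_apply, map_sum]
        refine Finset.sum_congr rfl fun s _ => ?_
        rw [map_smul]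
        rfl
      refine LinearMap.ext fun y => ?_
      have h3 := LinearMap.congr_fun hS (C (g y))
      have h4 := LinearMap.congr_fun hCg y
      simp only [LinearMap.comp_apply] at h3 h4
      change sumVars (LMod (H D)) ((-1 : ℤ) ^ (m + 1) • B (C (g y))) = (-1 : ℤ) ^ (m + 1) •
        c.π (((dPrime D ∘ₗ c.h) ^ (m + 1) : Module.End (Poly k n) (LMod D)) (dPrime D (c.ι y)))
      rw [map_zsmul, h3, h4, pow_succ' (dPrime D ∘ₗ c.h)]
      rfl
    exact h2 ▸ h1

/-- If the contraction is extended from `k`, then `δ_i` is a composition of `i` maps with linear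
entries with respect to bases extended from `k`. -/
theorem Contraction.delta_isLinearChain (c : Contraction (Lbar D) (Lbar (H D)))
    (hc : c.IsExtended) : ∃ (I : Type (max uk u)) (b : Module.Basis I (Poly k n) (LMod (H D))),
      ∀ i, 1 ≤ i → IsLinearChain (P := LMod (H D)) (Q := LMod (H D)) i b b (c.delta i) := by
  obtain ⟨π₀, ι₀, h₀, hπ, hι, hh⟩ := hc
  obtain ⟨I, b, hb⟩ := (H D).exists_homogeneous_basis
  obtain ⟨J, b', hb'⟩ := D.exists_homogeneous_basis
  have hB := isHomogeneousBasis_baseChange hb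
  have hB' := isHomogeneousBasis_baseChange hb'
  have hι' : IsHomogeneousMap (M := LMod (H D)) (N := LMod D) (dPrime D ∘ₗ c.ι) (0 + -1) :=
    IsHomogeneousMap.comp (dPrime_homogeneous D) c.ι_homogeneous
  have hh' : IsHomogeneousMap (M := LMod D) (N := LMod D) (dPrime D ∘ₗ c.h) (1 + -1) :=
    IsHomogeneousMap.comp (dPrime_homogeneous D) c.h_homogeneous
  -- Here π, ι, h have scalar entries, so each of ∂'ι, ∂'h and π∂'h is linear in bases extended from
  -- k, and the bases of D and H(D) can be fixed once for all i.
  have hchain : ∀ m : ℕ, IsLinearChain (P := LMod (H D)) (Q := LMod D) (m + 1)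
      (b.baseChange (Poly k n)) (b'.baseChange (Poly k n))
      (((dPrime D ∘ₗ c.h) ^ m : Module.End (Poly k n) (LMod D)) ∘ₗ dPrime D ∘ₗ c.ι) := by
    intro m
    induction m with
    | zero =>
      refine .single _ _ _ hB hB' ⟨_, hι'⟩ ?_
      have := hasLinearEntries_baseChange b b' (LinearMap.id : D →ₗ[k] D) ι₀
      rwa [LinearMap.baseChange_id, LinearMap.id_comp, ← hι] at this
    | succ m ih =>
      have h1 := hasLinearEntries_baseChange b' b' (LinearMap.id : D →ₗ[k] D) h₀
      rw [LinearMap.baseChange_id, LinearMap.id_comp, ← hh] at h1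
      have h2 := IsLinearChain.comp _ _ _ _ _ ih hB' ⟨_, hh'⟩ h1
      rw [pow_succ']
      exact h2
  refine ⟨I, b.baseChange (Poly k n), fun i hi => ?_⟩
  obtain _ | _ | m := i
  · omega
  · refine .single _ _ _ hB hB ⟨0 + -1 + 0, ?_⟩ ?_
    · exact (IsHomogeneousMap.comp c.π_homogeneous hι').zsmul _
    · have := hasLinearEntries_baseChange b b π₀ ι₀
      rw [← hι, ← hπ] at this
      have h2 : c.delta (0 + 1) = c.π ∘ₗ dPrime D ∘ₗ c.ι := by
        refine LinearMap.ext fun x => ?_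
        change (-1 : ℤ) ^ 0 • c.π (dPrime D (c.ι x)) = c.π (dPrime D (c.ι x))
        rw [pow_zero, one_smul]
      rw [h2]
      exact this
  · have h1 := hasLinearEntries_baseChange b' b ((-1 : ℤ) ^ (m + 1) • π₀) h₀
    have h3 : ((-1 : ℤ) ^ (m + 1) • π₀).baseChange (Poly k n) =
        (-1 : ℤ) ^ (m + 1) • π₀.baseChange (Poly k n) :=
      map_zsmul (LinearMap.baseChangeHom k (Poly k n) D (H D)) _ _
    rw [h3, ← hh, ← hπ] at h1
    have h2 := IsLinearChain.comp _ _ _ _ _ (hchain m) hB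
      ⟨_, ((IsHomogeneousMap.comp c.π_homogeneous hh').zsmul ((-1) ^ (m + 1)))⟩ h1
    have h4 : c.delta (m + 1 + 1) = ((-1 : ℤ) ^ (m + 1) • c.π ∘ₗ dPrime D ∘ₗ c.h) ∘ₗ
        ((dPrime D ∘ₗ c.h) ^ m : Module.End (Poly k n) (LMod D)) ∘ₗ dPrime D ∘ₗ c.ι := by
      rw [Contraction.delta, Nat.add_sub_cancel, pow_succ' (dPrime D ∘ₗ c.h)]
      rfl
    rw [h4]
    exact h2

end Deltas

/-! ### Quasi-isomorphisms and projection to terms -/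

section QuasiIso

universe u₁ u₂ u₃

variable {k : Type uk} [Field k] {n : ℕ} {A : Type uA} [AddCommGroup A] [DecidableEq A]
variable {w : Fin (n + 1) → A}

/-- The projection of `M` onto the term `M_j`. -/
def GrMod.termProj (M : GrMod.{u} k w) (j : ℤ) : M →ₗ[k] M :=
  DirectSum.toModule k (A × ℤ) M (fun d => if d.2 = j then (M.gr d).subtype else 0) ∘ₗ
    (decomp M.isInternal).toLinearMap

theorem GrMod.termProj_of_mem (M : GrMod.{u} k w) (j : ℤ) {d : A × ℤ} {m : M} (hm : m ∈ M.gr d) :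
    M.termProj j m = if d.2 = j then m else 0 := by
  rw [GrMod.termProj, LinearMap.comp_apply, LinearEquiv.coe_coe, decomp_of_mem _ hm,
    DirectSum.toModule_lof]
  split_ifs <;> rfl

theorem GrMod.termProj_mem (M : GrMod.{u} k w) (j : ℤ) (m : M) : M.termProj j m ∈ M.term j := by
  refine grading_induction M.isInternal (P := fun m => M.termProj j m ∈ M.term j) ?_ ?_ ?_ m
  · rw [map_zero]
    exact zero_mem _
  · intro x y hx hy
    rw [map_add]
    exact add_mem hx hy
  · rintro ⟨a, j'⟩ m hm
    rw [M.termProj_of_mem j hm]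
    split_ifs with h
    · obtain rfl : j' = j := h
      exact Submodule.mem_iSup_of_mem (p := fun a => M.gr (a, j')) a hm
    · exact zero_mem _

theorem GrMod.termProj_of_mem_term (M : GrMod.{u} k w) {j : ℤ} {m : M} (hm : m ∈ M.term j) :
    M.termProj j m = m := by
  refine Submodule.iSup_induction _ (motive := fun m => M.termProj j m = m) hm ?_ ?_ ?_
  · intro a m hm
    rw [M.termProj_of_mem j hm, if_pos rfl]
  · rw [map_zero]
  · intro x y hx hy
    rw [map_add, hx, hy]

theorem Cpx.termProj_d (C : Cpx.{u} k w) (j : ℤ) (m : C.toGrMod) :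
    C.toGrMod.termProj j (C.d m) = C.d (C.toGrMod.termProj (j + 1) m) := by
  have : C.toGrMod.termProj j ∘ₗ C.d.restrictScalars k =
      C.d.restrictScalars k ∘ₗ C.toGrMod.termProj (j + 1) := by
    refine linearMap_ext_grading C.toGrMod.isInternal ?_
    rintro ⟨a, j'⟩ m hm
    have h1 := C.isDifferential.homogeneous a j' m hm
    simp only [LinearMap.comp_apply, LinearMap.restrictScalars_apply]
    rw [C.toGrMod.termProj_of_mem _ h1, C.toGrMod.termProj_of_mem _ hm]
    by_cases h : j' = j + 1
    · rw [if_pos h, if_pos (by rw [h]; ring)]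
    · rw [if_neg h, if_neg (fun h' => h (by simp only at h'; linarith)), map_zero]
  exact LinearMap.congr_fun this m

theorem IsHomogeneousMap.mem_term {M : GrMod.{u₁} k w} {N : GrMod.{u₂} k w}
    {f : M →ₗ[Poly k n] N} (hf : ∀ (a : A) (j : ℤ), ∀ m ∈ M.gr (a, j), f m ∈ N.gr (a, j))
    {j : ℤ} {m : M} (hm : m ∈ M.term j) : f m ∈ N.term j := by
  refine (iSup_le fun a x hx => ?_ : M.term j ≤ (N.term j).comap (f.restrictScalars k)) hm
  exact Submodule.mem_iSup_of_mem (p := fun a => N.gr (a, j)) a (hf a j x hx)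

theorem IsQuasiIso.homologicallyBoundedBelow {C : Cpx.{u₁} k w} {C' : Cpx.{u₂} k w}
    {φ : C.toGrMod →ₗ[Poly k n] C'.toGrMod} (hφ : IsQuasiIso φ)
    (h : C'.HomologicallyBoundedBelow) : C.HomologicallyBoundedBelow := by
  obtain ⟨m, hm⟩ := h
  refine ⟨m, fun j hj x hx hdx => ?_⟩
  have h0 : ∀ (a : A) (j : ℤ), ∀ m ∈ C.toGrMod.gr (a, j), φ m ∈ C'.toGrMod.gr (a, j) := by
    intro a j m hm
    have := hφ.homogeneous a j m hm
    rwa [add_zero] at this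
  obtain ⟨y, -, hy⟩ := hm j hj (φ x) (IsHomogeneousMap.mem_term h0 hx)
    (by rw [← hφ.comm, hdx, map_zero])
  obtain ⟨z, hz⟩ := hφ.injective x hdx ⟨y, hy⟩
  -- The preimage z need not be concentrated in one homological degree; its part in degree j + 1 has
  -- the same boundary x.
  refine ⟨C.toGrMod.termProj (j + 1) z, C.toGrMod.termProj_mem _ _, ?_⟩
  rw [← C.termProj_d, hz, C.toGrMod.termProj_of_mem_term hx]

theorem IsQuasiIso.comp {C : Cpx.{u₁} k w} {C' : Cpx.{u₂} k w} {C'' : Cpx.{u₃} k w}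
    {φ : C.toGrMod →ₗ[Poly k n] C'.toGrMod} {ψ : C'.toGrMod →ₗ[Poly k n] C''.toGrMod}
    (hψ : IsQuasiIso ψ) (hφ : IsQuasiIso φ) : IsQuasiIso (ψ ∘ₗ φ) where
  homogeneous := by
    intro a j x hx
    have := hψ.homogeneous _ _ _ (hφ.homogeneous a j x hx)
    rw [add_zero] at this
    exact this
  comm x := by rw [LinearMap.comp_apply, LinearMap.comp_apply, hφ.comm, hψ.comm]
  injective x hx h := hφ.injective x hx
    (hψ.injective (φ x) (by rw [← hφ.comm, hx, map_zero]) h)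
  surjective z hz := by
    obtain ⟨y, hy, hyz⟩ := hψ.surjective z hz
    obtain ⟨x, hx, v, hv⟩ := hφ.surjective y hy
    refine ⟨x, hx, ?_⟩
    have h1 : z - (ψ ∘ₗ φ) x = (z - ψ y) + C''.d (ψ v) := by
      rw [← hψ.comm, hv, map_sub, LinearMap.comp_apply]
      abel
    rw [h1]
    exact add_mem hyz ⟨_, rfl⟩

end QuasiIso

/-! ### The perturbed complex as a minimal resolution -/

section Resolution

variable {k : Type uk} [Field k] {n : ℕ} {A : Type uA} [AddCommGroup A] [DecidableEq A]
variable {w : Fin (n + 1) → A} {D : DiffMod.{u} k w}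

/-- The condition that the perturbation series of the contraction is locally finite. -/
abbrev Contraction.IsLocallyNilpotent (c : Contraction (Lbar D) (Lbar (H D))) : Prop :=
  ∀ x, ∃ m, ((dPrime D ∘ₗ c.h : Module.End (Poly k n) (LMod D)) ^ m) x = 0

namespace Contraction

variable {c : Contraction (Lbar D) (Lbar (H D))}

/-- The operator `∑ (-1) ^ i (dPrime h) ^ i dPrime`. -/
def transfer (hn : c.IsLocallyNilpotent) : LMod D →ₗ[Poly k n] LMod D :=
  geomInv (dPrime D ∘ₗ c.h) hn ∘ₗ dPrime D

theorem perturbation (hn : c.IsLocallyNilpotent) :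
    Perturbation (dInternal D) (dPrime D) c.h (transfer hn) c.π c.ι where
  sq x := by
    have h1 := LinearMap.congr_fun (dPrime_dPrime D) x
    have h2 := LinearMap.congr_fun (dPrime_dInternal D) x
    simp only [LinearMap.comp_apply, LinearMap.zero_apply, LinearMap.add_apply] at h1 h2
    rw [h1, zero_add]
    exact (add_comm _ _).trans h2
  π_d := c.π_dInternal
  d_ι := c.dInternal_ι
  π_ι := c.π_ι
  homotopy := c.homotopy
  π_h := c.π_h
  h_ι := c.h_ι
  h_h := c.h_h
  eq_left x := geomInv_add_apply_geomInv hn (dPrime D x)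
  eq_right x := geomInv_add_geomInv_apply hn (dPrime D x)

theorem transfer_homogeneous (hn : c.IsLocallyNilpotent) :
    IsHomogeneousMap (M := LMod D) (N := LMod D) (transfer hn) (-1) := by
  intro a j x hx
  refine geomInv_mem hn ((LMod D).gr (a, j + -1)).toAddSubgroup (fun y hy => ?_)
    (dPrime_homogeneous D a j x hx)
  have := dPrime_homogeneous D _ _ _ (c.h_homogeneous _ _ _ hy)
  rwa [add_neg_cancel_right] at this

theorem delta_succ_eq_zero {x : LMod (H D)} {m : ℕ}
    (hm : ((dPrime D ∘ₗ c.h : Module.End (Poly k n) (LMod D)) ^ m) (dPrime D (c.ι x)) = 0)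
    {i : ℕ} (hi : m ≤ i) : c.delta (i + 1) x = 0 := by
  change (-1 : ℤ) ^ i • c.π (((dPrime D ∘ₗ c.h : Module.End (Poly k n) (LMod D)) ^ i)
    (dPrime D (c.ι x))) = 0
  rw [pow_apply_eq_zero_of_le _ hm hi, map_zero, smul_zero]

theorem finite_delta_ne_zero (hn : c.IsLocallyNilpotent) (x : LMod (H D)) :
    {i | c.delta i x ≠ 0}.Finite := by
  obtain ⟨m, hm⟩ := hn (dPrime D (c.ι x))
  -- The index 0 is included as well; there the truncated i - 1 makes δ_0 equal to δ_1.
  refine (Set.finite_Iic m).subset fun i hi => ?_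
  by_contra hmi
  obtain ⟨i, rfl⟩ : ∃ l, i = l + 1 := Nat.exists_eq_add_of_lt (not_le.1 hmi) |>.imp'
    (fun l => m + l) (fun l hl => by omega)
  exact hi (delta_succ_eq_zero hm (by simpa [Nat.lt_succ_iff] using hmi))

/-- The perturbed differential on `L(H(D))`. -/
def resDiff (hn : c.IsLocallyNilpotent) : LMod (H D) →ₗ[Poly k n] LMod (H D) :=
  c.π ∘ₗ transfer hn ∘ₗ c.ι

theorem resDiff_apply (hn : c.IsLocallyNilpotent) (hc : c.IsCanonical) (x : LMod (H D)) :
    resDiff hn x = (L (H D)).d x + ∑ᶠ i : ℕ, c.delta (i + 2) x := by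
  obtain ⟨m, hm⟩ := hn (dPrime D (c.ι x))
  have h1 : (L (H D)).d x = c.delta 1 x := by
    rw [c.delta_one hc]
    change dPrime (H D) x + dInternal (H D) x = _
    rw [dInternal_H, LinearMap.zero_apply, add_zero]
  have h2 : ∑ᶠ i : ℕ, c.delta (i + 2) x = ∑ i ∈ Finset.range m, c.delta (i + 1 + 1) x := by
    refine finsum_eq_sum_of_support_subset _ fun i hi => ?_
    rw [Finset.coe_range, Set.mem_Iio]
    by_contra hmi
    exact hi (delta_succ_eq_zero hm (by omega))
  have h3 : resDiff hn x = ∑ i ∈ Finset.range (m + 1), c.delta (i + 1) x := by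
    have h4 : transfer hn (c.ι x) = ∑ i ∈ Finset.range (m + 1), (-1 : ℤ) ^ i •
        ((dPrime D ∘ₗ c.h : Module.End (Poly k n) (LMod D)) ^ i) (dPrime D (c.ι x)) :=
      finsum_pow_eq_sum _ hm m.le_succ
    refine (congrArg c.π h4).trans ?_
    rw [map_sum]
    refine Finset.sum_congr rfl fun i _ => ?_
    rw [map_zsmul]
    rfl
  -- The term of index 0 of the series πTι is δ_1, that is, the differential of L(H(D)); the others
  -- are the δ_i with i ≥ 2.
  rw [h1, h2, h3, Finset.sum_range_succ', add_comm]

theorem resDiff_isDifferential (hn : c.IsLocallyNilpotent) :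
    IsDifferential (LMod (H D)) (resDiff hn) where
  homogeneous := by
    intro a j x hx
    have h1 := transfer_homogeneous hn _ _ _ (c.ι_homogeneous a j x hx)
    have h2 := c.π_homogeneous _ _ _ h1
    rw [add_zero, add_zero] at h2
    exact h2
  sq := (perturbation hn).sq_zero

/-- The complex `F`. -/
abbrev resolution (hn : c.IsLocallyNilpotent) : Cpx k w :=
  ⟨LMod (H D), resDiff hn, resDiff_isDifferential hn⟩

theorem dPrime_mem_smul_top (D : DiffMod.{u} k w) (x : LMod D) :
    dPrime D x ∈ Ideal.span (Set.range (MvPolynomial.X : Fin (n + 1) → Poly k n)) •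
      (⊤ : Submodule (Poly k n) (LMod D)) := by
  rw [dPrime_apply]
  exact Submodule.sum_mem _ fun s _ =>
    Submodule.smul_mem_smul (Ideal.subset_span ⟨s, rfl⟩) trivial

theorem map_mem_smul_top {S M N : Type*} [CommRing S] [AddCommGroup M] [Module S M]
    [AddCommGroup N] [Module S N] (I : Ideal S) (f : M →ₗ[S] N) {x : M}
    (hx : x ∈ I • (⊤ : Submodule S M)) : f x ∈ I • (⊤ : Submodule S N) := by
  have := Submodule.mem_map_of_mem (f := f) hx
  rw [Submodule.map_smul''] at this
  exact Submodule.smul_mono le_rfl le_top this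

/-- The differential is an S-linear map applied after ∂'ι, and ∂' takes values in (x_0, …, x_n)
L(D). -/
theorem resolution_isMinimal (hn : c.IsLocallyNilpotent) : (resolution hn).IsMinimal :=
  fun x => map_mem_smul_top _ (c.π ∘ₗ geomInv (dPrime D ∘ₗ c.h) hn)
    (dPrime_mem_smul_top D (c.ι x))

/-- The perturbed inclusion `F → L(D)`. -/
def resInclusion (hn : c.IsLocallyNilpotent) : LMod (H D) →ₗ[Poly k n] LMod D :=
  c.ι - c.h ∘ₗ transfer hn ∘ₗ c.ι

theorem L_d_apply (D : DiffMod.{u} k w) (x : LMod D) :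
    (L D).d x = (dInternal D + dPrime D) x := by
  rw [LinearMap.add_apply, add_comm]
  rfl

/-- The perturbed projection π - πTh is a left inverse and chain map, which gives injectivity on
homology; with the homotopy h - hTh it is also a homotopy inverse, which gives surjectivity. -/
theorem resInclusion_isQuasiIso (hn : c.IsLocallyNilpotent) :
    IsQuasiIso (C := resolution hn) (C' := L D) (resInclusion hn) where
  homogeneous := by
    intro a j x hx
    refine sub_mem (c.ι_homogeneous a j x hx) ?_
    have h1 := c.h_homogeneous _ _ _ (transfer_homogeneous hn _ _ _ (c.ι_homogeneous a j x hx))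
    rw [neg_add_cancel_right] at h1
    exact h1
  comm x := by
    rw [L_d_apply]
    exact ((perturbation hn).ι_comm x).symm
  injective := by
    rintro x hx ⟨y, hy⟩
    rw [L_d_apply] at hy
    refine ⟨c.π y - c.π (transfer hn (c.h y)), ?_⟩
    have h1 := (perturbation hn).π_comm y
    rw [hy] at h1
    exact h1.symm.trans ((perturbation hn).π_ι_perturbed x)
  surjective := by
    intro y hy
    rw [L_d_apply] at hy
    refine ⟨c.π y - c.π (transfer hn (c.h y)), ?_, c.h y - c.h (transfer hn (c.h y)), ?_⟩
    · have h1 := (perturbation hn).π_comm y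
      rw [hy, map_zero, map_zero, map_zero, map_zero, sub_zero] at h1
      exact h1.symm
    · have h1 := (perturbation hn).homotopy_perturbed y
      rw [hy, map_zero, map_zero, map_zero, sub_zero, add_zero] at h1
      rw [L_d_apply]
      exact h1.symm

end Contraction

end Resolution

end

end MultigradedBGG

/-! ### The main theorem -/

theorem mainTheorem2 {k : Type*} [Field k] {A : Type*} [AddCommGroup A] [DecidableEq A] {n : ℕ}
    (w : Fin (n + 1) → A) (hw : ∃ θ : A →+ ℤ, IsPositive w θ)
    (G : Cpx k w) (hG : G.HomologicallyBoundedBelow) (hG' : G.toGrMod.TermsBoundedBelow)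
    (c : Contraction (Lbar (R G)) (Lbar (H (R G)))) (hc : c.IsCanonical) :
    -- the sum of the `δ_i` is locally finite
    (∀ x, {i | c.delta i x ≠ 0}.Finite) ∧
    -- the perturbed complex is a minimal free resolution of `G`
    (∃ (dF : LMod (H (R G)) →ₗ[Poly k n] LMod (H (R G)))
        (hdF : IsDifferential (LMod (H (R G))) dF),
      (∀ x, dF x = (L (H (R G))).d x + ∑ᶠ i : ℕ, c.delta (i + 2) x) ∧
      IsMinimalFreeResolution ⟨LMod (H (R G)), dF, hdF⟩ G) ∧
    -- its terms vanish in low homological degrees, and are uniformly bounded below in `A`-degrees,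
    -- when those of `G` are
    (∀ m : ℤ, (∀ j < m, G.toGrMod.term j = ⊥) → ∀ j < m, (LMod (H (R G))).term j = ⊥) ∧
    (∀ θ : A →+ ℤ, IsPositive w θ → ∀ N : ℤ, (∀ a j, θ a < N → G.toGrMod.gr (a, j) = ⊥) →
      ∀ a j, θ a < N → (LMod (H (R G))).gr (a, j) = ⊥) ∧
    -- each `δ_i` is an `i`-fold composition of strongly linear maps, and even one with respect to
    -- fixed bases when the contraction is extended from `k`
    (∀ i, 1 ≤ i → IsStronglyLinearComp i (c.delta i)) ∧
    (c.IsExtended → ∃ (I : Type _) (b : Module.Basis I (Poly k n) (LMod (H (R G)))),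
      ∀ i, 1 ≤ i → IsLinearChain i b b (c.delta i)) := by
  obtain ⟨θ, hθ, hGθ⟩ := hG'
  have hD := R_boundedBelow G hθ hGθ
  have hn : c.IsLocallyNilpotent := dPrime_comp_locallyNilpotent (R G) hθ hD c.h_homogeneous
  -- The augmentation of the resolution is the composite F → L(R(G)) → G; it also transfers the
  -- vanishing of homology in low degrees from G to F.
  have hq := (counit_isQuasiIso G).comp (Contraction.resInclusion_isQuasiIso hn)
  refine ⟨Contraction.finite_delta_ne_zero hn, ⟨Contraction.resDiff hn,
    Contraction.resDiff_isDifferential hn, Contraction.resDiff_apply hn hc,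
    LMod_isGradedFree (H (R G)), Contraction.resolution_isMinimal hn,
    hq.homologicallyBoundedBelow hG, termsBoundedBelow_LMod_H (R G) hθ hD, _, hq⟩, ?_, ?_,
    c.delta_isStronglyLinearComp hc, c.delta_isLinearChain⟩
  · intro m hm j hj
    refine LMod_term_eq_bot _ fun a => H_gr_eq_bot _ (R_gr_eq_bot G fun q hq => ?_)
    -- Components of ω_E have auxiliary degree q.2 ≥ 0, so degree j of R(G) only involves terms of G
    -- of degree at most j.
    have h1 := hm (j - q.2) (by linarith [(omegaGr_nonneg hq).1])
    exact eq_bot_iff.2 ((le_iSup (fun a => G.toGrMod.gr (a, j - q.2)) (a - q.1)).trans h1.le)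
  -- The homomorphism θ' is arbitrary here and need not be the one that bounds the terms of G. Both
  -- S and ω_E have nonnegative θ'-degrees, so the same N works.
  · intro θ' hθ' N hN a j ha
    refine LMod_gr_eq_bot _ hθ' fun a' ha' => H_gr_eq_bot _ (R_gr_eq_bot G fun q hq => ?_)
    refine hN (a' - q.1) (j - q.2) ?_
    rw [map_sub]
    linarith [(omegaGr_nonneg hq).2 θ' hθ']
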